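/- Let $\mathbb K=\mathbb R$ or $\mathbb C$; manifolds are Hausdorff, of class smooth ($\mathbb K=\mathbb R$), real analytic ($\mathbb K=\mathbb R$) or holomorphic ($\mathbb K=\mathbb C$), not necessarily connected or second countable, and all tensors and maps are of the same class. A Jacobi manifold $(M,\pi_M,E_M)$ is a manifold with a bivector field $\pi_M$ and a vector field $E_M$ such that $[\pi_M,\pi_M]=2E_M\wedge\pi_M$ and $[E_M,\pi_M]=0$, where $[\pi,\pi](df,dg,dh)=2\big(\{\{f,g\},h\}+\{\{g,h\},f\}+\{\{h,f\},g\}\big)$ with $\{f,g\}=\pi(df,dg)$. If $\dim M=2n+1$, its singular locus is $\{E_M\wedge\pi_M^n=0\}$; a contact manifold of dimension $2n+1$ is viewed as a Jacobi manifold with empty singular locus. A Jacobi morphism is a map $\varphi$ with $\wedge^2T\varphi(\pi_\Sigma)=\pi_M\circ\varphi$ and $T\varphi(E_\Sigma)=E_M\circ\varphi$. A contact resolution of $(M,\pi_M,E_M)$ is a contact manifold $\Sigma$ of dimension $\dim M$ with a surjective Jacobi morphism $\varphi:\Sigma\to M$. A homogeneous Poisson manifold $(P,\pi_P,Z_P)$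 is a manifold with a bivector field $\pi_P$, $[\pi_P,\pi_P]=0$, and a complete vector field $Z_P$ (it generates a global flow with time in $\mathbb K$) such that $L_{Z_P}\pi_P=-\pi_P$. If $\dim P=2m$, the singular locus is $\{\pi_P^m=0\}$, and $P$ is symplectic if it is empty. A homogeneous symplectic resolution of $(P,\pi_P,Z_P)$ is a homogeneous Poisson manifold $(\widetilde\Sigma,\pi_{\widetilde\Sigma},Z_{\widetilde\Sigma})$ that is symplectic and of dimension $\dim P$, with a surjective map $\widetilde\varphi:\widetilde\Sigma\to P$ such that $\wedge^2T\widetilde\varphi(\pi_{\widetilde\Sigma})=\pi_P\circ\widetilde\varphi$ and $T\widetilde\varphi(Z_{\widetilde\Sigma})=Z_P\circ\widetilde\varphi$. The poissonification of $(M,\pi_M,E_M)$ is $P=M\times\mathbb K$ with $Z_P=\partial/\partial t$ and $\pi_P=e^{-t}(\pi_M+Z_P\wedge E_M)$, where $t$ is the coordinate on $\mathbb K$. A resolution is proper if its map is proper, semi-connected if its map sends no connected component of its source into the singular locus of its target, and separable if its source is separable. Proposition. Let $(M,\pi_M,E_M)$ be a smooth (resp. real analytic, resp. holomorphic) Jacobi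 manifold of dimension $2n+1$, with poissonification $(P,\pi_P,Z_P)$. Then: 1. $(M,\pi_M,E_M)$ admits a proper contact resolution if and only if $(P,\pi_P,Z_P)$ admits a proper homogeneous symplectic resolution; 2. $(M,\pi_M,E_M)$ admits a semi-connected contact resolution if and only if $(P,\pi_P,Z_P)$ admits a semi-connected homogeneous symplectic resolution; 3. $(M,\pi_M,E_M)$ admits a separable contact resolution if and only if $(P,\pi_P,Z_P)$ admits a separable homogeneous symplectic resolution, and the same holds with "second countable" in place of "separable". -/

import Mathlib

open scoped Manifold ContDiff

universe uE u v

namespace JacobiGeometry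

/-! ### Vector fields and bivector fields

`𝕜` is `ℝ` or `ℂ`; manifolds of class `C^k` over `𝕜` are smooth real (`𝕜 = ℝ`, `k = ∞`), real
analytic (`𝕜 = ℝ`, `k = ω`) or complex (`𝕜 = ℂ`, `k = ∞` or `k = ω`) manifolds. All conditions are
tested on `𝕜`-valued functions of class `C^k` on open subsets. -/

section Tensors

variable {𝕜 : Type} [RCLike 𝕜]
  {E : Type*} [NormedAddCommGroup E] [NormedSpace 𝕜 E]
  {H : Type*} [TopologicalSpace H] (I : ModelWithCorners 𝕜 E H)
  {M : Type*} [TopologicalSpace M] [ChartedSpace H M]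

/-- A (not necessarily regular) vector field on `M`. -/
abbrev VField (M : Type*) [TopologicalSpace M] [ChartedSpace H M] : Type _ :=
  ∀ x : M, TangentSpace I x

/-- A (not necessarily regular) bivector field on `M`: a section of `⋀² TM`. -/
abbrev BField (M : Type*) [TopologicalSpace M] [ChartedSpace H M] : Type _ :=
  ∀ x : M, ⋀[𝕜]^2 (TangentSpace I x)

/-- The differential of the function `f` at `x`, as a covector. -/
noncomputable def dAt (f : M → 𝕜) (x : M) : Module.Dual 𝕜 (TangentSpace I x) :=
  (mfderiv I 𝓘(𝕜, 𝕜) f x : TangentSpace I x →L[𝕜] 𝕜).toLinearMap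

/-- The function `X[f] = df(X)`. -/
noncomputable def derive (X : VField I M) (f : M → 𝕜) : M → 𝕜 :=
  fun x => dAt I f x (X x)

/-- The function `{f, g} = π(df, dg)`, where
`(u ∧ v)(α, β) = α(u) β(v) - α(v) β(u)`. -/
noncomputable def bracket (π : BField I M) (f g : M → 𝕜) : M → 𝕜 :=
  fun x => exteriorPower.pairingDual 𝕜 (TangentSpace I x) 2
    (exteriorPower.ιMulti 𝕜 2 ![dAt I f x, dAt I g x]) (π x)

/-- `X` is of class `C^k`: it sends local `C^k` functions to `C^k` functions. -/
def IsCkVField (k : WithTop ℕ∞) (X : VField I M) : Prop :=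
  ∀ U : Set M, IsOpen U → ∀ f : M → 𝕜, ContMDiffOn I 𝓘(𝕜, 𝕜) k f U →
    ContMDiffOn I 𝓘(𝕜, 𝕜) k (derive I X f) U

/-- `π` is of class `C^k`: `π(df, dg)` is `C^k` for all local `C^k` functions `f, g`. -/
def IsCkBField (k : WithTop ℕ∞) (π : BField I M) : Prop :=
  ∀ U : Set M, IsOpen U → ∀ f g : M → 𝕜, ContMDiffOn I 𝓘(𝕜, 𝕜) k f U →
    ContMDiffOn I 𝓘(𝕜, 𝕜) k g U → ContMDiffOn I 𝓘(𝕜, 𝕜) k (bracket I π f g) U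

/-- The Schouten square `[π, π]`, evaluated on `df, dg, dh`. -/
noncomputable def schoutenSquare (π : BField I M) (f g h : M → 𝕜) : M → 𝕜 :=
  fun x => 2 * (bracket I π (bracket I π f g) h x + bracket I π (bracket I π g h) f x +
    bracket I π (bracket I π h f) g x)

/-- The trivector field `X ∧ π`, evaluated on `df, dg, dh`. -/
noncomputable def wedgeVB (X : VField I M) (π : BField I M) (f g h : M → 𝕜) : M → 𝕜 :=
  fun x => derive I X f x * bracket I π g h x + derive I X g x * bracket I π h f x +
    derive I X h x * bracket I π f g x

/-- The Lie derivative `[X, π] = L_X π`, evaluated on `df, dg`. -/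
noncomputable def lieB (X : VField I M) (π : BField I M) (f g : M → 𝕜) : M → 𝕜 :=
  fun x => derive I X (bracket I π f g) x - bracket I π (derive I X f) g x -
    bracket I π f (derive I X g) x

/-- `(π, X)` is a Jacobi structure of class `C^k`: `[π, π] = 2 X ∧ π` and `[X, π] = 0`. -/
structure IsJacobi (k : WithTop ℕ∞) (π : BField I M) (X : VField I M) : Prop where
  bivector_ck : IsCkBField I k π
  field_ck : IsCkVField I k X
  schouten : ∀ U : Set M, IsOpen U → ∀ f g h : M → 𝕜, ContMDiffOn I 𝓘(𝕜, 𝕜) k f U →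
    ContMDiffOn I 𝓘(𝕜, 𝕜) k g U → ContMDiffOn I 𝓘(𝕜, 𝕜) k h U →
    ∀ x ∈ U, schoutenSquare I π f g h x = 2 * wedgeVB I X π f g h x
  lie : ∀ U : Set M, IsOpen U → ∀ f g : M → 𝕜, ContMDiffOn I 𝓘(𝕜, 𝕜) k f U →
    ContMDiffOn I 𝓘(𝕜, 𝕜) k g U → ∀ x ∈ U, lieB I X π f g x = 0

/-- `π` is a Poisson structure of class `C^k`: `[π, π] = 0`. -/
structure IsPoisson (k : WithTop ℕ∞) (π : BField I M) : Prop where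
  bivector_ck : IsCkBField I k π
  schouten : ∀ U : Set M, IsOpen U → ∀ f g h : M → 𝕜, ContMDiffOn I 𝓘(𝕜, 𝕜) k f U →
    ContMDiffOn I 𝓘(𝕜, 𝕜) k g U → ContMDiffOn I 𝓘(𝕜, 𝕜) k h U →
    ∀ x ∈ U, schoutenSquare I π f g h x = 0

/-- `Z` is complete: it is the infinitesimal generator of a global flow, i.e. of a `C^k` action of
the additive group `𝕜` on `M` (in the complex case, the time is complex). -/
def IsCompleteVField (k : WithTop ℕ∞) (Z : VField I M) : Prop :=
  ∃ Φ : 𝕜 → M → M,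
    ContMDiff (𝓘(𝕜, 𝕜).prod I) I k (fun p : 𝕜 × M => Φ p.1 p.2) ∧
    (∀ x, Φ 0 x = x) ∧ (∀ s t x, Φ (s + t) x = Φ s (Φ t x)) ∧
    ∀ t x, HasMFDerivAt 𝓘(𝕜, 𝕜) I (fun s => Φ s x) t
      ((1 : 𝕜 →L[𝕜] 𝕜).smulRight (Z (Φ t x)))

/-- `(π, Z)` is a homogeneous Poisson structure of class `C^k`: `π` is Poisson, `Z` is a complete
vector field, and `L_Z π = - π`. -/
structure IsHomogeneousPoisson (k : WithTop ℕ∞) (π : BField I M) (Z : VField I M) : Prop where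
  poisson : IsPoisson I k π
  field_ck : IsCkVField I k Z
  complete : IsCompleteVField I k Z
  homogeneous : ∀ U : Set M, IsOpen U → ∀ f g : M → 𝕜, ContMDiffOn I 𝓘(𝕜, 𝕜) k f U →
    ContMDiffOn I 𝓘(𝕜, 𝕜) k g U → ∀ x ∈ U, lieB I Z π f g x = - bracket I π f g x

/-- The singular locus of `(π, X)` in dimension `2n+1`: the points where `X ∧ π^n = 0`. -/
def jacobiSing (n : ℕ) (π : BField I M) (X : VField I M) : Set M :=
  {x | ExteriorAlgebra.ι 𝕜 (X x) * (π x : ExteriorAlgebra 𝕜 (TangentSpace I x)) ^ n = 0}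

/-- The singular locus of `π` in dimension `2m`: the points where `π^m = 0`. -/
def poissonSing (m : ℕ) (π : BField I M) : Set M :=
  {x | (π x : ExteriorAlgebra 𝕜 (TangentSpace I x)) ^ m = 0}

end Tensors

/-! ### Poissonification -/

section Poissonification

variable {𝕜 : Type} [RCLike 𝕜]
  {E : Type*} [NormedAddCommGroup E] [NormedSpace 𝕜 E]
  {H : Type*} [TopologicalSpace H] (I : ModelWithCorners 𝕜 E H)
  {M : Type*} [TopologicalSpace M] [ChartedSpace H M]

/-- The inclusion `T_x M → T_(x,t) (M × 𝕜) = T_x M × T_t 𝕜`. -/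
noncomputable def horizontal (p : M × 𝕜) :
    TangentSpace I p.1 →ₗ[𝕜] TangentSpace (I.prod 𝓘(𝕜, 𝕜)) p :=
  LinearMap.inl 𝕜 (TangentSpace I p.1) (TangentSpace 𝓘(𝕜, 𝕜) p.2)

/-- The vector field `Z = ∂/∂t` on `M × 𝕜`. -/
noncomputable def poissonificationField : VField (I.prod 𝓘(𝕜, 𝕜)) (M × 𝕜) :=
  fun p => LinearMap.inr 𝕜 (TangentSpace I p.1) (TangentSpace 𝓘(𝕜, 𝕜) p.2) (1 : 𝕜)

/-- The bivector field `exp(t)⁻¹ (π + Z ∧ X)` on `M × 𝕜`. -/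
noncomputable def poissonificationBivector (π : BField I M) (X : VField I M) :
    BField (I.prod 𝓘(𝕜, 𝕜)) (M × 𝕜) :=
  fun p => (NormedSpace.exp p.2)⁻¹ •
    (exteriorPower.map 2 (horizontal I p) (π p.1) +
      exteriorPower.ιMulti 𝕜 2 ![poissonificationField I p, horizontal I p (X p.1)])

end Poissonification

/-! ### Resolutions -/

section Resolutions

variable {𝕜 : Type} [RCLike 𝕜]
  {E : Type*} [NormedAddCommGroup E] [NormedSpace 𝕜 E]
  {H : Type*} [TopologicalSpace H] (I : ModelWithCorners 𝕜 E H)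
  {M : Type*} [TopologicalSpace M] [ChartedSpace H M]

/-- A contact resolution `(Σ, φ)` of class `C^k` of `(M, π, X)`, `dim M = 2n+1`. Here `Σ` (the field
`carrier`) is a Hausdorff manifold modelled on the same space as `M`, hence of the same dimension,
its contact structure is given as a Jacobi structure `(bivector, reeb)` such that
`reeb ∧ bivector ^ n` vanishes nowhere, and `φ` is a surjective Jacobi morphism.
No countability is required of `Σ`. -/
structure ContactResolution (k : WithTop ℕ∞) (n : ℕ) (π : BField I M) (X : VField I M) where
  carrier : Type v
  [topology : TopologicalSpace carrier]
  [charted : ChartedSpace H carrier]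
  [manifold : IsManifold I k carrier]
  [hausdorff : T2Space carrier]
  bivector : BField I carrier
  reeb : VField I carrier
  jacobi : IsJacobi I k bivector reeb
  contact : ∀ s, s ∉ jacobiSing I n bivector reeb
  φ : carrier → M
  φ_ck : ContMDiff I I k φ
  φ_surjective : Function.Surjective φ
  φ_bivector : ∀ s, exteriorPower.map 2 (mfderiv I I φ s).toLinearMap (bivector s) = π (φ s)
  φ_reeb : ∀ s, mfderiv I I φ s (reeb s) = X (φ s)

attribute [instance] ContactResolution.topology ContactResolution.charted
  ContactResolution.manifold ContactResolution.hausdorff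

/-- A homogeneous symplectic resolution `(Σ, φ)` of class `C^k` of the homogeneous Poisson manifold
`(P, π, Z)`, `dim P = 2m`. Here `Σ` (the field `carrier`) is a Hausdorff manifold of the same
dimension as `P`, its symplectic structure is given as a Poisson structure such that
`bivector ^ m` vanishes nowhere, `φ` is a surjective Poisson morphism, and `Σ` is homogeneous
through a complete vector field `field` that projects onto `Z`. -/
structure HomogeneousSymplecticResolution (k : WithTop ℕ∞) (m : ℕ)
    (π : BField I M) (Z : VField I M) where
  carrier : Type v
  [topology : TopologicalSpace carrier]
  [charted : ChartedSpace H carrier]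
  [manifold : IsManifold I k carrier]
  [hausdorff : T2Space carrier]
  bivector : BField I carrier
  field : VField I carrier
  homogeneousPoisson : IsHomogeneousPoisson I k bivector field
  symplectic : ∀ s, s ∉ poissonSing I m bivector
  φ : carrier → M
  φ_ck : ContMDiff I I k φ
  φ_surjective : Function.Surjective φ
  φ_bivector : ∀ s, exteriorPower.map 2 (mfderiv I I φ s).toLinearMap (bivector s) = π (φ s)
  φ_field : ∀ s, mfderiv I I φ s (field s) = Z (φ s)

attribute [instance] HomogeneousSymplecticResolution.topology
  HomogeneousSymplecticResolution.charted HomogeneousSymplecticResolution.manifold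
  HomogeneousSymplecticResolution.hausdorff

end Resolutions

/-- No connected component of `S` is mapped by `φ` into `Z`. -/
def SemiConnected {S M : Type*} [TopologicalSpace S] (φ : S → M) (Z : Set M) : Prop :=
  ∀ s : S, ¬ φ '' connectedComponent s ⊆ Z

end JacobiGeometry

/-! Write `E` for the vector field of the Jacobi structure, `Z = ∂/∂t`, and `τ` for the
`𝕜`-component of a homogeneous symplectic resolution.

From contact to symplectic, a contact resolution `φ : Σ → M` is replaced by `φ × id : Σ × 𝕜 → M ×
𝕜`, with the poissonification of `Σ` as source. In degree `2n+2` one has `(π + Z ∧ E)^(n+1) = (n+1)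
Z ∧ E ∧ π^n`, because `Z ∧ E` squares to zero and `π^(n+1)` vanishes on a space of dimension `2n+1`.
Hence the poissonification is symplectic exactly where the Jacobi structure is contact, and the
singular locus of `P` is the product of that of `M` with `𝕜` (`symplectization_pow_eq_zero_iff`).

Conversely, let `φ : N → M × 𝕜` be a homogeneous symplectic resolution with bivector `Λ`. Its
homogeneity field projects to `Z`, so `τ` grows at unit speed along the complete flow. Therefore `τ`
is a submersion, `S = τ⁻¹(0)` is a hypersurface, and following the flow for time `-τ` gives a
retraction `r : N → S`. The bivector of `S` is the pushforward of `Λ` by `r`, and its Reeb field is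
the pushforward of the contraction of `Λ` with `dτ`. Homogeneity gives `{f ∘ r, g ∘ r} = exp(-τ)
({f, g} ∘ r)`. Differentiating the factor `exp(τ)` produces the correction `E ∧ π`, so the Jacobi
identity of `Λ` on pullbacks becomes the first Jacobi equation, and on two pullbacks and `τ` it
becomes `[E, π] = 0` (`isJacobi_slice`). At the points of `S`, `Λ = π + Z ∧ E`, so the same linear
algebra shows that `S` is contact. The `M`-component of `φ` is constant along the flow, hence its
restriction to `S` is still onto and is a Jacobi morphism.

Each topological property follows from one of two facts: `S` is closed in `N`, and `r` is a
continuous retraction onto `S`.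

Tensors are described through their action on functions. Their equations are therefore first shown
to depend only on first derivatives (`schoutenSquare_eq_linCoord`, `lieB_eq_linCoord`), so that on
`M × 𝕜` it suffices to test functions of the form `f(x) + c t`. -/

namespace JacobiGeometry

set_option maxSynthPendingDepth 3

/-! ### Linear algebra of bivectors and their values on covectors -/

section BivectorAlgebra

variable {K : Type*} [Field K] {V : Type*} [AddCommGroup V] [Module K V]
  {W : Type*} [AddCommGroup W] [Module K W]

/-- The value `π(α, β)` of a bivector on two covectors. -/
noncomputable def bivectorPairing (π : ⋀[K]^2 V) (α β : Module.Dual K V) : K :=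
  exteriorPower.pairingDual K V 2 (exteriorPower.ιMulti K 2 ![α, β]) π

theorem bivectorPairing_add_right (π : ⋀[K]^2 V) (α β γ : Module.Dual K V) :
    bivectorPairing π α (β + γ) = bivectorPairing π α β + bivectorPairing π α γ := by
  have := (exteriorPower.ιMulti K 2 (M := Module.Dual K V)).map_update_add ![α, 0] 1 β γ
  have h (δ : Module.Dual K V) : Function.update ![α, 0] 1 δ = ![α, δ] := by
    funext i; fin_cases i <;> simp
  simp only [h] at this
  simp [bivectorPairing, this]

theorem bivectorPairing_smul_right (π : ⋀[K]^2 V) (c : K) (α β : Module.Dual K V) :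
    bivectorPairing π α (c • β) = c * bivectorPairing π α β := by
  have := (exteriorPower.ιMulti K 2 (M := Module.Dual K V)).map_update_smul ![α, 0] 1 c β
  have h (δ : Module.Dual K V) : Function.update ![α, 0] 1 δ = ![α, δ] := by
    funext i; fin_cases i <;> simp
  simp only [h] at this
  simp [bivectorPairing, this]

theorem bivectorPairing_swap (π : ⋀[K]^2 V) (α β : Module.Dual K V) :
    bivectorPairing π β α = -bivectorPairing π α β := by
  have := (exteriorPower.ιMulti K 2 (M := Module.Dual K V)).map_swap ![α, β]
    (i := 0) (j := 1) (by decide)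
  have h2 : (![α, β] ∘ (Equiv.swap (0 : Fin 2) 1)) = ![β, α] := by
    funext i; fin_cases i <;> simp
  rw [h2] at this
  simp [bivectorPairing, this]

theorem bivectorPairing_add_left (π : ⋀[K]^2 V) (α β γ : Module.Dual K V) :
    bivectorPairing π (α + β) γ = bivectorPairing π α γ + bivectorPairing π β γ := by
  rw [bivectorPairing_swap, bivectorPairing_add_right, bivectorPairing_swap π α,
    bivectorPairing_swap π β]
  ring

theorem bivectorPairing_smul_left (π : ⋀[K]^2 V) (c : K) (α β : Module.Dual K V) :
    bivectorPairing π (c • α) β = c * bivectorPairing π α β := by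
  rw [bivectorPairing_swap, bivectorPairing_smul_right, bivectorPairing_swap π α]
  ring

theorem bivectorPairing_zero_left (π : ⋀[K]^2 V) (β : Module.Dual K V) :
    bivectorPairing π 0 β = 0 := by
  rw [← zero_smul K (0 : Module.Dual K V), bivectorPairing_smul_left, zero_mul]

theorem bivectorPairing_self (π : ⋀[K]^2 V) (α : Module.Dual K V) :
    bivectorPairing π α α = 0 := by
  have : exteriorPower.ιMulti K 2 ![α, α] = 0 :=
    AlternatingMap.map_eq_zero_of_eq _ _ (i := 0) (j := 1) (by simp) (by decide)
  simp [bivectorPairing, this]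

theorem bivectorPairing_add (π ρ : ⋀[K]^2 V) (α β : Module.Dual K V) :
    bivectorPairing (π + ρ) α β = bivectorPairing π α β + bivectorPairing ρ α β := by
  simp [bivectorPairing]

theorem bivectorPairing_smul (c : K) (π : ⋀[K]^2 V) (α β : Module.Dual K V) :
    bivectorPairing (c • π) α β = c * bivectorPairing π α β := by
  simp [bivectorPairing]

theorem bivectorPairing_ιMulti (v w : V) (α β : Module.Dual K V) :
    bivectorPairing (exteriorPower.ιMulti K 2 ![v, w]) α β = α v * β w - α w * β v := by
  simp [bivectorPairing, Matrix.det_fin_two]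
  ring

theorem bivectorPairing_map (f : V →ₗ[K] W) (π : ⋀[K]^2 V) (α β : Module.Dual K W) :
    bivectorPairing (exteriorPower.map 2 f π) α β =
      bivectorPairing π (α ∘ₗ f) (β ∘ₗ f) := by
  have : (exteriorPower.pairingDual K W 2 (exteriorPower.ιMulti K 2 ![α, β])) ∘ₗ
      exteriorPower.map 2 f =
      exteriorPower.pairingDual K V 2 (exteriorPower.ιMulti K 2 ![α ∘ₗ f, β ∘ₗ f]) := by
    ext v
    simp [Matrix.det_fin_two]
  exact LinearMap.congr_fun this π

/-- The coefficients of a bivector in the basis of `⋀² V` induced by a basis of `V` are its values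
on pairs of coordinate covectors. No finiteness of `V` is needed. -/
theorem bivector_ext {π ρ : ⋀[K]^2 V}
    (h : ∀ α β, bivectorPairing π α β = bivectorPairing ρ α β) : π = ρ := by
  classical
  let b := Module.Free.chooseBasis K V
  -- An arbitrary order on the index set, so that pairs of indices can be listed increasingly.
  let _ : LinearOrder (Module.Free.ChooseBasisIndex K V) := linearOrderOfSTO WellOrderingRel
  refine (b.exteriorPower 2).ext_elem fun s => ?_
  rw [exteriorPower.basis_repr_apply, exteriorPower.basis_repr_apply]
  have := h (b.coord (Set.powersetCard.ofFinEmbEquiv.symm s 0))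
    (b.coord (Set.powersetCard.ofFinEmbEquiv.symm s 1))
  have h2 : ![b.coord (Set.powersetCard.ofFinEmbEquiv.symm s 0),
    b.coord (Set.powersetCard.ofFinEmbEquiv.symm s 1)] =
    fun i => b.coord (Set.powersetCard.ofFinEmbEquiv.symm s i) := by
    funext i; fin_cases i <;> simp
  simp only [bivectorPairing, h2] at this
  exact this

/-- Contraction of a bivector with a covector in its first slot. -/
noncomputable def bivectorContract [FiniteDimensional K V] (π : ⋀[K]^2 V)
    (α : Module.Dual K V) : V :=
  (Module.evalEquiv K V).symm
    { toFun := fun β => bivectorPairing π α β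
      map_add' := bivectorPairing_add_right π α
      map_smul' := fun c β => bivectorPairing_smul_right π c α β }

theorem apply_bivectorContract [FiniteDimensional K V] (π : ⋀[K]^2 V)
    (α β : Module.Dual K V) : β (bivectorContract π α) = bivectorPairing π α β := by
  rw [bivectorContract, Module.apply_evalEquiv_symm_apply]
  rfl

end BivectorAlgebra

/-! ### Top powers in the exterior algebra -/

section Nondegeneracy

variable {K : Type*} [Field K] {V : Type*} [AddCommGroup V] [Module K V]
  {W : Type*} [AddCommGroup W] [Module K W]

/-- Contraction is an antiderivation, so it vanishes on the subalgebra generated by vectors that `d`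
kills. -/
theorem contractLeft_map_eq_zero (f : V →ₗ[K] W) (d : Module.Dual K W) (hd : d ∘ₗ f = 0)
    (w : ExteriorAlgebra K V) :
    CliffordAlgebra.contractLeft (Q := (0 : QuadraticForm K W)) d (ExteriorAlgebra.map f w) =
      0 := by
  induction w using CliffordAlgebra.left_induction with
  | algebraMap r =>
    rw [AlgHom.commutes]
    exact CliffordAlgebra.contractLeft_algebraMap _ _ _
  | add x y hx hy => rw [map_add, map_add, hx, hy, add_zero]
  | ι_mul x m hx =>
    rw [map_mul]
    have h1 : ExteriorAlgebra.map f (CliffordAlgebra.ι 0 m) = ExteriorAlgebra.ι K (f m) :=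
      ExteriorAlgebra.map_apply_ι f m
    rw [h1]
    have h2 := CliffordAlgebra.contractLeft_ι_mul (Q := (0 : QuadraticForm K W)) d (f m)
      (ExteriorAlgebra.map f x)
    have h3 : d (f m) = 0 := LinearMap.congr_fun hd m
    rw [hx, h3] at h2
    simpa using h2

/-- Contracting `z ∧ j(w)` with `d` returns `j(w)`, since `d z = 1` and `d` kills the image of `j`.
The left inverse `q` then recovers `w`. -/
theorem ι_mul_map_eq_zero_iff {j : V →ₗ[K] W} {q : W →ₗ[K] V} {d : Module.Dual K W} {z : W}
    (hq : q ∘ₗ j = LinearMap.id) (hd : d ∘ₗ j = 0) (hz : d z = 1) (w : ExteriorAlgebra K V) :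
    ExteriorAlgebra.ι K z * ExteriorAlgebra.map j w = 0 ↔ w = 0 := by
  refine ⟨fun h => ?_, fun h => by simp [h]⟩
  have h2 := CliffordAlgebra.contractLeft_ι_mul (Q := (0 : QuadraticForm K W)) d z
    (ExteriorAlgebra.map j w)
  rw [contractLeft_map_eq_zero _ _ hd, hz] at h2
  have h3 : CliffordAlgebra.ι (0 : QuadraticForm K W) z * ExteriorAlgebra.map j w = 0 := h
  rw [h3] at h2
  have h4 : ExteriorAlgebra.map j w = 0 := by simpa using h2.symm
  have h5 := congrArg (ExteriorAlgebra.map q) h4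
  rw [map_zero, ← AlgHom.comp_apply, ExteriorAlgebra.map_comp_map, hq] at h5
  simpa using h5

theorem coe_exteriorPower_map (f : V →ₗ[K] W) (π : ⋀[K]^2 V) :
    (exteriorPower.map 2 f π : ExteriorAlgebra K W) = ExteriorAlgebra.map f π := by
  have : (⋀[K]^2 W).subtype ∘ₗ exteriorPower.map 2 f =
      (ExteriorAlgebra.map f).toLinearMap ∘ₗ (⋀[K]^2 V).subtype := by
    ext v
    simp only [LinearMap.compAlternatingMap_apply, LinearMap.comp_apply, Submodule.subtype_apply,
      exteriorPower.map_apply_ιMulti, exteriorPower.ιMulti_apply_coe, AlgHom.toLinearMap_apply,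
      ExteriorAlgebra.map_apply_ιMulti]
  exact LinearMap.congr_fun this π

/-- The power has degree `2m`, above the dimension. -/
theorem pow_eq_zero_of_finrank_lt [FiniteDimensional K V] (π : ⋀[K]^2 V) (m : ℕ)
    (h : Module.finrank K V < 2 * m) : (π : ExteriorAlgebra K V) ^ m = 0 := by
  have h1 : (π : ExteriorAlgebra K V) ^ m ∈ ⋀[K]^(2 * m) V := by
    have := Submodule.pow_mem_pow _ π.2 m
    rwa [← pow_mul] at this
  have h2 : Module.finrank K (⋀[K]^(2 * m) V) = 0 := by
    rw [exteriorPower.finrank_eq, Nat.choose_eq_zero_of_lt h]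
  have h3 := Module.finrank_zero_iff.1 h2
  exact congrArg Subtype.val (Subsingleton.elim (⟨_, h1⟩ : ⋀[K]^(2 * m) V) 0)

/-- Moving a vector past a product of two vectors costs two signs. -/
theorem ι_mul_coe_comm (x : V) (π : ⋀[K]^2 V) :
    ExteriorAlgebra.ι K x * (π : ExteriorAlgebra K V) = π * ExteriorAlgebra.ι K x := by
  have : (LinearMap.mulLeft K (ExteriorAlgebra.ι K x)) ∘ₗ (⋀[K]^2 V).subtype =
      (LinearMap.mulRight K (ExteriorAlgebra.ι K x)) ∘ₗ (⋀[K]^2 V).subtype := by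
    ext v
    simp only [LinearMap.compAlternatingMap_apply, LinearMap.comp_apply, Submodule.subtype_apply,
      LinearMap.mulLeft_apply, LinearMap.mulRight_apply, exteriorPower.ιMulti_apply_coe,
      ExteriorAlgebra.ιMulti_apply]
    simp only [List.ofFn_succ, List.ofFn_zero, List.prod_cons, List.prod_nil, mul_one]
    have a := fun y => eq_neg_of_add_eq_zero_left (ExteriorAlgebra.ι_add_mul_swap (R := K) x y)
    rw [← mul_assoc, a, neg_mul, mul_assoc, a, mul_neg, neg_neg, mul_assoc]
  exact LinearMap.congr_fun this π

/-- Binomial formula for the commuting elements `a = j(π)` and `v ∧ j(x)`, the second of square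
zero: only `a^(n+1)` and one mixed term survive, and `a^(n+1) = 0` since `2n+2` exceeds `dim V`.
Characteristic zero removes the factor `n+1`. Only a splitting of `j` is assumed, so the result
applies both to the poissonification and to the hypersurface `τ⁻¹(0)`. -/
theorem symplectization_pow_eq_zero_iff [CharZero K] [FiniteDimensional K V] {n : ℕ}
    (hV : Module.finrank K V = 2 * n + 1) {j : V →ₗ[K] W} {q : W →ₗ[K] V} {d : Module.Dual K W}
    {v : W} (hq : q ∘ₗ j = LinearMap.id) (hd : d ∘ₗ j = 0) (hv : d v = 1)
    (π : ⋀[K]^2 V) (x : V) :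
    ((exteriorPower.map 2 j π + exteriorPower.ιMulti K 2 ![v, j x] : ⋀[K]^2 W) :
        ExteriorAlgebra K W) ^ (n + 1) = 0 ↔
      ExteriorAlgebra.ι K x * (π : ExteriorAlgebra K V) ^ n = 0 := by
  set z := ExteriorAlgebra.ι K v
  set y := ExteriorAlgebra.ι K (j x)
  set J := ExteriorAlgebra.map j
  have hy : y = J (ExteriorAlgebra.ι K x) := (ExteriorAlgebra.map_apply_ι j x).symm
  set a : ExteriorAlgebra K W := J π
  have ha : (exteriorPower.map 2 j π : ExteriorAlgebra K W) = a :=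
    coe_exteriorPower_map _ _
  have hb : ((exteriorPower.ιMulti K 2 ![v, j x] : ⋀[K]^2 W) : ExteriorAlgebra K W) = z * y := by
    rw [exteriorPower.ιMulti_apply_coe, ExteriorAlgebra.ιMulti_apply]
    simp [z, y]
  have hza : z * a = a * z := by rw [← ha]; exact ι_mul_coe_comm _ _
  have hya : y * a = a * y := by rw [← ha]; exact ι_mul_coe_comm _ _
  have hzya : Commute (z * y) a := by
    change z * y * a = a * (z * y)
    rw [mul_assoc, hya, ← mul_assoc, hza, mul_assoc]
  have hzz : z * z = 0 := ExteriorAlgebra.ι_sq_zero _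
  have hyz : y * z = - (z * y) :=
    eq_neg_of_add_eq_zero_left (ExteriorAlgebra.ι_add_mul_swap (R := K) _ _)
  have hsq : (z * y) * (z * y) = 0 := by
    rw [mul_assoc, ← mul_assoc y z y, hyz, neg_mul, mul_assoc z y y, ExteriorAlgebra.ι_sq_zero]
    simp
  have hpow : ∀ m : ℕ, (a + z * y) ^ (m + 1) =
      a ^ (m + 1) + ((m + 1 : ℕ) : K) • (z * (y * a ^ m)) := by
    intro m
    induction m with
    | zero => simp
    | succ m ih =>
      have hc : Commute (z * y) (a ^ (m + 1)) := hzya.pow_right _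
      rw [pow_succ, ih, add_mul, mul_add, mul_add, ← pow_succ, ← hc.eq, smul_mul_assoc,
        smul_mul_assoc]
      have e1 : z * (y * a ^ m) * a = z * y * a ^ (m + 1) := by
        rw [pow_succ, mul_assoc, mul_assoc, mul_assoc]
      have e2 : z * (y * a ^ m) * (z * y) = 0 := by
        rw [← mul_assoc z, mul_assoc, ← (hzya.pow_right m).eq, ← mul_assoc, hsq, zero_mul]
      rw [e1, e2, smul_zero, add_zero, ← mul_assoc z y]
      push_cast
      module
  rw [Submodule.coe_add, ha, hb, hpow]
  have h0 : a ^ (n + 1) = 0 := by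
    rw [← map_pow, pow_eq_zero_of_finrank_lt π (n + 1) (by omega), map_zero]
  rw [h0, zero_add, smul_eq_zero_iff_right (by exact_mod_cast Nat.succ_ne_zero n), hy, ← map_pow,
    ← map_mul]
  exact ι_mul_map_eq_zero_iff hq hd hv _

end Nondegeneracy

/-! ### The two regularity classes -/

section Regularity

variable {k : WithTop ℕ∞}

theorem regularity_ne_zero (hk : k = ∞ ∨ k = ω) : k ≠ 0 := by
  rcases hk with rfl | rfl <;> simp

theorem one_le_regularity (hk : k = ∞ ∨ k = ω) : 1 ≤ k := by
  rcases hk with rfl | rfl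
  · exact_mod_cast le_top
  · exact le_top

theorem two_le_regularity (hk : k = ∞ ∨ k = ω) : 2 ≤ k := by
  rcases hk with rfl | rfl
  · exact WithTop.coe_le_coe.2 le_top
  · exact le_top

/-- Differentiation loses no regularity; this is what keeps brackets in the class `C^k`. -/
theorem regularity_add_one_le (hk : k = ∞ ∨ k = ω) : k + 1 ≤ k := by
  rcases hk with rfl | rfl
  · exact le_rfl
  · exact le_top

end Regularity

/-! ### Tensor fields in charts -/

section LocalCoordinates

variable {𝕜 : Type} [RCLike 𝕜]
  {E : Type*} [NormedAddCommGroup E] [NormedSpace 𝕜 E]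
  {H : Type*} [TopologicalSpace H] (I : ModelWithCorners 𝕜 E H)
  {M : Type*} [TopologicalSpace M] [ChartedSpace H M] {k : WithTop ℕ∞}

theorem bracket_apply (π : BField I M) (f g : M → 𝕜) (x : M) :
    bracket I π f g x = bivectorPairing (π x) (dAt I f x) (dAt I g x) := rfl

theorem dAt_congr {f g : M → 𝕜} {x : M} (h : f =ᶠ[nhds x] g) : dAt I f x = dAt I g x := by
  unfold dAt; rw [h.mfderiv_eq]

theorem HasMFDerivAt.dAt_eq {f : M → 𝕜} {x : M} {f' : TangentSpace I x →L[𝕜] 𝕜}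
    (h : HasMFDerivAt I 𝓘(𝕜, 𝕜) f x f') : dAt I f x = f'.toLinearMap := by
  unfold dAt; rw [h.mfderiv]

/-- The function `α ∘ e`, for `e` the preferred chart at `x₀` and `α` a covector. -/
noncomputable def linCoord (x₀ : M) (α : E →L[𝕜] 𝕜) : M → 𝕜 :=
  fun x => α (extChartAt I x₀ x)

/-- The expression of `f` in the preferred chart at `x₀`. -/
noncomputable def localExpr (x₀ : M) (f : M → 𝕜) : E → 𝕜 :=
  f ∘ (extChartAt I x₀).symm

/-- The derivative at `x₀` of `f`, expressed in the preferred chart at `x₀`. -/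
noncomputable def localDeriv (x₀ : M) (f : M → 𝕜) : E →L[𝕜] 𝕜 :=
  fderiv 𝕜 (localExpr I x₀ f) (extChartAt I x₀ x₀)

/-- The domain of `localExpr` for a function defined on `U`. -/
def localDomain (x₀ : M) (U : Set M) : Set E :=
  (extChartAt I x₀).target ∩ (extChartAt I x₀).symm ⁻¹' U

theorem isOpen_localDomain [I.Boundaryless] (x₀ : M) {U : Set M} (hU : IsOpen U) :
    IsOpen (localDomain I x₀ U) :=
  (continuousOn_extChartAt_symm x₀).isOpen_inter_preimage (isOpen_extChartAt_target x₀) hU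

theorem extChartAt_mem_localDomain {x₀ x : M} {U : Set M} (hx : x ∈ (extChartAt I x₀).source)
    (hU : x ∈ U) : extChartAt I x₀ x ∈ localDomain I x₀ U :=
  ⟨(extChartAt I x₀).map_source hx, by rwa [Set.mem_preimage, (extChartAt I x₀).left_inv hx]⟩

variable [IsManifold I k M]

theorem contMDiffOn_linCoord (x₀ : M) (α : E →L[𝕜] 𝕜) :
    ContMDiffOn I 𝓘(𝕜, 𝕜) k (linCoord I x₀ α) (extChartAt I x₀).source := by
  rw [extChartAt_source]
  exact α.contDiff.contMDiff.comp_contMDiffOn (contMDiffOn_extChartAt (n := k))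

theorem contDiffOn_localExpr (x₀ : M) {U : Set M} {f : M → 𝕜}
    (hf : ContMDiffOn I 𝓘(𝕜, 𝕜) k f U) :
    ContDiffOn 𝕜 k (localExpr I x₀ f) (localDomain I x₀ U) := by
  rw [← contMDiffOn_iff_contDiffOn]
  exact hf.comp ((contMDiffOn_extChartAt_symm x₀).mono Set.inter_subset_left)
    fun y hy => hy.2

theorem contDiffOn_fderiv_localExpr [I.Boundaryless] (hk : k = ∞ ∨ k = ω) (x₀ : M) {U : Set M}
    (hU : IsOpen U) {f : M → 𝕜} (hf : ContMDiffOn I 𝓘(𝕜, 𝕜) k f U) :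
    ContDiffOn 𝕜 k (fderiv 𝕜 (localExpr I x₀ f)) (localDomain I x₀ U) :=
  (contDiffOn_localExpr I x₀ hf).fderiv_of_isOpen (isOpen_localDomain I x₀ hU)
    (regularity_add_one_le hk)

omit [IsManifold I k M] in
theorem localExpr_eventuallyEq (x₀ : M) {x : M} (hx : x ∈ (extChartAt I x₀).source) (f : M → 𝕜) :
    f =ᶠ[nhds x] localExpr I x₀ f ∘ extChartAt I x₀ := by
  filter_upwards [extChartAt_source_mem_nhds' hx] with z hz
  simp only [localExpr, Function.comp_apply, (extChartAt I x₀).left_inv hz]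

/-- Chain rule through the chart. Absence of boundary makes the chart target open, so that `fderiv`
is the right derivative there. -/
theorem dAt_eq_comp [I.Boundaryless] (hk : k = ∞ ∨ k = ω) (x₀ : M) {x : M}
    (hx : x ∈ (extChartAt I x₀).source) {U : Set M} (hU : IsOpen U) (hxU : x ∈ U) {f : M → 𝕜}
    (hf : ContMDiffOn I 𝓘(𝕜, 𝕜) k f U) :
    dAt I f x = (fderiv 𝕜 (localExpr I x₀ f) (extChartAt I x₀ x)).toLinearMap ∘ₗ
      (mfderiv I 𝓘(𝕜, E) (extChartAt I x₀) x).toLinearMap := by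
  have h1 : HasMFDerivAt I 𝓘(𝕜, E) (extChartAt I x₀) x _ :=
    ((contMDiffAt_extChartAt' (I := I) (n := k) (by simpa using hx)).mdifferentiableAt
      (regularity_ne_zero hk)).hasMFDerivAt
  have h2 := (((contDiffOn_localExpr I x₀ hf).differentiableOn (regularity_ne_zero hk)
    ).differentiableAt ((isOpen_localDomain I x₀ hU).mem_nhds
      (extChartAt_mem_localDomain I hx hxU))).hasFDerivAt
  rw [dAt_congr I (localExpr_eventuallyEq I x₀ hx f)]
  exact HasMFDerivAt.dAt_eq I (h2.hasMFDerivAt.comp x h1)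

theorem dAt_linCoord (hk : k = ∞ ∨ k = ω) (x₀ : M) {x : M}
    (hx : x ∈ (extChartAt I x₀).source) (α : E →L[𝕜] 𝕜) :
    dAt I (linCoord I x₀ α) x = α.toLinearMap ∘ₗ
      (mfderiv I 𝓘(𝕜, E) (extChartAt I x₀) x).toLinearMap := by
  have h1 : HasMFDerivAt I 𝓘(𝕜, E) (extChartAt I x₀) x _ :=
    ((contMDiffAt_extChartAt' (I := I) (n := k) (by simpa using hx)).mdifferentiableAt
      (regularity_ne_zero hk)).hasMFDerivAt
  exact HasMFDerivAt.dAt_eq I (α.hasFDerivAt.hasMFDerivAt.comp x h1)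

theorem localDeriv_linCoord [I.Boundaryless] (x₀ : M) (α : E →L[𝕜] 𝕜) :
    localDeriv I x₀ (linCoord I x₀ α) = α := by
  have : localExpr I x₀ (linCoord I x₀ α) =ᶠ[nhds (extChartAt I x₀ x₀)] α := by
    filter_upwards [(isOpen_extChartAt_target (I := I) x₀).mem_nhds
      (mem_extChartAt_target (I := I) x₀)] with y hy
    simp only [localExpr, linCoord, Function.comp_apply, (extChartAt I x₀).right_inv hy]
  rw [localDeriv, this.fderiv_eq]
  exact α.fderiv

variable [FiniteDimensional 𝕜 E]

/-- The expression of a bivector field in the preferred chart at `x₀`. -/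
noncomputable def localBivector (π : BField I M) (x₀ : M) (y : E) :
    (E →L[𝕜] 𝕜) →L[𝕜] (E →L[𝕜] 𝕜) →L[𝕜] 𝕜 :=
  ∑ i, ∑ j, bracket I π
    (linCoord I x₀ (LinearMap.toContinuousLinearMap ((Module.finBasis 𝕜 E).coord i)))
    (linCoord I x₀ (LinearMap.toContinuousLinearMap ((Module.finBasis 𝕜 E).coord j)))
    ((extChartAt I x₀).symm y) •
    (ContinuousLinearMap.apply 𝕜 𝕜 (Module.finBasis 𝕜 E i)).smulRight
      (ContinuousLinearMap.apply 𝕜 𝕜 (Module.finBasis 𝕜 E j))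

/-- The expression of a vector field in the preferred chart at `x₀`. -/
noncomputable def localField (X : VField I M) (x₀ : M) (y : E) : E :=
  ∑ i, derive I X
    (linCoord I x₀ (LinearMap.toContinuousLinearMap ((Module.finBasis 𝕜 E).coord i)))
    ((extChartAt I x₀).symm y) • Module.finBasis 𝕜 E i

omit [IsManifold I k M] in
theorem sum_smul_comp {V W : Type*} [AddCommGroup V] [Module 𝕜 V] [AddCommGroup W] [Module 𝕜 W]
    {ι : Type*} (s : Finset ι) (c : ι → 𝕜) (L : ι → Module.Dual 𝕜 W) (T : V →ₗ[𝕜] W) :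
    (∑ i ∈ s, c i • L i) ∘ₗ T = ∑ i ∈ s, c i • (L i ∘ₗ T) := by
  ext v; simp

omit [IsManifold I k M] in
theorem bivectorPairing_sum_left {V : Type*} [AddCommGroup V] [Module 𝕜 V] (π : ⋀[𝕜]^2 V)
    {ι : Type*} (s : Finset ι) (α : ι → Module.Dual 𝕜 V) (β : Module.Dual 𝕜 V) :
    bivectorPairing π (∑ i ∈ s, α i) β = ∑ i ∈ s, bivectorPairing π (α i) β := by
  classical
  induction s using Finset.induction_on with
  | empty => simpa using bivectorPairing_smul_left π 0 0 β
  | insert i s hi ih => rw [Finset.sum_insert hi, Finset.sum_insert hi, bivectorPairing_add_left, ih]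

omit [IsManifold I k M] in
theorem bivectorPairing_sum_right {V : Type*} [AddCommGroup V] [Module 𝕜 V] (π : ⋀[𝕜]^2 V)
    {ι : Type*} (s : Finset ι) (α : Module.Dual 𝕜 V) (β : ι → Module.Dual 𝕜 V) :
    bivectorPairing π α (∑ i ∈ s, β i) = ∑ i ∈ s, bivectorPairing π α (β i) := by
  rw [bivectorPairing_swap, bivectorPairing_sum_left, ← Finset.sum_neg_distrib]
  exact Finset.sum_congr rfl fun i _ => (bivectorPairing_swap _ _ _).symm

/-- Both covectors are expanded in the dual basis. The coefficients of `localBivector` are brackets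
of coordinate functions, so bilinearity concludes. -/
theorem localBivector_apply (hk : k = ∞ ∨ k = ω) (π : BField I M) (x₀ : M) {x : M}
    (hx : x ∈ (extChartAt I x₀).source) (α β : E →L[𝕜] 𝕜) :
    localBivector I π x₀ (extChartAt I x₀ x) α β = bivectorPairing (π x)
      (α.toLinearMap ∘ₗ (mfderiv I 𝓘(𝕜, E) (extChartAt I x₀) x).toLinearMap)
      (β.toLinearMap ∘ₗ (mfderiv I 𝓘(𝕜, E) (extChartAt I x₀) x).toLinearMap) := by
  set b := Module.finBasis 𝕜 E
  have hexp (γ : E →L[𝕜] 𝕜) : γ.toLinearMap = ∑ i, γ (b i) • b.coord i :=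
    (b.sum_dual_apply_smul_coord γ.toLinearMap).symm
  conv_rhs => rw [hexp α, hexp β]
  have hsum (γ : E →L[𝕜] 𝕜) : (∑ i, γ (b i) • b.coord i) ∘ₗ
      (mfderiv I 𝓘(𝕜, E) (extChartAt I x₀) x).toLinearMap = ∑ i, γ (b i) • (b.coord i ∘ₗ
      (mfderiv I 𝓘(𝕜, E) (extChartAt I x₀) x).toLinearMap) := by
    exact sum_smul_comp _ _ _ _
  rw [hsum, hsum, bivectorPairing_sum_left]
  simp only [bivectorPairing_sum_right, bivectorPairing_smul_left, bivectorPairing_smul_right]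
  simp only [localBivector, _root_.sum_apply, _root_.smul_apply,
    ContinuousLinearMap.smulRight_apply, ContinuousLinearMap.apply_apply, smul_eq_mul,
    (extChartAt I x₀).left_inv hx, bracket_apply]
  refine Finset.sum_congr rfl fun i _ => Finset.sum_congr rfl fun j _ => ?_
  rw [dAt_linCoord I hk x₀ hx, dAt_linCoord I hk x₀ hx]
  simp only [LinearMap.coe_toContinuousLinearMap, b]
  ring

theorem apply_localField (hk : k = ∞ ∨ k = ω) (X : VField I M) (x₀ : M) {x : M}
    (hx : x ∈ (extChartAt I x₀).source) (α : E →L[𝕜] 𝕜) :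
    α (localField I X x₀ (extChartAt I x₀ x)) =
      α (mfderiv I 𝓘(𝕜, E) (extChartAt I x₀) x (X x)) := by
  congr 1
  set b := Module.finBasis 𝕜 E
  have hi (i) : derive I X (linCoord I x₀ (LinearMap.toContinuousLinearMap (b.coord i))) x =
      b.repr (show E from mfderiv I 𝓘(𝕜, E) (extChartAt I x₀) x (X x)) i := by
    rw [derive, dAt_linCoord I hk x₀ hx]
    rfl
  rw [localField, (extChartAt I x₀).left_inv hx]
  exact (Finset.sum_congr rfl fun i _ => by rw [hi i]).trans (b.sum_repr _)

section

variable [I.Boundaryless]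

theorem bracket_eq_local (hk : k = ∞ ∨ k = ω) (π : BField I M) (x₀ : M) {x : M}
    (hx : x ∈ (extChartAt I x₀).source) {U : Set M} (hU : IsOpen U) (hxU : x ∈ U) {f g : M → 𝕜}
    (hf : ContMDiffOn I 𝓘(𝕜, 𝕜) k f U) (hg : ContMDiffOn I 𝓘(𝕜, 𝕜) k g U) :
    bracket I π f g x = localBivector I π x₀ (extChartAt I x₀ x)
      (fderiv 𝕜 (localExpr I x₀ f) (extChartAt I x₀ x))
      (fderiv 𝕜 (localExpr I x₀ g) (extChartAt I x₀ x)) := by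
  rw [bracket_apply, localBivector_apply I hk π x₀ hx, dAt_eq_comp I hk x₀ hx hU hxU hf,
    dAt_eq_comp I hk x₀ hx hU hxU hg]

theorem derive_eq_local (hk : k = ∞ ∨ k = ω) (X : VField I M) (x₀ : M) {x : M}
    (hx : x ∈ (extChartAt I x₀).source) {U : Set M} (hU : IsOpen U) (hxU : x ∈ U) {f : M → 𝕜}
    (hf : ContMDiffOn I 𝓘(𝕜, 𝕜) k f U) :
    derive I X f x = fderiv 𝕜 (localExpr I x₀ f) (extChartAt I x₀ x)
      (localField I X x₀ (extChartAt I x₀ x)) := by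
  rw [derive, dAt_eq_comp I hk x₀ hx hU hxU hf, apply_localField I hk X x₀ hx]
  rfl

/-- The identity holds on an open set rather than at one point, so it may be differentiated in
`localDeriv_bracket`. -/
theorem localExpr_bracket (hk : k = ∞ ∨ k = ω) (π : BField I M) (x₀ : M) {U : Set M}
    (hU : IsOpen U) {f g : M → 𝕜}
    (hf : ContMDiffOn I 𝓘(𝕜, 𝕜) k f U) (hg : ContMDiffOn I 𝓘(𝕜, 𝕜) k g U) :
    Set.EqOn (localExpr I x₀ (bracket I π f g)) (fun y => localBivector I π x₀ y
      (fderiv 𝕜 (localExpr I x₀ f) y) (fderiv 𝕜 (localExpr I x₀ g) y)) (localDomain I x₀ U) := by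
  intro y hy
  have := bracket_eq_local I hk π x₀ ((extChartAt I x₀).map_target hy.1) hU hy.2 hf hg
  rwa [(extChartAt I x₀).right_inv hy.1] at this

theorem localExpr_derive (hk : k = ∞ ∨ k = ω) (X : VField I M) (x₀ : M) {U : Set M}
    (hU : IsOpen U) {f : M → 𝕜} (hf : ContMDiffOn I 𝓘(𝕜, 𝕜) k f U) :
    Set.EqOn (localExpr I x₀ (derive I X f)) (fun y => fderiv 𝕜 (localExpr I x₀ f) y
      (localField I X x₀ y)) (localDomain I x₀ U) := by
  intro y hy
  have := derive_eq_local I hk X x₀ ((extChartAt I x₀).map_target hy.1) hU hy.2 hf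
  rwa [(extChartAt I x₀).right_inv hy.1] at this

omit [FiniteDimensional 𝕜 E] [IsManifold I k M] in
theorem contMDiffOn_of_localExpr {f : M → 𝕜} {U : Set M} (hU : IsOpen U)
    (h : ∀ x₀ ∈ U, ContDiffOn 𝕜 k (localExpr I x₀ f) (localDomain I x₀ U)) :
    ContMDiffOn I 𝓘(𝕜, 𝕜) k f U := by
  intro x hx
  have h1 := ((h x hx).contDiffAt ((isOpen_localDomain I x hU).mem_nhds
    (extChartAt_mem_localDomain I (mem_extChartAt_source x) hx))).contMDiffAt
  exact ((h1.comp x contMDiffAt_extChartAt).congr_of_eventuallyEq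
    (localExpr_eventuallyEq I x (mem_extChartAt_source x) f)).contMDiffWithinAt

omit [I.Boundaryless] in
-- Passage from regularity tested on functions to regularity of the coefficients, which are
-- themselves brackets of test functions.
theorem contDiffOn_localBivector (π : BField I M) (x₀ : M)
    (h : ∀ α β : E →L[𝕜] 𝕜, ContMDiffOn I 𝓘(𝕜, 𝕜) k
      (bracket I π (linCoord I x₀ α) (linCoord I x₀ β)) (extChartAt I x₀).source) :
    ContDiffOn 𝕜 k (localBivector I π x₀) (extChartAt I x₀).target := by
  unfold localBivector
  refine ContDiffOn.sum fun i _ => ContDiffOn.sum fun j _ => ContDiffOn.fun_smul ?_ contDiffOn_const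
  exact (contDiffOn_localExpr I x₀ (h _ _)).mono fun y hy =>
    ⟨hy, (extChartAt I x₀).map_target hy⟩

omit [I.Boundaryless] in
theorem contDiffOn_localField (X : VField I M) (x₀ : M)
    (h : ∀ α : E →L[𝕜] 𝕜, ContMDiffOn I 𝓘(𝕜, 𝕜) k
      (derive I X (linCoord I x₀ α)) (extChartAt I x₀).source) :
    ContDiffOn 𝕜 k (localField I X x₀) (extChartAt I x₀).target := by
  unfold localField
  refine ContDiffOn.sum fun i _ => ContDiffOn.smul ?_ contDiffOn_const
  exact (contDiffOn_localExpr I x₀ (h _)).mono fun y hy =>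
    ⟨hy, (extChartAt I x₀).map_target hy⟩

/-- A bivector field is of class `C^k` if it is so on coordinate functions. -/
theorem isCkBField_of_linCoord (hk : k = ∞ ∨ k = ω) {π : BField I M}
    (h : ∀ x₀ : M, ∀ α β : E →L[𝕜] 𝕜, ContMDiffOn I 𝓘(𝕜, 𝕜) k
      (bracket I π (linCoord I x₀ α) (linCoord I x₀ β)) (extChartAt I x₀).source) :
    IsCkBField I k π := by
  intro U hU f g hf hg
  refine contMDiffOn_of_localExpr I hU fun x₀ _ => ?_
  refine ContDiffOn.congr ?_ (localExpr_bracket I hk π x₀ hU hf hg)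
  exact (((contDiffOn_localBivector I π x₀ (h x₀)).mono Set.inter_subset_left).clm_apply
    (contDiffOn_fderiv_localExpr I hk x₀ hU hf)).clm_apply
    (contDiffOn_fderiv_localExpr I hk x₀ hU hg)

/-- A vector field is of class `C^k` if it is so on coordinate functions. -/
theorem isCkVField_of_linCoord (hk : k = ∞ ∨ k = ω) {X : VField I M}
    (h : ∀ x₀ : M, ∀ α : E →L[𝕜] 𝕜, ContMDiffOn I 𝓘(𝕜, 𝕜) k
      (derive I X (linCoord I x₀ α)) (extChartAt I x₀).source) :
    IsCkVField I k X := by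
  intro U hU f hf
  refine contMDiffOn_of_localExpr I hU fun x₀ _ => ?_
  refine ContDiffOn.congr ?_ (localExpr_derive I hk X x₀ hU hf)
  exact (contDiffOn_fderiv_localExpr I hk x₀ hU hf).clm_apply
    ((contDiffOn_localField I X x₀ (h x₀)).mono Set.inter_subset_left)

omit [I.Boundaryless] in
theorem IsCkBField.contDiffOn_localBivector {π : BField I M} (hπ : IsCkBField I k π) (x₀ : M) :
    ContDiffOn 𝕜 k (localBivector I π x₀) (extChartAt I x₀).target :=
  JacobiGeometry.contDiffOn_localBivector I π x₀ fun _ _ =>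
    hπ _ (isOpen_extChartAt_source x₀) _ _ (contMDiffOn_linCoord I x₀ _)
      (contMDiffOn_linCoord I x₀ _)

omit [I.Boundaryless] in
theorem IsCkVField.contDiffOn_localField {X : VField I M} (hX : IsCkVField I k X) (x₀ : M) :
    ContDiffOn 𝕜 k (localField I X x₀) (extChartAt I x₀).target :=
  JacobiGeometry.contDiffOn_localField I X x₀ fun _ =>
    hX _ (isOpen_extChartAt_source x₀) _ (contMDiffOn_linCoord I x₀ _)

/-! ### Tensoriality of the Schouten square and of the Lie derivative -/

theorem bracket_eq_localDeriv (hk : k = ∞ ∨ k = ω) (π : BField I M) (x₀ : M) {U : Set M}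
    (hU : IsOpen U) (hxU : x₀ ∈ U) {f g : M → 𝕜}
    (hf : ContMDiffOn I 𝓘(𝕜, 𝕜) k f U) (hg : ContMDiffOn I 𝓘(𝕜, 𝕜) k g U) :
    bracket I π f g x₀ = localBivector I π x₀ (extChartAt I x₀ x₀) (localDeriv I x₀ f)
      (localDeriv I x₀ g) :=
  bracket_eq_local I hk π x₀ (mem_extChartAt_source x₀) hU hxU hf hg

theorem derive_eq_localDeriv (hk : k = ∞ ∨ k = ω) (X : VField I M) (x₀ : M) {U : Set M}
    (hU : IsOpen U) (hxU : x₀ ∈ U) {f : M → 𝕜} (hf : ContMDiffOn I 𝓘(𝕜, 𝕜) k f U) :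
    derive I X f x₀ = localDeriv I x₀ f (localField I X x₀ (extChartAt I x₀ x₀)) :=
  derive_eq_local I hk X x₀ (mem_extChartAt_source x₀) hU hxU hf

omit [FiniteDimensional 𝕜 E] in
-- The symmetry of the Hessian is what cancels the second-order terms in the two tensoriality
-- statements below.
theorem exists_secondDeriv (hk : k = ∞ ∨ k = ω) (x₀ : M) {U : Set M} (hU : IsOpen U)
    (hxU : x₀ ∈ U) {f : M → 𝕜} (hf : ContMDiffOn I 𝓘(𝕜, 𝕜) k f U) :
    ∃ f'' : E →L[𝕜] E →L[𝕜] 𝕜,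
      HasFDerivAt (fderiv 𝕜 (localExpr I x₀ f)) f'' (extChartAt I x₀ x₀) ∧
      ∀ v w, f'' v w = f'' w v := by
  have hy := (isOpen_localDomain I x₀ hU).mem_nhds
    (extChartAt_mem_localDomain I (mem_extChartAt_source x₀) hxU)
  refine ⟨_, (((contDiffOn_fderiv_localExpr I hk x₀ hU hf).differentiableOn
    (regularity_ne_zero hk)).differentiableAt hy).hasFDerivAt, fun v w => ?_⟩
  refine ((contDiffOn_localExpr I x₀ hf).contDiffAt hy).isSymmSndFDerivAt ?_ v w
  rw [minSmoothness_of_isRCLikeNormedField]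
  exact two_le_regularity hk

theorem localDeriv_bracket (hk : k = ∞ ∨ k = ω) {π : BField I M} (hπ : IsCkBField I k π)
    (x₀ : M) {U : Set M} (hU : IsOpen U) (hxU : x₀ ∈ U) {f g : M → 𝕜}
    (hf : ContMDiffOn I 𝓘(𝕜, 𝕜) k f U) (hg : ContMDiffOn I 𝓘(𝕜, 𝕜) k g U)
    {f'' g'' : E →L[𝕜] E →L[𝕜] 𝕜}
    (hf'' : HasFDerivAt (fderiv 𝕜 (localExpr I x₀ f)) f'' (extChartAt I x₀ x₀))
    (hg'' : HasFDerivAt (fderiv 𝕜 (localExpr I x₀ g)) g'' (extChartAt I x₀ x₀)) (v : E) :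
    localDeriv I x₀ (bracket I π f g) v =
      fderiv 𝕜 (localBivector I π x₀) (extChartAt I x₀ x₀) v (localDeriv I x₀ f)
        (localDeriv I x₀ g) +
      localBivector I π x₀ (extChartAt I x₀ x₀) (f'' v) (localDeriv I x₀ g) +
      localBivector I π x₀ (extChartAt I x₀ x₀) (localDeriv I x₀ f) (g'' v) := by
  have hy := (isOpen_localDomain I x₀ hU).mem_nhds
    (extChartAt_mem_localDomain I (mem_extChartAt_source x₀) hxU)
  have hB := (((hπ.contDiffOn_localBivector I x₀).differentiableOn
    (regularity_ne_zero hk)).differentiableAt ((isOpen_extChartAt_target (I := I) x₀).mem_nhds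
      (mem_extChartAt_target (I := I) x₀))).hasFDerivAt
  have h := (hB.clm_apply hf'').clm_apply hg''
  rw [localDeriv, ((localExpr_bracket I hk π x₀ hU hf hg).eventuallyEq_of_mem hy).fderiv_eq,
    h.fderiv]
  simp [localDeriv]
  ring

theorem localDeriv_derive (hk : k = ∞ ∨ k = ω) {X : VField I M} (hX : IsCkVField I k X)
    (x₀ : M) {U : Set M} (hU : IsOpen U) (hxU : x₀ ∈ U) {f : M → 𝕜}
    (hf : ContMDiffOn I 𝓘(𝕜, 𝕜) k f U) {f'' : E →L[𝕜] E →L[𝕜] 𝕜}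
    (hf'' : HasFDerivAt (fderiv 𝕜 (localExpr I x₀ f)) f'' (extChartAt I x₀ x₀)) (v : E) :
    localDeriv I x₀ (derive I X f) v =
      f'' v (localField I X x₀ (extChartAt I x₀ x₀)) +
      localDeriv I x₀ f (fderiv 𝕜 (localField I X x₀) (extChartAt I x₀ x₀) v) := by
  have hy := (isOpen_localDomain I x₀ hU).mem_nhds
    (extChartAt_mem_localDomain I (mem_extChartAt_source x₀) hxU)
  have hB := (((hX.contDiffOn_localField I x₀).differentiableOn
    (regularity_ne_zero hk)).differentiableAt ((isOpen_extChartAt_target (I := I) x₀).mem_nhds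
      (mem_extChartAt_target (I := I) x₀))).hasFDerivAt
  have h := hf''.clm_apply hB
  rw [localDeriv, ((localExpr_derive I hk X x₀ hU hf).eventuallyEq_of_mem hy).fderiv_eq,
    h.fderiv]
  simp [localDeriv]
  ring

omit [I.Boundaryless] in
theorem localBivector_swap (hk : k = ∞ ∨ k = ω) (π : BField I M) (x₀ : M) (α β : E →L[𝕜] 𝕜) :
    localBivector I π x₀ (extChartAt I x₀ x₀) β α =
      -localBivector I π x₀ (extChartAt I x₀ x₀) α β := by
  rw [localBivector_apply I hk π x₀ (mem_extChartAt_source x₀),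
    localBivector_apply I hk π x₀ (mem_extChartAt_source x₀), bivectorPairing_swap]

omit [I.Boundaryless] in
-- Reflexivity of the finite-dimensional `E`: `w` is the Hamiltonian vector of `β`, up to sign.
theorem exists_localContract (π : BField I M) (x₀ : M) (β : E →L[𝕜] 𝕜) :
    ∃ w : E, ∀ α : E →L[𝕜] 𝕜,
      localBivector I π x₀ (extChartAt I x₀ x₀) α β = α w := by
  let L : Module.Dual 𝕜 (Module.Dual 𝕜 E) :=
    ((localBivector I π x₀ (extChartAt I x₀ x₀)).flip β).toLinearMap ∘ₗ
      (LinearMap.toContinuousLinearMap (𝕜 := 𝕜) (E := E) (F' := 𝕜)).toLinearMap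
  refine ⟨(Module.evalEquiv 𝕜 E).symm L, fun α => ?_⟩
  have := Module.apply_evalEquiv_symm_apply (f := α.toLinearMap) (g := L)
  exact this.symm

/-- The Schouten square of a bivector field is a tensor. -/
theorem schoutenSquare_eq_linCoord (hk : k = ∞ ∨ k = ω) {π : BField I M}
    (hπ : IsCkBField I k π) (x₀ : M) {U : Set M} (hU : IsOpen U) (hxU : x₀ ∈ U) {f g h : M → 𝕜}
    (hf : ContMDiffOn I 𝓘(𝕜, 𝕜) k f U) (hg : ContMDiffOn I 𝓘(𝕜, 𝕜) k g U)
    (hh : ContMDiffOn I 𝓘(𝕜, 𝕜) k h U) :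
    schoutenSquare I π f g h x₀ = schoutenSquare I π (linCoord I x₀ (localDeriv I x₀ f))
      (linCoord I x₀ (localDeriv I x₀ g)) (linCoord I x₀ (localDeriv I x₀ h)) x₀ := by
  choose w hw using exists_localContract I π x₀
  -- A formula involving first derivatives only. Each Hessian occurs twice in the cyclic sum, with
  -- opposite signs and exchanged arguments; for instance `f''` is evaluated on the Hamiltonian
  -- vectors of `g` and `h`.
  have key : ∀ V : Set M, IsOpen V → x₀ ∈ V → ∀ f g h : M → 𝕜, ContMDiffOn I 𝓘(𝕜, 𝕜) k f V →
      ContMDiffOn I 𝓘(𝕜, 𝕜) k g V → ContMDiffOn I 𝓘(𝕜, 𝕜) k h V →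
      schoutenSquare I π f g h x₀ = 2 *
        (fderiv 𝕜 (localBivector I π x₀) (extChartAt I x₀ x₀) (w (localDeriv I x₀ h))
            (localDeriv I x₀ f) (localDeriv I x₀ g) +
          fderiv 𝕜 (localBivector I π x₀) (extChartAt I x₀ x₀) (w (localDeriv I x₀ f))
            (localDeriv I x₀ g) (localDeriv I x₀ h) +
          fderiv 𝕜 (localBivector I π x₀) (extChartAt I x₀ x₀) (w (localDeriv I x₀ g))
            (localDeriv I x₀ h) (localDeriv I x₀ f)) := by
    intro V hV hxV f g h hf hg hh
    obtain ⟨f'', hf'', sf⟩ := exists_secondDeriv I hk x₀ hV hxV hf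
    obtain ⟨g'', hg'', sg⟩ := exists_secondDeriv I hk x₀ hV hxV hg
    obtain ⟨h'', hh'', sh⟩ := exists_secondDeriv I hk x₀ hV hxV hh
    rw [schoutenSquare, bracket_eq_localDeriv I hk π x₀ hV hxV (hπ V hV f g hf hg) hh,
      bracket_eq_localDeriv I hk π x₀ hV hxV (hπ V hV g h hg hh) hf,
      bracket_eq_localDeriv I hk π x₀ hV hxV (hπ V hV h f hh hf) hg, hw, hw, hw,
      localDeriv_bracket I hk hπ x₀ hV hxV hf hg hf'' hg'',
      localDeriv_bracket I hk hπ x₀ hV hxV hg hh hg'' hh'',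
      localDeriv_bracket I hk hπ x₀ hV hxV hh hf hh'' hf'',
      localBivector_swap I hk π x₀ _ (localDeriv I x₀ f),
      localBivector_swap I hk π x₀ _ (localDeriv I x₀ g),
      localBivector_swap I hk π x₀ _ (localDeriv I x₀ h)]
    simp only [hw]
    rw [sf (w (localDeriv I x₀ g)) (w (localDeriv I x₀ h)),
      sg (w (localDeriv I x₀ f)) (w (localDeriv I x₀ h)),
      sh (w (localDeriv I x₀ f)) (w (localDeriv I x₀ g))]
    ring
  -- The functions and their linearizations in the chart have the same `localDeriv`, so `key` gives
  -- the same value for both.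
  rw [key U hU hxU f g h hf hg hh, key _ (isOpen_extChartAt_source x₀) (mem_extChartAt_source x₀)
    _ _ _ (contMDiffOn_linCoord I x₀ _) (contMDiffOn_linCoord I x₀ _)
    (contMDiffOn_linCoord I x₀ _)]
  simp only [localDeriv_linCoord]

theorem bracket_eq_linCoord (hk : k = ∞ ∨ k = ω) (π : BField I M) (x₀ : M) {U : Set M}
    (hU : IsOpen U) (hxU : x₀ ∈ U) {f g : M → 𝕜}
    (hf : ContMDiffOn I 𝓘(𝕜, 𝕜) k f U) (hg : ContMDiffOn I 𝓘(𝕜, 𝕜) k g U) :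
    bracket I π f g x₀ = bracket I π (linCoord I x₀ (localDeriv I x₀ f))
      (linCoord I x₀ (localDeriv I x₀ g)) x₀ := by
  rw [bracket_eq_localDeriv I hk π x₀ hU hxU hf hg,
    bracket_eq_localDeriv I hk π x₀ (isOpen_extChartAt_source x₀) (mem_extChartAt_source x₀)
      (contMDiffOn_linCoord I x₀ _) (contMDiffOn_linCoord I x₀ _)]
  simp only [localDeriv_linCoord]

/-- The Lie derivative of a bivector field is a tensor. -/
theorem lieB_eq_linCoord (hk : k = ∞ ∨ k = ω) {π : BField I M}
    (hπ : IsCkBField I k π) {X : VField I M} (hX : IsCkVField I k X)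
    (x₀ : M) {U : Set M} (hU : IsOpen U) (hxU : x₀ ∈ U) {f g : M → 𝕜}
    (hf : ContMDiffOn I 𝓘(𝕜, 𝕜) k f U) (hg : ContMDiffOn I 𝓘(𝕜, 𝕜) k g U) :
    lieB I X π f g x₀ = lieB I X π (linCoord I x₀ (localDeriv I x₀ f))
      (linCoord I x₀ (localDeriv I x₀ g)) x₀ := by
  choose w hw using exists_localContract I π x₀
  -- Again the Hessians cancel: those from `X{f, g}` against those from `{Xf, g}` and `{f, Xg}`.
  have key : ∀ V : Set M, IsOpen V → x₀ ∈ V → ∀ f g : M → 𝕜, ContMDiffOn I 𝓘(𝕜, 𝕜) k f V →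
      ContMDiffOn I 𝓘(𝕜, 𝕜) k g V →
      lieB I X π f g x₀ =
        fderiv 𝕜 (localBivector I π x₀) (extChartAt I x₀ x₀)
          (localField I X x₀ (extChartAt I x₀ x₀)) (localDeriv I x₀ f) (localDeriv I x₀ g) -
        localDeriv I x₀ f (fderiv 𝕜 (localField I X x₀) (extChartAt I x₀ x₀)
          (w (localDeriv I x₀ g))) +
        localDeriv I x₀ g (fderiv 𝕜 (localField I X x₀) (extChartAt I x₀ x₀)
          (w (localDeriv I x₀ f))) := by
    intro V hV hxV f g hf hg
    obtain ⟨f'', hf'', sf⟩ := exists_secondDeriv I hk x₀ hV hxV hf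
    obtain ⟨g'', hg'', sg⟩ := exists_secondDeriv I hk x₀ hV hxV hg
    rw [lieB, derive_eq_localDeriv I hk X x₀ hV hxV (hπ V hV f g hf hg),
      bracket_eq_localDeriv I hk π x₀ hV hxV (hX V hV f hf) hg,
      bracket_eq_localDeriv I hk π x₀ hV hxV hf (hX V hV g hg),
      localDeriv_bracket I hk hπ x₀ hV hxV hf hg hf'' hg'',
      localBivector_swap I hk π x₀ _ (localDeriv I x₀ f),
      localBivector_swap I hk π x₀ _ (localDeriv I x₀ f)]
    simp only [hw]
    rw [localDeriv_derive I hk hX x₀ hV hxV hf hf'', localDeriv_derive I hk hX x₀ hV hxV hg hg'',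
      sf (w (localDeriv I x₀ g)), sg (w (localDeriv I x₀ f))]
    ring
  rw [key U hU hxU f g hf hg, key _ (isOpen_extChartAt_source x₀) (mem_extChartAt_source x₀)
    _ _ (contMDiffOn_linCoord I x₀ _) (contMDiffOn_linCoord I x₀ _)]
  simp only [localDeriv_linCoord]

end

end LocalCoordinates

/-! ### The exponential on `𝕜` -/

section Exponential

variable {𝕜 : Type} [RCLike 𝕜]

theorem normedExp_ne_zero (t : 𝕜) : NormedSpace.exp t ≠ 0 :=
  (NormedSpace.isUnit_exp_of_mem_ball (𝕂 := 𝕜)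
    ((NormedSpace.expSeries_radius_eq_top 𝕜 𝕜).symm ▸ edist_lt_top _ _)).ne_zero

theorem hasDerivAt_normedExp_inv (t : 𝕜) :
    HasDerivAt (fun s : 𝕜 => (NormedSpace.exp s)⁻¹) (-(NormedSpace.exp t)⁻¹) t := by
  have h := (hasDerivAt_exp (𝕂 := 𝕜) (x := t)).fun_inv (normedExp_ne_zero t)
  have e (z : 𝕜) (hz : z ≠ 0) : -z / z ^ 2 = -z⁻¹ := by field_simp
  rwa [e _ (normedExp_ne_zero t)] at h

theorem contDiff_normedExp {k : WithTop ℕ∞} : ContDiff 𝕜 k (NormedSpace.exp : 𝕜 → 𝕜) := by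
  have h : ContDiff 𝕜 ω (NormedSpace.exp : 𝕜 → 𝕜) :=
    contDiff_iff_contDiffAt.2 fun t => (NormedSpace.exp_analytic (𝕂 := 𝕜) t).contDiffAt
  exact h.of_le le_top

theorem contDiff_normedExp_inv {k : WithTop ℕ∞} :
    ContDiff 𝕜 k (fun t : 𝕜 => (NormedSpace.exp t)⁻¹) :=
  contDiff_normedExp.fun_inv normedExp_ne_zero

end Exponential

/-! ### Rules for the differential of a function -/

section Differential

variable {𝕜 : Type} [RCLike 𝕜]
  {E : Type*} [NormedAddCommGroup E] [NormedSpace 𝕜 E]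
  {H : Type*} [TopologicalSpace H] (I : ModelWithCorners 𝕜 E H)
  {M : Type*} [TopologicalSpace M] [ChartedSpace H M]
  {E' : Type*} [NormedAddCommGroup E'] [NormedSpace 𝕜 E']
  {H' : Type*} [TopologicalSpace H'] {I' : ModelWithCorners 𝕜 E' H'}
  {M' : Type*} [TopologicalSpace M'] [ChartedSpace H' M']

theorem dAt_add {f g : M → 𝕜} {x : M} (hf : MDifferentiableAt I 𝓘(𝕜, 𝕜) f x)
    (hg : MDifferentiableAt I 𝓘(𝕜, 𝕜) g x) :
    dAt I (fun y => f y + g y) x = dAt I f x + dAt I g x :=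
  HasMFDerivAt.dAt_eq I (hf.hasMFDerivAt.add hg.hasMFDerivAt)

theorem dAt_const_mul {f : M → 𝕜} {x : M} (c : 𝕜) (hf : MDifferentiableAt I 𝓘(𝕜, 𝕜) f x) :
    dAt I (fun y => c * f y) x = c • dAt I f x :=
  HasMFDerivAt.dAt_eq I (hf.hasMFDerivAt.const_smul c)

theorem dAt_mul {f g : M → 𝕜} {x : M} (hf : MDifferentiableAt I 𝓘(𝕜, 𝕜) f x)
    (hg : MDifferentiableAt I 𝓘(𝕜, 𝕜) g x) :
    dAt I (fun y => f y * g y) x = f x • dAt I g x + g x • dAt I f x :=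
  HasMFDerivAt.dAt_eq I (hf.hasMFDerivAt.mul hg.hasMFDerivAt)

theorem dAt_const (c : 𝕜) (x : M) : dAt I (fun _ : M => c) x = 0 :=
  HasMFDerivAt.dAt_eq I (hasMFDerivAt_const c x)

theorem dAt_scalar_comp {f : M → 𝕜} {x : M} {u : 𝕜 → 𝕜} {u' : 𝕜} (hu : HasDerivAt u u' (f x))
    (hf : MDifferentiableAt I 𝓘(𝕜, 𝕜) f x) :
    dAt I (fun y => u (f y)) x = u' • dAt I f x := by
  refine (HasMFDerivAt.dAt_eq I (f := fun y => u (f y))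
    (hu.hasFDerivAt.hasMFDerivAt.comp x hf.hasMFDerivAt)).trans ?_
  ext v
  exact mul_comm _ _

theorem dAt_comp {f : M' → 𝕜} {φ : M → M'} {x : M}
    (hf : MDifferentiableAt I' 𝓘(𝕜, 𝕜) f (φ x)) (hφ : MDifferentiableAt I I' φ x) :
    dAt I (fun y => f (φ y)) x = dAt I' f (φ x) ∘ₗ (mfderiv I I' φ x).toLinearMap :=
  HasMFDerivAt.dAt_eq I (hf.hasMFDerivAt.comp x hφ.hasMFDerivAt)

theorem ContMDiffOn.mdifferentiableAt_of_mem {k : WithTop ℕ∞} (hk : k = ∞ ∨ k = ω)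
    {φ : M → M'} {U : Set M} (hφ : ContMDiffOn I I' k φ U) (hU : IsOpen U) {x : M} (hx : x ∈ U) :
    MDifferentiableAt I I' φ x :=
  (hφ.contMDiffAt (hU.mem_nhds hx)).mdifferentiableAt (regularity_ne_zero hk)

end Differential

/-! ### The poissonification is homogeneous Poisson -/

section Poissonification

variable {𝕜 : Type} [RCLike 𝕜]
  {E : Type*} [NormedAddCommGroup E] [NormedSpace 𝕜 E]
  {H : Type*} [TopologicalSpace H] (I : ModelWithCorners 𝕜 E H)
  {M : Type*} [TopologicalSpace M] [ChartedSpace H M] {k : WithTop ℕ∞}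

/-- The function `(x, t) ↦ f x + c t` on `M × 𝕜`. -/
def affineLift (f : M → 𝕜) (c : 𝕜) : M × 𝕜 → 𝕜 := fun p => f p.1 + c * p.2

/-- The function `(x, t) ↦ exp(t)⁻¹ f x` on `M × 𝕜`. -/
noncomputable def expLift (f : M → 𝕜) : M × 𝕜 → 𝕜 := fun p => (NormedSpace.exp p.2)⁻¹ * f p.1

theorem bivectorPairing_poissonificationBivector (π : BField I M) (X : VField I M) (p : M × 𝕜)
    (α β : Module.Dual 𝕜 (TangentSpace (I.prod 𝓘(𝕜, 𝕜)) p)) :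
    bivectorPairing (poissonificationBivector I π X p) α β = (NormedSpace.exp p.2)⁻¹ *
      (bivectorPairing (π p.1) (α ∘ₗ horizontal I p) (β ∘ₗ horizontal I p) +
        (α (poissonificationField I p) * (β ∘ₗ horizontal I p) (X p.1) -
        (α ∘ₗ horizontal I p) (X p.1) * β (poissonificationField I p))) := by
  rw [poissonificationBivector, bivectorPairing_smul, bivectorPairing_add,
    bivectorPairing_map, bivectorPairing_ιMulti]
  rfl

theorem dAt_comp_fst {f : M → 𝕜} {p : M × 𝕜} (hf : MDifferentiableAt I 𝓘(𝕜, 𝕜) f p.1) :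
    dAt (I.prod 𝓘(𝕜, 𝕜)) (fun q : M × 𝕜 => f q.1) p ∘ₗ horizontal I p = dAt I f p.1 ∧
    dAt (I.prod 𝓘(𝕜, 𝕜)) (fun q : M × 𝕜 => f q.1) p (poissonificationField I p) = 0 := by
  have h : HasMFDerivAt (I.prod 𝓘(𝕜, 𝕜)) 𝓘(𝕜, 𝕜) (fun q : M × 𝕜 => f q.1) p _ :=
    hf.hasMFDerivAt.comp p (hasMFDerivAt_fst (I := I) (I' := 𝓘(𝕜, 𝕜)) p)
  rw [HasMFDerivAt.dAt_eq _ h]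
  exact ⟨rfl, map_zero (mfderiv I 𝓘(𝕜, 𝕜) f p.1)⟩

theorem dAt_snd (p : M × 𝕜) :
    dAt (I.prod 𝓘(𝕜, 𝕜)) (fun q : M × 𝕜 => q.2) p ∘ₗ horizontal I p = 0 ∧
    dAt (I.prod 𝓘(𝕜, 𝕜)) (fun q : M × 𝕜 => q.2) p (poissonificationField I p) = 1 := by
  have h : HasMFDerivAt (I.prod 𝓘(𝕜, 𝕜)) 𝓘(𝕜, 𝕜) (fun q : M × 𝕜 => q.2) p _ :=
    hasMFDerivAt_snd (I := I) (I' := 𝓘(𝕜, 𝕜)) p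
  rw [HasMFDerivAt.dAt_eq _ h]
  exact ⟨rfl, rfl⟩

theorem mdifferentiableAt_comp_fst {f : M → 𝕜} {p : M × 𝕜}
    (hf : MDifferentiableAt I 𝓘(𝕜, 𝕜) f p.1) :
    MDifferentiableAt (I.prod 𝓘(𝕜, 𝕜)) 𝓘(𝕜, 𝕜) (fun q : M × 𝕜 => f q.1) p :=
  (hf.hasMFDerivAt.comp p (hasMFDerivAt_fst (I := I) (I' := 𝓘(𝕜, 𝕜)) p)).mdifferentiableAt

theorem mdifferentiableAt_comp_snd {u : 𝕜 → 𝕜} {u' : 𝕜} {p : M × 𝕜} (hu : HasDerivAt u u' p.2) :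
    MDifferentiableAt (I.prod 𝓘(𝕜, 𝕜)) 𝓘(𝕜, 𝕜) (fun q : M × 𝕜 => u q.2) p :=
  (hu.hasFDerivAt.hasMFDerivAt.comp p
    (hasMFDerivAt_snd (I := I) (I' := 𝓘(𝕜, 𝕜)) p)).mdifferentiableAt

theorem dAt_affineLift {f : M → 𝕜} {p : M × 𝕜} (c : 𝕜)
    (hf : MDifferentiableAt I 𝓘(𝕜, 𝕜) f p.1) :
    dAt (I.prod 𝓘(𝕜, 𝕜)) (affineLift f c) p ∘ₗ horizontal I p = dAt I f p.1 ∧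
    dAt (I.prod 𝓘(𝕜, 𝕜)) (affineLift f c) p (poissonificationField I p) = c := by
  have hs : MDifferentiableAt (I.prod 𝓘(𝕜, 𝕜)) 𝓘(𝕜, 𝕜) (fun q : M × 𝕜 => q.2) p :=
    mdifferentiableAt_comp_snd I (hasDerivAt_id p.2)
  have h : dAt (I.prod 𝓘(𝕜, 𝕜)) (affineLift f c) p =
      dAt (I.prod 𝓘(𝕜, 𝕜)) (fun q : M × 𝕜 => f q.1) p +
        c • dAt (I.prod 𝓘(𝕜, 𝕜)) (fun q : M × 𝕜 => q.2) p := by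
    rw [← dAt_const_mul _ c hs]
    exact dAt_add _ (mdifferentiableAt_comp_fst I hf) (hs.const_smul c)
  rw [h, LinearMap.add_comp, LinearMap.smul_comp, (dAt_comp_fst I hf).1, (dAt_snd I p).1,
    LinearMap.add_apply, LinearMap.smul_apply, (dAt_comp_fst I hf).2, (dAt_snd I p).2]
  simp

theorem dAt_expLift {f : M → 𝕜} {p : M × 𝕜} (hf : MDifferentiableAt I 𝓘(𝕜, 𝕜) f p.1) :
    dAt (I.prod 𝓘(𝕜, 𝕜)) (expLift f) p ∘ₗ horizontal I p =
      (NormedSpace.exp p.2)⁻¹ • dAt I f p.1 ∧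
    dAt (I.prod 𝓘(𝕜, 𝕜)) (expLift f) p (poissonificationField I p) =
      -((NormedSpace.exp p.2)⁻¹ * f p.1) := by
  have hs : MDifferentiableAt (I.prod 𝓘(𝕜, 𝕜)) 𝓘(𝕜, 𝕜) (fun q : M × 𝕜 => q.2) p :=
    mdifferentiableAt_comp_snd I (hasDerivAt_id p.2)
  have h : dAt (I.prod 𝓘(𝕜, 𝕜)) (expLift f) p =
      (NormedSpace.exp p.2)⁻¹ • dAt (I.prod 𝓘(𝕜, 𝕜)) (fun q : M × 𝕜 => f q.1) p +
        f p.1 • -(NormedSpace.exp p.2)⁻¹ • dAt (I.prod 𝓘(𝕜, 𝕜)) (fun q : M × 𝕜 => q.2) p := by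
    rw [← dAt_scalar_comp (I.prod 𝓘(𝕜, 𝕜)) (hasDerivAt_normedExp_inv p.2) hs]
    exact dAt_mul _ (mdifferentiableAt_comp_snd I (hasDerivAt_normedExp_inv p.2))
      (mdifferentiableAt_comp_fst I hf)
  rw [h, LinearMap.add_comp, LinearMap.smul_comp, LinearMap.smul_comp, LinearMap.smul_comp,
    (dAt_comp_fst I hf).1, (dAt_snd I p).1, LinearMap.add_apply, LinearMap.smul_apply,
    LinearMap.smul_apply, LinearMap.smul_apply, (dAt_comp_fst I hf).2, (dAt_snd I p).2]
  simp [mul_comm]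

/-- The function on `M` which, up to the factor `exp(-t)`, is the Poisson bracket of two
affine lifts. -/
noncomputable def affineBracket (π : BField I M) (X : VField I M) (f : M → 𝕜) (a : 𝕜)
    (g : M → 𝕜) (b : 𝕜) : M → 𝕜 :=
  fun x => bracket I π f g x + (a * derive I X g x + (-b) * derive I X f x)

/-- The term `Z ∧ X` contributes `a X[g] - b X[f]`. The result is no longer an affine lift but
`exp(-t)` times a function on `M`, whence the need for `bracket_expLift`. -/
theorem bracket_affineLift (π : BField I M) (X : VField I M) {f g : M → 𝕜} (a b : 𝕜) {p : M × 𝕜}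
    (hf : MDifferentiableAt I 𝓘(𝕜, 𝕜) f p.1) (hg : MDifferentiableAt I 𝓘(𝕜, 𝕜) g p.1) :
    bracket (I.prod 𝓘(𝕜, 𝕜)) (poissonificationBivector I π X) (affineLift f a) (affineLift g b) p =
      expLift (affineBracket I π X f a g b) p := by
  rw [bracket_apply, bivectorPairing_poissonificationBivector, (dAt_affineLift I a hf).1, (dAt_affineLift I a hf).2,
    (dAt_affineLift I b hg).1, (dAt_affineLift I b hg).2]
  simp only [expLift, affineBracket, bracket_apply, derive]
  ring

/-- The term `-f X[g]` comes from differentiating `exp(-t)` in `t`. It is responsible for `X ∧ π` in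
the Schouten square. -/
theorem bracket_expLift (π : BField I M) (X : VField I M) {f g : M → 𝕜} (b : 𝕜) {p : M × 𝕜}
    (hf : MDifferentiableAt I 𝓘(𝕜, 𝕜) f p.1) (hg : MDifferentiableAt I 𝓘(𝕜, 𝕜) g p.1) :
    bracket (I.prod 𝓘(𝕜, 𝕜)) (poissonificationBivector I π X) (expLift f) (affineLift g b) p =
      (NormedSpace.exp p.2)⁻¹ ^ 2 *
        (bracket I π f g p.1 - f p.1 * derive I X g p.1 - b * derive I X f p.1) := by
  rw [bracket_apply, bivectorPairing_poissonificationBivector, (dAt_expLift I hf).1, (dAt_expLift I hf).2,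
    (dAt_affineLift I b hg).1, (dAt_affineLift I b hg).2, bivectorPairing_smul_left]
  simp only [bracket_apply, derive, LinearMap.smul_apply, smul_eq_mul]
  ring

theorem bracket_congr (π : BField I M) {f f' g g' : M → 𝕜} {x : M} (hf : f =ᶠ[nhds x] f')
    (hg : g =ᶠ[nhds x] g') : bracket I π f g x = bracket I π f' g' x := by
  rw [bracket_apply, bracket_apply, dAt_congr I hf, dAt_congr I hg]

theorem derive_congr (X : VField I M) {f f' : M → 𝕜} {x : M} (hf : f =ᶠ[nhds x] f') :
    derive I X f x = derive I X f' x := by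
  rw [derive, derive, dAt_congr I hf]

theorem bracket_swap (π : BField I M) (f g : M → 𝕜) (x : M) :
    bracket I π g f x = -bracket I π f g x :=
  bivectorPairing_swap _ _ _

section

variable {π : BField I M} {X : VField I M} (hk : k = ∞ ∨ k = ω) (hJ : IsJacobi I k π X)
  {V : Set M} (hV : IsOpen V) {f g h : M → 𝕜} (hf : ContMDiffOn I 𝓘(𝕜, 𝕜) k f V)
  (hg : ContMDiffOn I 𝓘(𝕜, 𝕜) k g V) (hh : ContMDiffOn I 𝓘(𝕜, 𝕜) k h V)

include hJ hV hf hg in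
theorem contMDiffOn_affineBracket (a b : 𝕜) :
    ContMDiffOn I 𝓘(𝕜, 𝕜) k (affineBracket I π X f a g b) V :=
  (hJ.bivector_ck V hV f g hf hg).add
    ((contMDiffOn_const.mul (hJ.field_ck V hV g hg)).add
      (contMDiffOn_const.mul (hJ.field_ck V hV f hf)))

include hk hJ hV hf hg in
theorem dAt_affineBracket (a b : 𝕜) {x : M} (hx : x ∈ V) :
    dAt I (affineBracket I π X f a g b) x = dAt I (bracket I π f g) x +
      (a • dAt I (derive I X g) x + (-b) • dAt I (derive I X f) x) := by
  have h1 := ContMDiffOn.mdifferentiableAt_of_mem I hk (hJ.bivector_ck V hV f g hf hg) hV hx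
  have h2 := ContMDiffOn.mdifferentiableAt_of_mem I hk (hJ.field_ck V hV g hg) hV hx
  have h3 := ContMDiffOn.mdifferentiableAt_of_mem I hk (hJ.field_ck V hV f hf) hV hx
  rw [← dAt_const_mul I a h2, ← dAt_const_mul I (-b) h3,
    ← dAt_add I (f := fun y => a * derive I X g y) (g := fun y => -b * derive I X f y)
      (h2.const_smul a) (h3.const_smul (-b))]
  exact dAt_add I h1 ((h2.const_smul a).add (h3.const_smul (-b)))

include hk hV hf hg in
theorem bracket_affineLift_eventuallyEq (a b : 𝕜) {p : M × 𝕜} (hp : p.1 ∈ V) :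
    bracket (I.prod 𝓘(𝕜, 𝕜)) (poissonificationBivector I π X) (affineLift f a) (affineLift g b)
      =ᶠ[nhds p] expLift (affineBracket I π X f a g b) := by
  filter_upwards [(hV.preimage continuous_fst).mem_nhds hp] with q hq
  exact bracket_affineLift I π X a b (ContMDiffOn.mdifferentiableAt_of_mem I hk hf hV hq)
    (ContMDiffOn.mdifferentiableAt_of_mem I hk hg hV hq)

include hk hJ hV hf hg hh in
theorem bracket_bracket_affineLift (a b c : 𝕜) {p : M × 𝕜} (hp : p.1 ∈ V) :
    bracket (I.prod 𝓘(𝕜, 𝕜)) (poissonificationBivector I π X)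
      (bracket (I.prod 𝓘(𝕜, 𝕜)) (poissonificationBivector I π X) (affineLift f a)
        (affineLift g b)) (affineLift h c) p =
      (NormedSpace.exp p.2)⁻¹ ^ 2 *
        (bracket I π (bracket I π f g) h p.1 + a * bracket I π (derive I X g) h p.1 -
          b * bracket I π (derive I X f) h p.1 -
          affineBracket I π X f a g b p.1 * derive I X h p.1 -
          c * (derive I X (bracket I π f g) p.1 + a * derive I X (derive I X g) p.1 -
            b * derive I X (derive I X f) p.1)) := by
  rw [bracket_congr _ _ (bracket_affineLift_eventuallyEq I hk hV hf hg a b hp)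
    (Filter.EventuallyEq.refl _ _), bracket_expLift I π X c
    (ContMDiffOn.mdifferentiableAt_of_mem I hk (contMDiffOn_affineBracket I hJ hV hf hg a b) hV hp)
    (ContMDiffOn.mdifferentiableAt_of_mem I hk hh hV hp)]
  simp only [bracket_apply I π (affineBracket I π X f a g b), derive,
    dAt_affineBracket I hk hJ hV hf hg a b hp]
  simp only [bivectorPairing_add_left, bivectorPairing_smul_left, LinearMap.add_apply,
    LinearMap.smul_apply, smul_eq_mul, ← bracket_apply]
  simp only [← derive.eq_1]
  ring

include hk hJ hV hf hg hh in
-- The cyclic sum is a polynomial in `a, b, c`. Its constant term is `[π, π] - 2 X ∧ π`, its linear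
-- terms are multiples of `[X, π]` on pairs of the three functions, and the products of two
-- parameters cancel.
theorem schoutenSquare_affineLift (a b c : 𝕜) {p : M × 𝕜} (hp : p.1 ∈ V) :
    schoutenSquare (I.prod 𝓘(𝕜, 𝕜)) (poissonificationBivector I π X) (affineLift f a)
      (affineLift g b) (affineLift h c) p = 0 := by
  have hS := hJ.schouten V hV f g h hf hg hh p.1 hp
  have hfg := hJ.lie V hV f g hf hg p.1 hp
  have hgh := hJ.lie V hV g h hg hh p.1 hp
  have hhf := hJ.lie V hV h f hh hf p.1 hp
  simp only [schoutenSquare, wedgeVB, lieB] at hS hfg hgh hhf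
  rw [schoutenSquare, bracket_bracket_affineLift I hk hJ hV hf hg hh a b c hp,
    bracket_bracket_affineLift I hk hJ hV hg hh hf b c a hp,
    bracket_bracket_affineLift I hk hJ hV hh hf hg c a b hp]
  rw [bracket_swap I π _ f] at hfg
  rw [bracket_swap I π _ g] at hgh
  rw [bracket_swap I π _ h] at hhf
  simp only [affineBracket]
  linear_combination (NormedSpace.exp p.2)⁻¹ ^ 2 * (hS - 2 * c * hfg - 2 * a * hgh - 2 * b * hhf)

end

theorem contMDiffOn_expLift {f : M → 𝕜} {V : Set M} (hf : ContMDiffOn I 𝓘(𝕜, 𝕜) k f V) :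
    ContMDiffOn (I.prod 𝓘(𝕜, 𝕜)) 𝓘(𝕜, 𝕜) k (expLift f) (Prod.fst ⁻¹' V) :=
  (contDiff_normedExp_inv.contMDiff.comp_contMDiffOn contMDiffOn_snd).mul
    (hf.comp contMDiffOn_fst fun _ h => h)

/-- Since the chart of the factor `𝕜` is the identity, the linear coordinates on `M × 𝕜` are affine
lifts. By tensoriality they are the only functions to be tested. -/
theorem linCoord_prod (p : M × 𝕜) (α : E × 𝕜 →L[𝕜] 𝕜) :
    linCoord (I.prod 𝓘(𝕜, 𝕜)) p α =
      affineLift (linCoord I p.1 (α.comp (ContinuousLinearMap.inl 𝕜 E 𝕜))) (α (0, 1)) := by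
  funext q
  simp only [linCoord, affineLift, extChartAt_prod]
  have : (α ((extChartAt I p.1 q.1, q.2) : E × 𝕜)) =
      α (extChartAt I p.1 q.1, 0) + α (0, 1) * q.2 := by
    have h : ((extChartAt I p.1 q.1, q.2) : E × 𝕜) =
        (extChartAt I p.1 q.1, 0) + q.2 • (0, 1) := by simp
    rw [h, map_add, map_smul, smul_eq_mul, mul_comm]
  exact this

theorem extChartAt_prod_source (p : M × 𝕜) :
    (extChartAt (I.prod 𝓘(𝕜, 𝕜)) p).source = Prod.fst ⁻¹' (extChartAt I p.1).source := by
  rw [extChartAt_prod, PartialEquiv.prod_source, extChartAt_model_space_eq_id,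
    PartialEquiv.refl_source, Set.prod_univ]

theorem derive_affineLift (f : M → 𝕜) (c : 𝕜) (p : M × 𝕜)
    (hf : MDifferentiableAt I 𝓘(𝕜, 𝕜) f p.1) :
    derive (I.prod 𝓘(𝕜, 𝕜)) (poissonificationField I) (affineLift f c) p = c :=
  (dAt_affineLift I c hf).2

theorem isCompleteVField_poissonificationField [IsManifold I k M] :
    IsCompleteVField (I.prod 𝓘(𝕜, 𝕜)) k (poissonificationField I (M := M)) := by
  refine ⟨fun s p => (p.1, s + p.2), ?_, fun p => by simp, fun s t p => by simp [add_assoc],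
    fun t p => ?_⟩
  · exact (contMDiff_fst.comp contMDiff_snd).prodMk
      (contMDiff_fst.add (contMDiff_snd.comp contMDiff_snd))
  · have h1 : HasMFDerivAt 𝓘(𝕜, 𝕜) I (fun _ : 𝕜 => p.1) t _ := hasMFDerivAt_const p.1 t
    have h2 : HasMFDerivAt 𝓘(𝕜, 𝕜) 𝓘(𝕜, 𝕜) (fun s : 𝕜 => s + p.2) t _ :=
      ((hasFDerivAt_id t).add_const p.2).hasMFDerivAt
    have h3 := h1.prodMk h2
    have e : (1 : 𝕜 →L[𝕜] 𝕜).smulRight ((0, 1) : E × 𝕜) =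
        (0 : 𝕜 →L[𝕜] E).prod (ContinuousLinearMap.id 𝕜 𝕜) := by
      ext <;> simp
    exact e ▸ h3

variable [IsManifold I k M] [FiniteDimensional 𝕜 E] [I.Boundaryless]

/-- The poissonification of a Jacobi manifold is a homogeneous Poisson manifold. -/
theorem IsJacobi.isHomogeneousPoisson_poissonification (hk : k = ∞ ∨ k = ω) {π : BField I M}
    {X : VField I M} (hJ : IsJacobi I k π X) :
    IsHomogeneousPoisson (I.prod 𝓘(𝕜, 𝕜)) k (poissonificationBivector I π X)
      (poissonificationField I) := by
  have hπ : IsCkBField (I.prod 𝓘(𝕜, 𝕜)) k (poissonificationBivector I π X) := by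
    refine isCkBField_of_linCoord _ hk fun p α β => ?_
    rw [linCoord_prod, linCoord_prod, extChartAt_prod_source]
    set f := linCoord I p.1 (α.comp (ContinuousLinearMap.inl 𝕜 E 𝕜))
    set g := linCoord I p.1 (β.comp (ContinuousLinearMap.inl 𝕜 E 𝕜))
    have hV := isOpen_extChartAt_source (I := I) p.1
    have hf : ContMDiffOn I 𝓘(𝕜, 𝕜) k f _ := contMDiffOn_linCoord I p.1 _
    have hg : ContMDiffOn I 𝓘(𝕜, 𝕜) k g _ := contMDiffOn_linCoord I p.1 _
    exact (contMDiffOn_expLift I (contMDiffOn_affineBracket I hJ hV hf hg _ _)).congr fun q hq =>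
      (bracket_affineLift_eventuallyEq I hk hV hf hg _ _ hq).eq_of_nhds
  have hZ : IsCkVField (I.prod 𝓘(𝕜, 𝕜)) k (poissonificationField I (M := M)) := by
    refine isCkVField_of_linCoord _ hk fun p α => ?_
    rw [linCoord_prod, extChartAt_prod_source]
    exact contMDiffOn_const.congr fun q hq => derive_affineLift I _ _ q
      (ContMDiffOn.mdifferentiableAt_of_mem I hk (contMDiffOn_linCoord I p.1 _)
        (isOpen_extChartAt_source (I := I) p.1) hq)
  refine ⟨⟨hπ, ?_⟩, hZ, isCompleteVField_poissonificationField I, ?_⟩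
  -- Tensoriality replaces the three functions by affine lifts.
  · intro U hU f g h hf hg hh p hp
    rw [schoutenSquare_eq_linCoord _ hk hπ p hU hp hf hg hh]
    simp only [linCoord_prod]
    exact schoutenSquare_affineLift I hk hJ (isOpen_extChartAt_source (I := I) p.1)
      (contMDiffOn_linCoord I p.1 _) (contMDiffOn_linCoord I p.1 _)
      (contMDiffOn_linCoord I p.1 _) _ _ _ (mem_extChartAt_source p.1)
  · intro U hU f g hf hg p hp
    rw [lieB_eq_linCoord _ hk hπ hZ p hU hp hf hg, bracket_eq_linCoord _ hk _ p hU hp hf hg]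
    simp only [linCoord_prod]
    generalize localDeriv (I.prod 𝓘(𝕜, 𝕜)) p f (0, 1) = a
    generalize localDeriv (I.prod 𝓘(𝕜, 𝕜)) p g (0, 1) = b
    set F := linCoord I p.1 ((localDeriv (I.prod 𝓘(𝕜, 𝕜)) p f).comp
      (ContinuousLinearMap.inl 𝕜 E 𝕜))
    set G := linCoord I p.1 ((localDeriv (I.prod 𝓘(𝕜, 𝕜)) p g).comp
      (ContinuousLinearMap.inl 𝕜 E 𝕜))
    have hV := isOpen_extChartAt_source (I := I) p.1
    have hF : ContMDiffOn I 𝓘(𝕜, 𝕜) k F _ := contMDiffOn_linCoord I p.1 _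
    have hG : ContMDiffOn I 𝓘(𝕜, 𝕜) k G _ := contMDiffOn_linCoord I p.1 _
    have hp1 := mem_extChartAt_source (I := I) p.1
    -- `Z` sends an affine lift to a constant, so two of the three terms of `L_Z π` vanish. In the
    -- remaining one `Z` acts on `exp(-t)` times a function on `M`, that is, by `-1`.
    have hc : ∀ (K : M → 𝕜) (c : 𝕜), ContMDiffOn I 𝓘(𝕜, 𝕜) k K (extChartAt I p.1).source →
        derive (I.prod 𝓘(𝕜, 𝕜)) (poissonificationField I) (affineLift K c) =ᶠ[nhds p]
          fun _ => c := by
      intro K c hK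
      filter_upwards [(hV.preimage continuous_fst).mem_nhds hp1] with q hq
      exact derive_affineLift I K c q (ContMDiffOn.mdifferentiableAt_of_mem I hk hK hV hq)
    have hb := bracket_affineLift_eventuallyEq (π := π) (X := X) I hk hV hF hG a b
      (p := p) hp1
    rw [lieB, derive_congr _ _ hb, bracket_congr _ _ (hc F a hF) (Filter.EventuallyEq.refl _ _),
      bracket_congr _ _ (Filter.EventuallyEq.refl _ _) (hc G b hG), hb.eq_of_nhds]
    rw [derive, (dAt_expLift I (ContMDiffOn.mdifferentiableAt_of_mem I hk
      (contMDiffOn_affineBracket I hJ hV hF hG a b) hV hp1)).2, bracket_apply, bracket_apply,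
      dAt_const, dAt_const, ← zero_smul 𝕜 (0 : Module.Dual 𝕜 _), bivectorPairing_smul_left,
      bivectorPairing_smul_right]
    simp [expLift]

end Poissonification

/-! ### Singular locus of the poissonification -/

section SingularLocus

variable {𝕜 : Type} [RCLike 𝕜]
  {E : Type*} [NormedAddCommGroup E] [NormedSpace 𝕜 E]
  {H : Type*} [TopologicalSpace H] (I : ModelWithCorners 𝕜 E H)
  {M : Type*} [TopologicalSpace M] [ChartedSpace H M]

/-- The scalar factor `exp(-t)` is invertible, and `T(M × 𝕜)` is split by the two projections, so
the linear statement applies. -/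
theorem mem_poissonSing_poissonification [FiniteDimensional 𝕜 E] {n : ℕ}
    (hE : Module.finrank 𝕜 E = 2 * n + 1) (π : BField I M) (X : VField I M) (p : M × 𝕜) :
    p ∈ poissonSing (I.prod 𝓘(𝕜, 𝕜)) (n + 1) (poissonificationBivector I π X) ↔
      p.1 ∈ jacobiSing I n π X := by
  have : FiniteDimensional 𝕜 (TangentSpace I p.1) := inferInstanceAs (FiniteDimensional 𝕜 E)
  have hV : Module.finrank 𝕜 (TangentSpace I p.1) = 2 * n + 1 := hE
  refine Iff.trans ?_ (symplectization_pow_eq_zero_iff hV (j := horizontal I p)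
    (q := LinearMap.fst 𝕜 (TangentSpace I p.1) (TangentSpace 𝓘(𝕜, 𝕜) p.2))
    (d := LinearMap.snd 𝕜 (TangentSpace I p.1) (TangentSpace 𝓘(𝕜, 𝕜) p.2))
    (v := poissonificationField I p) rfl rfl rfl (π p.1) (X p.1))
  rw [poissonSing, Set.mem_ofPred_eq, poissonificationBivector, Submodule.coe_smul, smul_pow]
  exact smul_eq_zero_iff_right (pow_ne_zero _ (inv_ne_zero (normedExp_ne_zero p.2)))

end SingularLocus

/-! ### From contact resolutions to homogeneous symplectic resolutions -/

section Symplectization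

variable {𝕜 : Type} [RCLike 𝕜]
  {E : Type*} [NormedAddCommGroup E] [NormedSpace 𝕜 E] [FiniteDimensional 𝕜 E]
  {H : Type*} [TopologicalSpace H] {I : ModelWithCorners 𝕜 E H} [I.Boundaryless]
  {M : Type*} [TopologicalSpace M] [ChartedSpace H M] {k : WithTop ℕ∞} {n : ℕ}
  {π : BField I M} {X : VField I M}

omit [FiniteDimensional 𝕜 E] [I.Boundaryless] in
theorem mfderiv_prodMap_id {N : Type*} [TopologicalSpace N] [ChartedSpace H N] {φ : N → M}
    {s : N × 𝕜} (hφ : MDifferentiableAt I I φ s.1) :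
    (mfderiv (I.prod 𝓘(𝕜, 𝕜)) (I.prod 𝓘(𝕜, 𝕜)) (Prod.map φ id) s).toLinearMap ∘ₗ horizontal I s =
      horizontal I (Prod.map φ id s) ∘ₗ (mfderiv I I φ s.1).toLinearMap ∧
    mfderiv (I.prod 𝓘(𝕜, 𝕜)) (I.prod 𝓘(𝕜, 𝕜)) (Prod.map φ id) s (poissonificationField I s) =
      poissonificationField I (Prod.map φ id s) := by
  have h1 : HasMFDerivAt (I.prod 𝓘(𝕜, 𝕜)) I (fun q : N × 𝕜 => φ q.1) s _ :=
    hφ.hasMFDerivAt.comp s (hasMFDerivAt_fst (I := I) (I' := 𝓘(𝕜, 𝕜)) s)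
  have h2 : HasMFDerivAt (I.prod 𝓘(𝕜, 𝕜)) (I.prod 𝓘(𝕜, 𝕜)) (Prod.map φ id) s _ :=
    h1.prodMk (hasMFDerivAt_snd (I := I) (I' := 𝓘(𝕜, 𝕜)) s)
  rw [h2.mfderiv]
  exact ⟨rfl, Prod.ext (map_zero (mfderiv I I φ s.1)) rfl⟩

/-- The poissonification of a contact resolution is a homogeneous symplectic resolution of the
poissonification. -/
noncomputable def ContactResolution.symplectization (hk : k = ∞ ∨ k = ω)
    (hE : Module.finrank 𝕜 E = 2 * n + 1) (R : ContactResolution.{v} I k n π X) :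
    HomogeneousSymplecticResolution.{v} (I.prod 𝓘(𝕜, 𝕜)) k (n + 1)
      (poissonificationBivector I π X) (poissonificationField I) where
  carrier := R.carrier × 𝕜
  bivector := poissonificationBivector I R.bivector R.reeb
  field := poissonificationField I
  homogeneousPoisson := R.jacobi.isHomogeneousPoisson_poissonification I hk
  symplectic s hs := R.contact s.1 ((mem_poissonSing_poissonification I hE _ _ s).1 hs)
  φ := Prod.map R.φ id
  φ_ck := R.φ_ck.prodMap contMDiff_id
  φ_surjective := R.φ_surjective.prodMap Function.surjective_id
  φ_bivector s := by
    obtain ⟨hD, hZ⟩ := mfderiv_prodMap_id (s := s)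
      (R.φ_ck.mdifferentiable (regularity_ne_zero hk) s.1)
    have hγ (γ : Module.Dual 𝕜 (TangentSpace (I.prod 𝓘(𝕜, 𝕜)) (Prod.map R.φ id s))) :
        (γ ∘ₗ (mfderiv (I.prod 𝓘(𝕜, 𝕜)) (I.prod 𝓘(𝕜, 𝕜)) (Prod.map R.φ id) s).toLinearMap)
          (poissonificationField I s) = γ (poissonificationField I (Prod.map R.φ id s)) :=
      congrArg γ hZ
    refine bivector_ext fun α β => ?_
    rw [bivectorPairing_map, bivectorPairing_poissonificationBivector,
      bivectorPairing_poissonificationBivector, LinearMap.comp_assoc, LinearMap.comp_assoc, hD,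
      hγ, hγ]
    -- `φ × id` preserves `t`, so the exponential factors on both sides agree.
    simp only [Prod.map_fst, Prod.map_snd, id_eq]
    rw [← R.φ_bivector s.1, ← R.φ_reeb s.1, bivectorPairing_map]
    rfl
  φ_field s :=
    (mfderiv_prodMap_id (s := s) (R.φ_ck.mdifferentiable (regularity_ne_zero hk) s.1)).2

/-- The component of `(s, t)` contains the component of `s` times `{t}`, and membership in the
singular locus does not depend on `t`. -/
theorem ContactResolution.semiConnected_symplectization (hk : k = ∞ ∨ k = ω)
    (hE : Module.finrank 𝕜 E = 2 * n + 1) (R : ContactResolution.{v} I k n π X)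
    (h : SemiConnected R.φ (jacobiSing I n π X)) :
    SemiConnected (R.symplectization hk hE).φ
      (poissonSing (I.prod 𝓘(𝕜, 𝕜)) (n + 1) (poissonificationBivector I π X)) := by
  rintro ⟨s, t⟩ hs
  refine h s ?_
  rintro _ ⟨y, hy, rfl⟩
  have h1 : (y, t) ∈ connectedComponent (s, t) := by
    have h2 : IsPreconnected ((fun z : R.carrier => (z, t)) '' connectedComponent s) :=
      isPreconnected_connectedComponent.image _ (by fun_prop)
    exact h2.subset_connectedComponent ⟨s, mem_connectedComponent, rfl⟩ ⟨y, hy, rfl⟩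
  exact (mem_poissonSing_poissonification I hE π X (R.φ y, t)).1 (hs ⟨(y, t), h1, rfl⟩)

end Symplectization

/-! ### Charts adapted to a submersion -/

section SliceChart

variable {𝕜 : Type} [RCLike 𝕜]
  {F : Type*} [NormedAddCommGroup F] [NormedSpace 𝕜 F] [FiniteDimensional 𝕜 F]
  {E : Type*} [NormedAddCommGroup E] [NormedSpace 𝕜 E] [FiniteDimensional 𝕜 E]
  {H : Type*} [TopologicalSpace H] (I : ModelWithCorners 𝕜 F H) [I.Boundaryless]
  {N : Type*} [TopologicalSpace N] [ChartedSpace H N] {k : WithTop ℕ∞} [IsManifold I k N]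

omit [FiniteDimensional 𝕜 F] [FiniteDimensional 𝕜 E] in
-- Choose `z` with `d z = 1`. Then `F` is the sum of `ker d` and the line of `z`, and `ker d` is
-- isomorphic to `E` by dimension.
theorem exists_continuousLinearEquiv_snd_eq [FiniteDimensional 𝕜 F] [FiniteDimensional 𝕜 E]
    (hF : Module.finrank 𝕜 F = Module.finrank 𝕜 E + 1) (d : F →L[𝕜] 𝕜) (hd : d ≠ 0) :
    ∃ L : F ≃L[𝕜] E × 𝕜, ∀ v, (L v).2 = d v := by
  have hd' : d.toLinearMap ≠ 0 := fun h => hd (ContinuousLinearMap.coe_injective h)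
  obtain ⟨z, hz⟩ : ∃ z, d z = 1 := by
    obtain ⟨w, hw⟩ := DFunLike.ne_iff.1 hd
    exact ⟨(d w)⁻¹ • w, by rw [map_smul, smul_eq_mul]; exact inv_mul_cancel₀ hw⟩
  have hker : Module.finrank 𝕜 (LinearMap.ker d.toLinearMap) = Module.finrank 𝕜 E := by
    have := Module.Dual.finrank_ker_add_one_of_ne_zero (f := d.toLinearMap) hd'
    omega
  let A := LinearEquiv.ofFinrankEq _ _ hker
  let p : F →ₗ[𝕜] LinearMap.ker d.toLinearMap :=
    LinearMap.codRestrict _ (LinearMap.id - d.toLinearMap.smulRight z) fun v => by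
      simp [hz]
  let T : F →ₗ[𝕜] E × 𝕜 := (A.toLinearMap ∘ₗ p).prod d.toLinearMap
  have hT : Function.Injective T := by
    rw [← LinearMap.ker_eq_bot, LinearMap.ker_eq_bot']
    intro v hv
    have h1 : A (p v) = 0 := congrArg Prod.fst hv
    have h2 : d v = 0 := congrArg Prod.snd hv
    have h3 : (p v : F) = 0 := by rw [A.map_eq_zero_iff.1 h1]; rfl
    have h4 : (p v : F) = v - d v • z := rfl
    rwa [h4, h2, zero_smul, sub_zero] at h3
  have hfr : Module.finrank 𝕜 F = Module.finrank 𝕜 (E × 𝕜) := by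
    rw [Module.finrank_prod, Module.finrank_self, hF]
  exact ⟨(LinearEquiv.ofInjectiveOfFinrankEq T hT hfr).toContinuousLinearEquiv, fun v => rfl⟩

/-- The preferred chart at `x₀`, for a manifold without boundary, as a partial homeomorphism to the
model vector space. -/
noncomputable def vectorChartAt (x₀ : N) : OpenPartialHomeomorph N F :=
  (chartAt H x₀).transHomeomorph I.toHomeomorph

/-- Around a point where the differential of `τ` does not vanish, `τ` is the last coordinate of
a `C^k` chart. -/
theorem exists_sliceChart (hk : k = ∞ ∨ k = ω)
    (hF : Module.finrank 𝕜 F = Module.finrank 𝕜 E + 1) {τ : N → 𝕜}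
    (hτ : ContMDiff I 𝓘(𝕜, 𝕜) k τ) (x₀ : N) (hd : dAt I τ x₀ ≠ 0) :
    ∃ Ψ : OpenPartialHomeomorph N (E × 𝕜), x₀ ∈ Ψ.source ∧ (∀ y ∈ Ψ.source, (Ψ y).2 = τ y) ∧
      ContMDiffOn I 𝓘(𝕜, E × 𝕜) k Ψ Ψ.source ∧
      ContMDiffOn 𝓘(𝕜, E × 𝕜) I k Ψ.symm Ψ.target := by
  have : CompleteSpace F := FiniteDimensional.complete 𝕜 F
  have : CompleteSpace E := FiniteDimensional.complete 𝕜 E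
  have hk0 := regularity_ne_zero hk
  have hd0 : localDeriv I x₀ τ ≠ 0 := by
    intro h
    apply hd
    rw [dAt_eq_comp I hk x₀ (mem_extChartAt_source x₀) isOpen_univ (Set.mem_univ _)
      hτ.contMDiffOn]
    rw [localDeriv] at h
    rw [h]
    exact LinearMap.zero_comp _
  obtain ⟨L, hL⟩ := exists_continuousLinearEquiv_snd_eq (E := E) hF _ hd0
  set y₀ := extChartAt I x₀ x₀
  have hT : IsOpen (extChartAt I x₀).target := isOpen_extChartAt_target (I := I) x₀
  have hy₀ : y₀ ∈ (extChartAt I x₀).target := mem_extChartAt_target (I := I) x₀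
  have hτc : ContDiffOn 𝕜 k (localExpr I x₀ τ) (extChartAt I x₀).target :=
    (contDiffOn_localExpr I x₀ (hτ.contMDiffOn (s := Set.univ))).mono fun y hy => ⟨hy, trivial⟩
  -- The last coordinate of `L` is replaced by `τ` itself. The derivative at `y₀` is still `L`, so
  -- the inverse function theorem applies.
  let G : F → E × 𝕜 := fun y => ((L y).1, localExpr I x₀ τ y)
  have hG : ContDiffOn 𝕜 k G (extChartAt I x₀).target :=
    (contDiff_fst.comp L.contDiff).contDiffOn.prodMk hτc
  have hGd : HasFDerivAt G (L : F →L[𝕜] E × 𝕜) y₀ := by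
    have h1 : HasFDerivAt (fun y => (L y).1)
        ((ContinuousLinearMap.fst 𝕜 E 𝕜).comp (L : F →L[𝕜] E × 𝕜)) y₀ :=
      ((ContinuousLinearMap.fst 𝕜 E 𝕜).comp (L : F →L[𝕜] E × 𝕜)).hasFDerivAt
    have h2 := ((hτc.differentiableOn hk0).differentiableAt (hT.mem_nhds hy₀)).hasFDerivAt
    have h3 := h1.prodMk h2
    convert h3 using 1
    refine ContinuousLinearMap.ext fun v => Prod.ext rfl ?_
    exact hL v
  have hGy := hG.contDiffAt (hT.mem_nhds hy₀)
  let g := hGy.toOpenPartialHomeomorph G hGd hk0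
  -- The inverse must be `C^k` on its whole domain, not only near the image of `y₀`; hence the
  -- restriction to the open set where the derivative of `G` is invertible.
  let W : Set F := (extChartAt I x₀).target ∩
    (fderiv 𝕜 G) ⁻¹' Set.range ((↑) : (F ≃L[𝕜] E × 𝕜) → F →L[𝕜] E × 𝕜)
  have hW : IsOpen W :=
    (hG.continuousOn_fderiv_of_isOpen hT (one_le_regularity hk)).isOpen_inter_preimage hT
      ContinuousLinearEquiv.isOpen
  have hyW : y₀ ∈ W := ⟨hy₀, L, hGd.fderiv.symm⟩
  let g' := g.restrOpen W hW
  have hg's : g'.source = g.source ∩ W := g.restrOpen_source W hW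
  have hgsymm : ContDiffOn 𝕜 k g'.symm g'.target := by
    intro a ha
    have h1 : g'.symm a ∈ g.source ∩ W := hg's ▸ g'.map_target ha
    have ha' : a ∈ g.target := by
      have := g.map_source h1.1
      have h2 : g (g'.symm a) = a := g'.right_inv ha
      rwa [h2] at this
    obtain ⟨A, hA⟩ := h1.2.2
    have h3 := (hG.differentiableOn hk0).differentiableAt (hT.mem_nhds h1.2.1)
    have h4 : HasFDerivAt G (A : F →L[𝕜] E × 𝕜) (g.symm a) := by
      rw [hA]; exact h3.hasFDerivAt
    exact (g.contDiffAt_symm ha' h4 (hG.contDiffAt (hT.mem_nhds h1.2.1))).contDiffWithinAt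
  let e := vectorChartAt I x₀
  have hes : e.source = (extChartAt I x₀).source := by
    rw [extChartAt_source]; rfl
  refine ⟨e.trans g', ?_, ?_, ?_, ?_⟩
  · rw [OpenPartialHomeomorph.trans_source, hg's]
    exact ⟨hes ▸ mem_extChartAt_source x₀,
      hGy.mem_toOpenPartialHomeomorph_source hGd hk0, hyW⟩
  · intro y hy
    rw [OpenPartialHomeomorph.trans_source] at hy
    exact congrArg τ ((extChartAt I x₀).left_inv (hes ▸ hy.1))
  · rw [OpenPartialHomeomorph.trans_source, hg's]
    have h1 : ContMDiffOn I 𝓘(𝕜, F) k (extChartAt I x₀) (extChartAt I x₀).source := by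
      rw [extChartAt_source]; exact contMDiffOn_extChartAt
    exact hG.contMDiffOn.comp (h1.mono (hes ▸ Set.inter_subset_left)) fun y hy => hy.2.2.1
  · rw [OpenPartialHomeomorph.trans_target]
    refine (contMDiffOn_extChartAt_symm x₀).comp
      (hgsymm.contMDiffOn.mono Set.inter_subset_left) fun a ha => ?_
    have h1 : g'.symm a ∈ g.source ∩ W := hg's ▸ g'.map_target ha.1
    exact h1.2.1

end SliceChart

/-! ### The hypersurface `τ⁻¹(0)` as a manifold -/

section Slice

variable {𝕜 : Type} [RCLike 𝕜]
  {F : Type*} [NormedAddCommGroup F] [NormedSpace 𝕜 F]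
  {E : Type*} [NormedAddCommGroup E] [NormedSpace 𝕜 E]
  {H : Type*} [TopologicalSpace H] {I : ModelWithCorners 𝕜 F H}
  {N : Type v} [TopologicalSpace N] [ChartedSpace H N] {k : WithTop ℕ∞} {τ : N → 𝕜}

/-- The partial homeomorphism from `τ⁻¹(0)` to `E` induced by a chart of which `τ` is the last
coordinate. -/
noncomputable def sliceRestrict (Ψ : OpenPartialHomeomorph N (E × 𝕜))
    (hΨ : ∀ y ∈ Ψ.source, (Ψ y).2 = τ y) (s₀ : {x // τ x = 0}) :
    OpenPartialHomeomorph {x // τ x = 0} E := by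
  classical
  have hτ : ∀ e : E, (e, (0 : 𝕜)) ∈ Ψ.target → τ (Ψ.symm (e, 0)) = 0 := fun e he => by
    rw [← hΨ _ (Ψ.map_target he), Ψ.right_inv he]
  exact
  { toFun := fun s => (Ψ s.1).1
    -- The value `s₀` is a default, taken only outside the target.
    invFun := fun e => if h : τ (Ψ.symm (e, 0)) = 0 then ⟨Ψ.symm (e, 0), h⟩ else s₀
    source := Subtype.val ⁻¹' Ψ.source
    target := (fun e : E => (e, (0 : 𝕜))) ⁻¹' Ψ.target
    map_source' := fun s hs => by
      have h : ((Ψ s.1).1, (0 : 𝕜)) = Ψ s.1 := Prod.ext rfl (by rw [hΨ _ hs, s.2])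
      rw [Set.mem_preimage, h]
      exact Ψ.map_source hs
    map_target' := fun e he => by
      rw [Set.mem_preimage, dif_pos (hτ e he)]
      exact Ψ.map_target he
    left_inv' := fun s hs => by
      have h : ((Ψ s.1).1, (0 : 𝕜)) = Ψ s.1 := Prod.ext rfl (by rw [hΨ _ hs, s.2])
      have h2 : Ψ.symm ((Ψ s.1).1, (0 : 𝕜)) = s.1 := by rw [h]; exact Ψ.left_inv hs
      rw [dif_pos (by rw [h2, s.2])]
      exact Subtype.ext h2
    right_inv' := fun e he => by
      rw [dif_pos (hτ e he), Ψ.right_inv he]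
    open_source := Ψ.open_source.preimage continuous_subtype_val
    open_target := Ψ.open_target.preimage (by fun_prop)
    continuousOn_toFun := continuous_fst.comp_continuousOn
      (Ψ.continuousOn.comp continuous_subtype_val.continuousOn fun _ h => h)
    continuousOn_invFun := by
      have hi : Topology.IsInducing (Subtype.val : {x // τ x = 0} → N) := ⟨rfl⟩
      rw [hi.continuousOn_iff]
      have h : ContinuousOn (fun e : E => Ψ.symm (e, (0 : 𝕜)))
          ((fun e : E => (e, (0 : 𝕜))) ⁻¹' Ψ.target) :=
        Ψ.symm.continuousOn.comp (Continuous.continuousOn (by fun_prop)) fun _ h => h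
      refine h.congr fun e he => ?_
      simp only [Function.comp_apply]
      rw [dif_pos (hτ e he)] }

omit [NormedSpace 𝕜 E] in
theorem sliceRestrict_symm_val (Ψ : OpenPartialHomeomorph N (E × 𝕜))
    (hΨ : ∀ y ∈ Ψ.source, (Ψ y).2 = τ y) (s₀ : {x // τ x = 0}) {e : E}
    (he : (e, (0 : 𝕜)) ∈ Ψ.target) :
    ((sliceRestrict Ψ hΨ s₀).symm e).1 = Ψ.symm (e, 0) := by
  have hτ : τ (Ψ.symm (e, 0)) = 0 := by
    rw [← hΨ _ (Ψ.map_target he), Ψ.right_inv he]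
  change (if h : τ (Ψ.symm (e, 0)) = 0 then (⟨Ψ.symm (e, 0), h⟩ : {x // τ x = 0}) else s₀).1 = _
  rw [dif_pos hτ]

variable (I E k τ) in
/-- A family of charts around the points of `τ⁻¹(0)` of which `τ` is the last coordinate. -/
structure SliceAtlas where
  chart : {x // τ x = 0} → OpenPartialHomeomorph N (E × 𝕜)
  mem_source : ∀ s, s.1 ∈ (chart s).source
  snd_eq : ∀ s, ∀ y ∈ (chart s).source, (chart s y).2 = τ y
  contMDiffOn_chart : ∀ s, ContMDiffOn I 𝓘(𝕜, E × 𝕜) k (chart s) (chart s).source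
  contMDiffOn_symm : ∀ s, ContMDiffOn 𝓘(𝕜, E × 𝕜) I k (chart s).symm (chart s).target

namespace SliceAtlas

/-- The hypersurface `τ⁻¹(0)`. -/
def Slice (_A : SliceAtlas E I k τ) : Type v := {x // τ x = 0}

variable (A : SliceAtlas E I k τ)

instance : TopologicalSpace A.Slice := inferInstanceAs (TopologicalSpace {x // τ x = 0})

instance [T2Space N] : T2Space A.Slice := inferInstanceAs (T2Space {x // τ x = 0})

/-- The inclusion of `τ⁻¹(0)`. -/
def incl (s : A.Slice) : N := s.1

theorem isInducing_incl : Topology.IsInducing A.incl := ⟨rfl⟩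

theorem apply_incl (s : A.Slice) : τ (A.incl s) = 0 := s.2

theorem incl_injective : Function.Injective A.incl := Subtype.val_injective

/-- The charts depend on `A`; this is why `Slice` carries `A` as an argument instead of being the
bare subtype. -/
noncomputable instance : ChartedSpace E A.Slice where
  atlas := Set.range fun s : {x // τ x = 0} => sliceRestrict (A.chart s) (A.snd_eq s) s
  chartAt s := sliceRestrict (A.chart s) (A.snd_eq s) s
  mem_chart_source s := A.mem_source s
  chart_mem_atlas s := ⟨s, rfl⟩

theorem incl_chartAt_symm (s : A.Slice) {e : E} (he : (e, (0 : 𝕜)) ∈ (A.chart s).target) :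
    A.incl ((chartAt E s).symm e) = (A.chart s).symm (e, 0) :=
  sliceRestrict_symm_val _ (A.snd_eq s) s he

theorem contDiffOn_symm_inl (s : A.Slice) :
    ContMDiffOn 𝓘(𝕜, E) I k (fun e => (A.chart s).symm (e, 0)) (chartAt E s).target :=
  (A.contMDiffOn_symm s).comp
    ((contDiff_id.prodMk contDiff_const).contMDiff.contMDiffOn) fun _ h => h

/-- A change of charts is the first component of an ambient change of charts restricted to `E ×
{0}`. -/
instance : IsManifold 𝓘(𝕜, E) k A.Slice := by
  refine isManifold_of_contDiffOn _ _ _ ?_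
  suffices h : ∀ s t : A.Slice, ContDiffOn 𝕜 k
      (𝓘(𝕜, E) ∘ (chartAt E s).symm ≫ₕ (chartAt E t) ∘ 𝓘(𝕜, E).symm)
      (𝓘(𝕜, E).symm ⁻¹' ((chartAt E s).symm ≫ₕ (chartAt E t)).source ∩ Set.range 𝓘(𝕜, E)) by
    rintro _ _ ⟨s, rfl⟩ ⟨t, rfl⟩
    exact h s t
  intro s t
  have h1 : ContMDiffOn 𝓘(𝕜, E) 𝓘(𝕜, E) k
      (fun e => (A.chart t ((A.chart s).symm (e, 0))).1)
      ((chartAt E s).target ∩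
        (fun e => (A.chart s).symm (e, 0)) ⁻¹' (A.chart t).source) :=
    (contDiff_fst.contMDiff (n := k)).comp_contMDiffOn ((A.contMDiffOn_chart t).comp
      ((A.contDiffOn_symm_inl s).mono Set.inter_subset_left) fun _ h => h.2)
  refine (h1.contDiffOn.mono ?_).congr ?_
  · intro e he
    have he1 : e ∈ (chartAt E s).target := he.1.1
    refine ⟨he1, ?_⟩
    have h2 : A.incl ((chartAt E s).symm e) ∈ (A.chart t).source := he.1.2
    rwa [A.incl_chartAt_symm s he1] at h2
  · intro e he
    have he1 : e ∈ (chartAt E s).target := he.1.1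
    change (A.chart t (A.incl ((chartAt E s).symm e))).1 = _
    rw [A.incl_chartAt_symm s he1]

theorem contMDiff_incl : ContMDiff 𝓘(𝕜, E) I k A.incl := by
  intro s
  have h1 : ContMDiffOn 𝓘(𝕜, E) I k
      ((fun e => (A.chart s).symm (e, 0)) ∘ chartAt E s) (chartAt E s).source :=
    (A.contDiffOn_symm_inl s).comp (_root_.contMDiffOn_chart (I := 𝓘(𝕜, E)) (n := k))
      fun t ht => (chartAt E s).map_source ht
  refine (h1.contMDiffAt ((chartAt E s).open_source.mem_nhds (mem_chart_source E s))
    ).congr_of_eventuallyEq ?_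
  filter_upwards [(chartAt E s).open_source.mem_nhds (mem_chart_source E s)] with t ht
  rw [Function.comp_apply, ← A.incl_chartAt_symm s ((chartAt E s).map_source ht),
    (chartAt E s).left_inv ht]

/-- A map to `τ⁻¹(0)` is `C^k` if it is so as a map to the ambient manifold. -/
theorem contMDiff_of_incl_comp {F' : Type*} [NormedAddCommGroup F'] [NormedSpace 𝕜 F']
    {H' : Type*} [TopologicalSpace H'] {I' : ModelWithCorners 𝕜 F' H'}
    {N' : Type*} [TopologicalSpace N'] [ChartedSpace H' N'] {g : N' → A.Slice}
    (hg : ContMDiff I' I k (A.incl ∘ g)) : ContMDiff I' 𝓘(𝕜, E) k g := by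
  have hc : Continuous g := A.isInducing_incl.continuous_iff.2 hg.continuous
  intro x
  rw [contMDiffAt_iff_target]
  refine ⟨hc.continuousAt, ?_⟩
  have h1 : ContMDiffAt I 𝓘(𝕜, E) k (fun y => (A.chart (g x) y).1) (A.incl (g x)) :=
    (contDiff_fst.contMDiff (n := k)).contMDiffAt.comp _
      ((A.contMDiffOn_chart (g x)).contMDiffAt
        ((A.chart (g x)).open_source.mem_nhds (A.mem_source (g x))))
  exact ContMDiffAt.comp (f := A.incl ∘ g) x h1 hg.contMDiffAt

end SliceAtlas

/-- If the differential of `τ` does not vanish on `τ⁻¹(0)`, this hypersurface is a manifold. -/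
noncomputable def SliceAtlas.ofSubmersion [I.Boundaryless] [IsManifold I k N]
    [FiniteDimensional 𝕜 F] [FiniteDimensional 𝕜 E] (hk : k = ∞ ∨ k = ω)
    (hF : Module.finrank 𝕜 F = Module.finrank 𝕜 E + 1)
    (hτ : ContMDiff I 𝓘(𝕜, 𝕜) k τ) (hd : ∀ x, dAt I τ x ≠ 0) : SliceAtlas E I k τ where
  chart s := (exists_sliceChart (E := E) I hk hF hτ s.1 (hd s.1)).choose
  mem_source s := (exists_sliceChart (E := E) I hk hF hτ s.1 (hd s.1)).choose_spec.1
  snd_eq s := (exists_sliceChart (E := E) I hk hF hτ s.1 (hd s.1)).choose_spec.2.1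
  contMDiffOn_chart s := (exists_sliceChart (E := E) I hk hF hτ s.1 (hd s.1)).choose_spec.2.2.1
  contMDiffOn_symm s := (exists_sliceChart (E := E) I hk hF hτ s.1 (hd s.1)).choose_spec.2.2.2

end Slice

/-! ### Elementary differential equations with time in `𝕜` -/

section ScalarCurves

variable {𝕜 : Type} [RCLike 𝕜]

/-- Integrating factor: `exp(s) h(s)` has zero derivative. -/
theorem eq_exp_inv_mul_of_hasDerivAt_neg {h : 𝕜 → 𝕜} (hh : ∀ t, HasDerivAt h (-h t) t) (t : 𝕜) :
    h t = (NormedSpace.exp t)⁻¹ * h 0 := by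
  have h1 (s : 𝕜) : HasDerivAt (fun s => NormedSpace.exp s * h s) 0 s := by
    have h1 := (hasDerivAt_exp (𝕂 := 𝕜) (x := s)).fun_mul (hh s)
    have h2 : NormedSpace.exp s * h s + NormedSpace.exp s * -h s = 0 := by ring
    rwa [h2] at h1
  have h2 := is_const_of_deriv_eq_zero (fun s => (h1 s).differentiableAt)
    (fun s => (h1 s).deriv) t 0
  simp only [NormedSpace.exp_zero, one_mul] at h2
  rw [← h2, ← mul_assoc, inv_mul_cancel₀ (normedExp_ne_zero t), one_mul]

theorem eq_of_hasDerivAt_zero {h : 𝕜 → 𝕜} (hh : ∀ t, HasDerivAt h 0 t) (t : 𝕜) : h t = h 0 :=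
  is_const_of_deriv_eq_zero (fun s => (hh s).differentiableAt) (fun s => (hh s).deriv) t 0

theorem eq_add_of_hasDerivAt_one {h : 𝕜 → 𝕜} (hh : ∀ t, HasDerivAt h 1 t) (t : 𝕜) :
    h t = h 0 + t := by
  have h1 (s : 𝕜) : HasDerivAt (fun s => h s - s) 0 s := by
    simpa using (hh s).fun_sub (hasDerivAt_id' s)
  have h2 := eq_of_hasDerivAt_zero h1 t
  simp only [sub_zero] at h2
  rw [← h2]; ring

variable {E : Type*} [NormedAddCommGroup E] [NormedSpace 𝕜 E]
  {H : Type*} [TopologicalSpace H] {I : ModelWithCorners 𝕜 E H}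
  {M : Type*} [TopologicalSpace M] [ChartedSpace H M] {k : WithTop ℕ∞}

/-- A curve with zero derivative in a manifold is constant. -/
theorem eq_of_hasMFDerivAt_zero [IsManifold I k M] (hk : k = ∞ ∨ k = ω) {γ : 𝕜 → M}
    (hγ : ∀ t, HasMFDerivAt 𝓘(𝕜, 𝕜) I γ t 0) (t : 𝕜) : γ t = γ 0 := by
  -- Local constancy suffices because `𝕜` is connected. Locally the curve stays in one chart over a
  -- ball, where a function with zero derivative is constant.
  have hloc : IsLocallyConstant γ := by
    rw [IsLocallyConstant.iff_eventually_eq]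
    intro t₀
    set e := extChartAt I (γ t₀)
    have hnh : γ ⁻¹' e.source ∈ nhds t₀ :=
      (hγ t₀).continuousAt.preimage_mem_nhds (extChartAt_source_mem_nhds (γ t₀))
    obtain ⟨ε, hε, hball⟩ := Metric.mem_nhds_iff.1 hnh
    have hd : ∀ s ∈ Metric.ball t₀ ε, HasFDerivAt (e ∘ γ) (0 : 𝕜 →L[𝕜] E) s := by
      intro s hs
      have h1 : HasMFDerivAt I 𝓘(𝕜, E) e (γ s) _ :=
        ((contMDiffAt_extChartAt' (I := I) (n := k) (by simpa [e] using hball hs)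
          ).mdifferentiableAt (regularity_ne_zero hk)).hasMFDerivAt
      have h2 := h1.comp s (hγ s)
      rw [ContinuousLinearMap.comp_zero] at h2
      exact h2.hasFDerivAt
    have hconv : IsPreconnected (Metric.ball t₀ ε) := (convex_ball t₀ ε).isPreconnected
    filter_upwards [Metric.ball_mem_nhds t₀ hε] with s hs
    have h3 : e (γ s) = e (γ t₀) := Metric.isOpen_ball.is_const_of_fderiv_eq_zero hconv
      (f := e ∘ γ) (fun z hz => (hd z hz).differentiableAt.differentiableWithinAt)
      (fun z hz => (hd z hz).fderiv) hs (Metric.mem_ball_self hε)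
    exact e.injOn (hball hs) (hball (Metric.mem_ball_self hε)) h3
  exact hloc.apply_eq_of_preconnectedSpace t 0

end ScalarCurves

/-! ### Derivatives with transported target point -/

section MFDerivTo

variable {𝕜 : Type} [RCLike 𝕜]
  {F : Type*} [NormedAddCommGroup F] [NormedSpace 𝕜 F]
  {H : Type*} [TopologicalSpace H] (J : ModelWithCorners 𝕜 F H)
  {N : Type*} [TopologicalSpace N] [ChartedSpace H N]
  {E : Type*} [NormedAddCommGroup E] [NormedSpace 𝕜 E]
  {H' : Type*} [TopologicalSpace H'] (I : ModelWithCorners 𝕜 E H')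
  {S : Type*} [TopologicalSpace S] [ChartedSpace H' S]

/-- The derivative of `g` at `y`, as a map to the tangent space at a point `s` propositionally
equal to `g y`. -/
noncomputable def mfderivTo (g : N → S) (y : N) (s : S) (h : g y = s) :
    TangentSpace J y →ₗ[𝕜] TangentSpace I s :=
  h ▸ (mfderiv J I g y).toLinearMap

theorem dAt_comp_mfderivTo {g : N → S} {y : N} {s : S} (h : g y = s) {f : S → 𝕜}
    (hf : MDifferentiableAt I 𝓘(𝕜, 𝕜) f s) (hg : MDifferentiableAt J I g y) :
    dAt J (fun z => f (g z)) y = dAt I f s ∘ₗ mfderivTo J I g y s h := by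
  subst h
  exact dAt_comp J hf hg

theorem mfderivTo_comp_mfderiv {g : N → S} {i : S → N} (hgi : ∀ s, g (i s) = s) {s : S}
    (hg : MDifferentiableAt J I g (i s)) (hi : MDifferentiableAt I J i s) :
    mfderivTo J I g (i s) s (hgi s) ∘ₗ (mfderiv I J i s).toLinearMap = LinearMap.id := by
  -- The endpoint `s'` is generalized so that the equality of points can be substituted; the
  -- underlying vector of `E` is unaffected by the transport.
  have key : ∀ (f : S → S) (s' : S) (h : f s = s'), f = id → s' = s →
      ∀ v : TangentSpace I s, (mfderivTo I I f s s' h v : E) = v := by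
    rintro f s' h rfl rfl v
    change (mfderiv I I id s' v : E) = v
    rw [mfderiv_id]
    rfl
  have h2 : ∀ (s' : S) (h : g (i s) = s') (v : TangentSpace I s),
      mfderivTo J I g (i s) s' h (mfderiv I J i s v) = mfderivTo I I (g ∘ i) s s' h v := by
    rintro s' rfl v
    change mfderiv J I g (i s) (mfderiv I J i s v) = mfderiv I I (g ∘ i) s v
    rw [mfderiv_comp s hg hi]
    rfl
  refine LinearMap.ext fun v => ?_
  exact (h2 s (hgi s) v).trans (key (g ∘ i) s (hgi s) (funext hgi) rfl v)

end MFDerivTo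

/-! ### Composition of functions and maps with integral curves -/

section Velocity

variable {𝕜 : Type} [RCLike 𝕜]
  {F : Type*} [NormedAddCommGroup F] [NormedSpace 𝕜 F]
  {H : Type*} [TopologicalSpace H] (J : ModelWithCorners 𝕜 F H)
  {N : Type*} [TopologicalSpace N] [ChartedSpace H N]
  {γ : 𝕜 → N} {t : 𝕜} {v : TangentSpace J (γ t)}
  (hγ : HasMFDerivAt 𝓘(𝕜, 𝕜) J γ t ((1 : 𝕜 →L[𝕜] 𝕜).smulRight v))

include hγ in
theorem hasDerivAt_comp_of_velocity {h : N → 𝕜} (hh : MDifferentiableAt J 𝓘(𝕜, 𝕜) h (γ t)) :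
    HasDerivAt (fun s => h (γ s)) (dAt J h (γ t) v) t := by
  let D : 𝕜 →L[𝕜] 𝕜 := (mfderiv J 𝓘(𝕜, 𝕜) h (γ t)).comp ((1 : 𝕜 →L[𝕜] 𝕜).smulRight v)
  have h1 : HasFDerivAt (fun s => h (γ s)) D t := (hh.hasMFDerivAt.comp t hγ).hasFDerivAt
  have h2 : D 1 = dAt J h (γ t) v := congrArg (dAt J h (γ t)) (one_smul 𝕜 v)
  rw [← h2]
  exact h1.hasDerivAt

include hγ in
theorem hasMFDerivAt_comp_zero_of_velocity {E : Type*} [NormedAddCommGroup E] [NormedSpace 𝕜 E]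
    {H' : Type*} [TopologicalSpace H'] {I : ModelWithCorners 𝕜 E H'}
    {S : Type*} [TopologicalSpace S] [ChartedSpace H' S] {g : N → S}
    (hg : MDifferentiableAt J I g (γ t)) (hv : mfderiv J I g (γ t) v = 0) :
    HasMFDerivAt 𝓘(𝕜, 𝕜) I (fun s => g (γ s)) t 0 := by
  have h1 : (mfderiv J I g (γ t)).comp ((1 : 𝕜 →L[𝕜] 𝕜).smulRight v) = 0 := by
    refine ContinuousLinearMap.ext fun c => ?_
    rw [ContinuousLinearMap.comp_apply, ContinuousLinearMap.smulRight_apply, map_smul, hv,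
      smul_zero]
    rfl
  exact (hg.hasMFDerivAt.comp t hγ).congr_mfderiv h1

end Velocity

/-! ### The Jacobi structure on the zero level of a height function -/

section TransverseFlow

variable {𝕜 : Type} [RCLike 𝕜]
  {F : Type*} [NormedAddCommGroup F] [NormedSpace 𝕜 F]
  {H : Type*} [TopologicalSpace H] (J : ModelWithCorners 𝕜 F H)
  {N : Type v} [TopologicalSpace N] [ChartedSpace H N] (k : WithTop ℕ∞)

/-- A `C^k` flow generated by `Z`, with a `C^k` function which grows at unit speed along it. -/
structure TransverseFlow (Z : VField J N) (τ : N → 𝕜) where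
  flow : 𝕜 → N → N
  contMDiff_flow : ContMDiff (𝓘(𝕜, 𝕜).prod J) J k (fun p : 𝕜 × N => flow p.1 p.2)
  flow_zero : ∀ x, flow 0 x = x
  flow_add : ∀ s t x, flow (s + t) x = flow s (flow t x)
  hasMFDerivAt_flow : ∀ t x, HasMFDerivAt 𝓘(𝕜, 𝕜) J (fun s => flow s x) t
    ((1 : 𝕜 →L[𝕜] 𝕜).smulRight (Z (flow t x)))
  contMDiff_height : ContMDiff J 𝓘(𝕜, 𝕜) k τ
  height_flow : ∀ t x, τ (flow t x) = τ x + t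

namespace TransverseFlow

variable {J k} {Z : VField J N} {τ : N → 𝕜} (T : TransverseFlow J k Z τ)
  {E : Type*} [NormedAddCommGroup E] [NormedSpace 𝕜 E] (A : SliceAtlas E J k τ)

theorem hasDerivAt_comp_flow {h : N → 𝕜} {t : 𝕜} {x : N}
    (hh : MDifferentiableAt J 𝓘(𝕜, 𝕜) h (T.flow t x)) :
    HasDerivAt (fun s => h (T.flow s x)) (derive J Z h (T.flow t x)) t :=
  hasDerivAt_comp_of_velocity J (T.hasMFDerivAt_flow t x) hh

theorem derive_eq_of_hasDerivAt {h : N → 𝕜} {x : N} {c : 𝕜}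
    (hh : MDifferentiableAt J 𝓘(𝕜, 𝕜) h x)
    (hc : HasDerivAt (fun s => h (T.flow s x)) c 0) : derive J Z h x = c := by
  have h1 := T.hasDerivAt_comp_flow (h := h) (t := 0) (x := x) (by rwa [T.flow_zero])
  rw [T.flow_zero] at h1
  exact h1.unique hc

include T in
theorem mdifferentiableAt_height (hk : k = ∞ ∨ k = ω) (x : N) :
    MDifferentiableAt J 𝓘(𝕜, 𝕜) τ x :=
  T.contMDiff_height.mdifferentiable (regularity_ne_zero hk) x

include T in
theorem derive_height (hk : k = ∞ ∨ k = ω) (x : N) : derive J Z τ x = 1 := by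
  refine T.derive_eq_of_hasDerivAt (T.mdifferentiableAt_height hk x) ?_
  simp only [T.height_flow]
  simpa using (hasDerivAt_id (0 : 𝕜)).const_add (τ x)

include T in
theorem dAt_height_ne_zero (hk : k = ∞ ∨ k = ω) (x : N) : dAt J τ x ≠ 0 := by
  intro h
  have h1 := T.derive_height hk x
  rw [derive, h] at h1
  exact zero_ne_one h1

/-- The retraction onto `τ⁻¹(0)` along the flow. -/
def retract (y : N) : A.Slice :=
  ⟨T.flow (-τ y) y, by rw [T.height_flow, add_neg_cancel]⟩

theorem incl_retract (y : N) : A.incl (T.retract A y) = T.flow (-τ y) y := rfl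

theorem retract_incl (s : A.Slice) : T.retract A (A.incl s) = s := by
  apply A.incl_injective
  rw [T.incl_retract, A.apply_incl, neg_zero, T.flow_zero]

theorem flow_height_retract (y : N) : T.flow (τ y) (A.incl (T.retract A y)) = y := by
  rw [T.incl_retract, ← T.flow_add, add_neg_cancel, T.flow_zero]

theorem retract_flow (t : 𝕜) (y : N) : T.retract A (T.flow t y) = T.retract A y := by
  apply A.incl_injective
  rw [T.incl_retract, T.incl_retract, T.height_flow, ← T.flow_add]
  congr 1
  ring

/-- The ambient map is `y ↦ flow (-τ y) y`, a composite of `C^k` maps. -/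
theorem contMDiff_retract : ContMDiff J 𝓘(𝕜, E) k (T.retract A) := by
  refine A.contMDiff_of_incl_comp ?_
  have h1 : ContMDiff J (𝓘(𝕜, 𝕜).prod J) k (fun y : N => (-τ y, y)) :=
    (contDiff_neg.contMDiff.comp T.contMDiff_height).prodMk contMDiff_id
  exact T.contMDiff_flow.comp h1

theorem continuous_retract : Continuous (T.retract A) := (T.contMDiff_retract A).continuous

/-- The derivative of the retraction at a point of `τ⁻¹(0)`. -/
noncomputable def retractDeriv (s : A.Slice) :
    TangentSpace J (A.incl s) →ₗ[𝕜] TangentSpace 𝓘(𝕜, E) s :=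
  mfderivTo J 𝓘(𝕜, E) (T.retract A) (A.incl s) s (T.retract_incl A s)

/-- The pushforward to `τ⁻¹(0)` of the restriction of a bivector field. -/
noncomputable def sliceBivector (Λ : BField J N) : BField 𝓘(𝕜, E) A.Slice :=
  fun s => exteriorPower.map 2 (T.retractDeriv A s) (Λ (A.incl s))

/-- The pushforward to `τ⁻¹(0)` of the contraction of a bivector field with `dτ`. -/
noncomputable def sliceField [FiniteDimensional 𝕜 F] (Λ : BField J N) :
    VField 𝓘(𝕜, E) A.Slice :=
  fun s => T.retractDeriv A s
    (letI : FiniteDimensional 𝕜 (TangentSpace J (A.incl s)) :=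
      inferInstanceAs (FiniteDimensional 𝕜 F)
    bivectorContract (Λ (A.incl s)) (dAt J τ (A.incl s)))

theorem apply_sliceField [FiniteDimensional 𝕜 F] (Λ : BField J N) (s : A.Slice)
    (β : Module.Dual 𝕜 (TangentSpace 𝓘(𝕜, E) s)) :
    β (T.sliceField A Λ s) = bivectorPairing (Λ (A.incl s)) (dAt J τ (A.incl s))
      (β ∘ₗ T.retractDeriv A s) := by
  have : FiniteDimensional 𝕜 (TangentSpace J (A.incl s)) :=
    inferInstanceAs (FiniteDimensional 𝕜 F)
  exact apply_bivectorContract (Λ (A.incl s)) (dAt J τ (A.incl s)) (β ∘ₗ T.retractDeriv A s)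

section

variable (hk : k = ∞ ∨ k = ω)

include hk in
theorem dAt_comp_retract {f : A.Slice → 𝕜} {s : A.Slice}
    (hf : MDifferentiableAt 𝓘(𝕜, E) 𝓘(𝕜, 𝕜) f s) :
    dAt J (fun y => f (T.retract A y)) (A.incl s) = dAt 𝓘(𝕜, E) f s ∘ₗ T.retractDeriv A s :=
  dAt_comp_mfderivTo J 𝓘(𝕜, E) (T.retract_incl A s) hf
    ((T.contMDiff_retract A).mdifferentiable (regularity_ne_zero hk) _)

include hk in
theorem bracket_sliceBivector (Λ : BField J N) {f g : A.Slice → 𝕜} {s : A.Slice}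
    (hf : MDifferentiableAt 𝓘(𝕜, E) 𝓘(𝕜, 𝕜) f s) (hg : MDifferentiableAt 𝓘(𝕜, E) 𝓘(𝕜, 𝕜) g s) :
    bracket 𝓘(𝕜, E) (T.sliceBivector A Λ) f g s =
      bracket J Λ (fun y => f (T.retract A y)) (fun y => g (T.retract A y)) (A.incl s) := by
  rw [bracket_apply, bracket_apply, T.dAt_comp_retract A hk hf, T.dAt_comp_retract A hk hg,
    sliceBivector, bivectorPairing_map]

include hk in
theorem derive_sliceField [FiniteDimensional 𝕜 F] (Λ : BField J N) {f : A.Slice → 𝕜} {s : A.Slice}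
    (hf : MDifferentiableAt 𝓘(𝕜, E) 𝓘(𝕜, 𝕜) f s) :
    derive 𝓘(𝕜, E) (T.sliceField A Λ) f s =
      bracket J Λ τ (fun y => f (T.retract A y)) (A.incl s) := by
  rw [bracket_apply, T.dAt_comp_retract A hk hf, derive, T.apply_sliceField]

theorem contMDiffOn_comp_retract {f : A.Slice → 𝕜} {U : Set A.Slice}
    (hf : ContMDiffOn 𝓘(𝕜, E) 𝓘(𝕜, 𝕜) k f U) :
    ContMDiffOn J 𝓘(𝕜, 𝕜) k (fun y => f (T.retract A y)) (T.retract A ⁻¹' U) :=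
  hf.comp (T.contMDiff_retract A).contMDiffOn fun _ h => h

include hk in
/-- A function which is scaled by the flow is determined by its restriction to `τ⁻¹(0)`. -/
theorem eq_exp_mul_of_derive_eq_neg {B : N → 𝕜} {U : Set A.Slice} (hU : IsOpen U)
    (hB : ContMDiffOn J 𝓘(𝕜, 𝕜) k B (T.retract A ⁻¹' U))
    (hd : ∀ y ∈ T.retract A ⁻¹' U, derive J Z B y = -B y) {y : N} (hy : T.retract A y ∈ U) :
    B y = (NormedSpace.exp (τ y))⁻¹ * B (A.incl (T.retract A y)) := by
  have hW := hU.preimage (T.continuous_retract A)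
  have hmem (t : 𝕜) : T.flow t (A.incl (T.retract A y)) ∈ T.retract A ⁻¹' U := by
    rw [Set.mem_preimage, T.retract_flow, T.retract_incl]
    exact hy
  -- On the flow line through the retraction of `y`, `B` solves `B' = -B`. The point `y` itself is
  -- reached at time `τ y`.
  have h1 (t : 𝕜) : HasDerivAt (fun t => B (T.flow t (A.incl (T.retract A y))))
      (-B (T.flow t (A.incl (T.retract A y)))) t := by
    rw [← hd _ (hmem t)]
    exact T.hasDerivAt_comp_flow (ContMDiffOn.mdifferentiableAt_of_mem J hk hB hW (hmem t))
  have h2 := eq_exp_inv_mul_of_hasDerivAt_neg h1 (τ y)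
  simpa only [T.flow_height_retract, T.flow_zero] using h2

theorem derive_comp_retract {f : A.Slice → 𝕜} {y : N}
    (hf : MDifferentiableAt J 𝓘(𝕜, 𝕜) (fun y => f (T.retract A y)) y) :
    derive J Z (fun y => f (T.retract A y)) y = 0 := by
  refine T.derive_eq_of_hasDerivAt hf ?_
  simp only [T.retract_flow]
  exact hasDerivAt_const _ _

variable {Λ : BField J N} (hΛ : IsHomogeneousPoisson J k Λ Z)
  {U : Set A.Slice} (hU : IsOpen U) {f g : A.Slice → 𝕜}
  (hf : ContMDiffOn 𝓘(𝕜, E) 𝓘(𝕜, 𝕜) k f U) (hg : ContMDiffOn 𝓘(𝕜, E) 𝓘(𝕜, 𝕜) k g U)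

theorem bracket_const_left {M : Type*} [TopologicalSpace M] [ChartedSpace H M] (π : BField J M)
    {a b : M → 𝕜} {x : M} {c : 𝕜} (ha : a =ᶠ[nhds x] fun _ => c) : bracket J π a b x = 0 := by
  rw [bracket_apply, dAt_congr J ha, dAt_const, bivectorPairing_zero_left]

theorem bracket_const_right {M : Type*} [TopologicalSpace M] [ChartedSpace H M] (π : BField J M)
    {a b : M → 𝕜} {x : M} {c : 𝕜} (hb : b =ᶠ[nhds x] fun _ => c) : bracket J π a b x = 0 := by
  rw [bracket_swap, bracket_const_left π hb, neg_zero]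

include hk hU hf in
theorem derive_comp_retract_eventuallyEq {y : N} (hy : T.retract A y ∈ U) :
    derive J Z (fun y => f (T.retract A y)) =ᶠ[nhds y] fun _ => 0 := by
  have hW := hU.preimage (T.continuous_retract A)
  filter_upwards [hW.mem_nhds hy] with z hz
  exact T.derive_comp_retract A
    (ContMDiffOn.mdifferentiableAt_of_mem J hk (T.contMDiffOn_comp_retract A hf) hW hz)

include hk hΛ hU hf hg in
-- `Z` kills functions pulled back by the retraction, so `L_Z Λ = -Λ` says that their bracket is
-- scaled by `exp(-t)` along the flow.
theorem bracket_comp_retract {y : N} (hy : T.retract A y ∈ U) :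
    bracket J Λ (fun y => f (T.retract A y)) (fun y => g (T.retract A y)) y =
      (NormedSpace.exp (τ y))⁻¹ * bracket 𝓘(𝕜, E) (T.sliceBivector A Λ) f g (T.retract A y) := by
  have hW := hU.preimage (T.continuous_retract A)
  have hf' := T.contMDiffOn_comp_retract A hf
  have hg' := T.contMDiffOn_comp_retract A hg
  rw [T.bracket_sliceBivector A hk Λ (ContMDiffOn.mdifferentiableAt_of_mem _ hk hf hU hy)
    (ContMDiffOn.mdifferentiableAt_of_mem _ hk hg hU hy)]
  refine T.eq_exp_mul_of_derive_eq_neg A hk hU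
    (hΛ.poisson.bivector_ck _ hW _ _ hf' hg') (fun z hz => ?_) hy
  have := hΛ.homogeneous _ hW _ _ hf' hg' z hz
  rwa [lieB, bracket_const_left Λ (T.derive_comp_retract_eventuallyEq A hk hU hf hz),
    bracket_const_right Λ (T.derive_comp_retract_eventuallyEq A hk hU hg hz), sub_zero,
    sub_zero] at this

include hk hΛ hU hf in
-- Same argument: `Z[τ] = 1` is constant, hence has zero bracket with any function.
theorem bracket_height_comp_retract [FiniteDimensional 𝕜 F] {y : N} (hy : T.retract A y ∈ U) :
    bracket J Λ τ (fun y => f (T.retract A y)) y =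
      (NormedSpace.exp (τ y))⁻¹ * derive 𝓘(𝕜, E) (T.sliceField A Λ) f (T.retract A y) := by
  have hW := hU.preimage (T.continuous_retract A)
  have hf' := T.contMDiffOn_comp_retract A hf
  have hτ := T.contMDiff_height.contMDiffOn (s := T.retract A ⁻¹' U)
  rw [T.derive_sliceField A hk Λ (ContMDiffOn.mdifferentiableAt_of_mem _ hk hf hU hy)]
  refine T.eq_exp_mul_of_derive_eq_neg A hk hU
    (hΛ.poisson.bivector_ck _ hW _ _ hτ hf') (fun z hz => ?_) hy
  have := hΛ.homogeneous _ hW _ _ hτ hf' z hz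
  have h1 : derive J Z τ =ᶠ[nhds z] fun _ => 1 :=
    Filter.Eventually.of_forall fun w => T.derive_height hk w
  rwa [lieB, bracket_const_left Λ h1,
    bracket_const_right Λ (T.derive_comp_retract_eventuallyEq A hk hU hf hz), sub_zero,
    sub_zero] at this

include hk T in
-- Leibniz rule at a point where `exp(τ) = 1`. The second summand is the source of every difference
-- between the Poisson identity upstairs and the Jacobi identities on `τ⁻¹(0)`.
theorem bracket_exp_mul_left (s : A.Slice) {B h : N → 𝕜}
    (hB : MDifferentiableAt J 𝓘(𝕜, 𝕜) B (A.incl s)) :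
    bracket J Λ (fun y => NormedSpace.exp (τ y) * B y) h (A.incl s) =
      bracket J Λ B h (A.incl s) + B (A.incl s) * bracket J Λ τ h (A.incl s) := by
  have hτ := T.mdifferentiableAt_height hk (A.incl s)
  have he : HasDerivAt (NormedSpace.exp : 𝕜 → 𝕜) (NormedSpace.exp (τ (A.incl s)))
      (τ (A.incl s)) := hasDerivAt_exp
  have hem : MDifferentiableAt J 𝓘(𝕜, 𝕜) (fun y => NormedSpace.exp (τ y)) (A.incl s) :=
    (he.hasFDerivAt.hasMFDerivAt.comp _ hτ.hasMFDerivAt).mdifferentiableAt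
  rw [bracket_apply, dAt_mul J hem hB, dAt_scalar_comp J he hτ, A.apply_incl,
    NormedSpace.exp_zero, one_smul, one_smul, bivectorPairing_add_left, bivectorPairing_smul_left]
  rfl

include hk hΛ hU hf hg in
/-- The bracket on `τ⁻¹(0)`, pulled back to the ambient manifold. -/
theorem bracket_comp_retract_eventuallyEq {s : A.Slice} (hs : s ∈ U) :
    (fun y => bracket 𝓘(𝕜, E) (T.sliceBivector A Λ) f g (T.retract A y)) =ᶠ[nhds (A.incl s)]
      fun y => NormedSpace.exp (τ y) *
        bracket J Λ (fun y => f (T.retract A y)) (fun y => g (T.retract A y)) y := by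
  have hW := hU.preimage (T.continuous_retract A)
  have hsW : A.incl s ∈ T.retract A ⁻¹' U := by rwa [Set.mem_preimage, T.retract_incl]
  filter_upwards [hW.mem_nhds hsW] with y hy
  rw [T.bracket_comp_retract A hk hΛ hU hf hg hy, ← mul_assoc,
    mul_inv_cancel₀ (normedExp_ne_zero _), one_mul]

include hk hΛ hU hf in
theorem derive_comp_retract_eventuallyEq_exp [FiniteDimensional 𝕜 F] {s : A.Slice} (hs : s ∈ U) :
    (fun y => derive 𝓘(𝕜, E) (T.sliceField A Λ) f (T.retract A y)) =ᶠ[nhds (A.incl s)]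
      fun y => NormedSpace.exp (τ y) * bracket J Λ τ (fun y => f (T.retract A y)) y := by
  have hW := hU.preimage (T.continuous_retract A)
  have hsW : A.incl s ∈ T.retract A ⁻¹' U := by rwa [Set.mem_preimage, T.retract_incl]
  filter_upwards [hW.mem_nhds hsW] with y hy
  rw [T.bracket_height_comp_retract A hk hΛ hU hf hy, ← mul_assoc,
    mul_inv_cancel₀ (normedExp_ne_zero _), one_mul]

include hk hΛ in
theorem isCkBField_sliceBivector : IsCkBField 𝓘(𝕜, E) k (T.sliceBivector A Λ) := by
  intro U hU f g hf hg
  have h1 := hΛ.poisson.bivector_ck _ (hU.preimage (T.continuous_retract A)) _ _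
    (T.contMDiffOn_comp_retract A hf) (T.contMDiffOn_comp_retract A hg)
  refine (h1.comp A.contMDiff_incl.contMDiffOn fun s hs => ?_).congr fun s hs => ?_
  · rwa [Set.mem_preimage, Set.mem_preimage, T.retract_incl]
  · exact T.bracket_sliceBivector A hk Λ (ContMDiffOn.mdifferentiableAt_of_mem _ hk hf hU hs)
      (ContMDiffOn.mdifferentiableAt_of_mem _ hk hg hU hs)

include hk hΛ in
theorem isCkVField_sliceField [FiniteDimensional 𝕜 F] :
    IsCkVField 𝓘(𝕜, E) k (T.sliceField A Λ) := by
  intro U hU f hf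
  have h1 := hΛ.poisson.bivector_ck _ (hU.preimage (T.continuous_retract A)) _ _
    T.contMDiff_height.contMDiffOn (T.contMDiffOn_comp_retract A hf)
  refine (h1.comp A.contMDiff_incl.contMDiffOn fun s hs => ?_).congr fun s hs => ?_
  · rwa [Set.mem_preimage, Set.mem_preimage, T.retract_incl]
  · exact T.derive_sliceField A hk Λ (ContMDiffOn.mdifferentiableAt_of_mem _ hk hf hU hs)

include hk hΛ hU hf hg in
-- The inner bracket pulls back to `exp(τ)` times the ambient bracket, and differentiating this
-- factor gives the second summand.
theorem bracket_bracket_slice [FiniteDimensional 𝕜 F] {h : A.Slice → 𝕜}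
    (hh : ContMDiffOn 𝓘(𝕜, E) 𝓘(𝕜, 𝕜) k h U) {s : A.Slice} (hs : s ∈ U) :
    bracket 𝓘(𝕜, E) (T.sliceBivector A Λ) (bracket 𝓘(𝕜, E) (T.sliceBivector A Λ) f g) h s =
      bracket J Λ (bracket J Λ (fun y => f (T.retract A y)) (fun y => g (T.retract A y)))
        (fun y => h (T.retract A y)) (A.incl s) +
      bracket 𝓘(𝕜, E) (T.sliceBivector A Λ) f g s * derive 𝓘(𝕜, E) (T.sliceField A Λ) h s := by
  have hW := hU.preimage (T.continuous_retract A)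
  have hsW : A.incl s ∈ T.retract A ⁻¹' U := by rwa [Set.mem_preimage, T.retract_incl]
  have hfd := ContMDiffOn.mdifferentiableAt_of_mem _ hk hf hU hs
  have hgd := ContMDiffOn.mdifferentiableAt_of_mem _ hk hg hU hs
  have hhd := ContMDiffOn.mdifferentiableAt_of_mem _ hk hh hU hs
  rw [T.bracket_sliceBivector A hk Λ (ContMDiffOn.mdifferentiableAt_of_mem _ hk
      (T.isCkBField_sliceBivector A hk hΛ U hU f g hf hg) hU hs) hhd,
    bracket_congr J Λ (T.bracket_comp_retract_eventuallyEq A hk hΛ hU hf hg hs)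
      (Filter.EventuallyEq.refl _ _),
    T.bracket_exp_mul_left A hk s (ContMDiffOn.mdifferentiableAt_of_mem _ hk
      (hΛ.poisson.bivector_ck _ hW _ _ (T.contMDiffOn_comp_retract A hf)
        (T.contMDiffOn_comp_retract A hg)) hW hsW),
    T.bracket_sliceBivector A hk Λ hfd hgd, T.derive_sliceField A hk Λ hhd]

include hk hΛ hU hf in
theorem bracket_derive_slice [FiniteDimensional 𝕜 F] {h : A.Slice → 𝕜}
    (hh : ContMDiffOn 𝓘(𝕜, E) 𝓘(𝕜, 𝕜) k h U) {s : A.Slice} (hs : s ∈ U) :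
    bracket 𝓘(𝕜, E) (T.sliceBivector A Λ) (derive 𝓘(𝕜, E) (T.sliceField A Λ) f) h s =
      bracket J Λ (bracket J Λ τ (fun y => f (T.retract A y)))
        (fun y => h (T.retract A y)) (A.incl s) +
      derive 𝓘(𝕜, E) (T.sliceField A Λ) f s * derive 𝓘(𝕜, E) (T.sliceField A Λ) h s := by
  have hW := hU.preimage (T.continuous_retract A)
  have hsW : A.incl s ∈ T.retract A ⁻¹' U := by rwa [Set.mem_preimage, T.retract_incl]
  have hfd := ContMDiffOn.mdifferentiableAt_of_mem _ hk hf hU hs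
  have hhd := ContMDiffOn.mdifferentiableAt_of_mem _ hk hh hU hs
  rw [T.bracket_sliceBivector A hk Λ (ContMDiffOn.mdifferentiableAt_of_mem _ hk
      (T.isCkVField_sliceField A hk hΛ U hU f hf) hU hs) hhd,
    bracket_congr J Λ (T.derive_comp_retract_eventuallyEq_exp A hk hΛ hU hf hs)
      (Filter.EventuallyEq.refl _ _),
    T.bracket_exp_mul_left A hk s (ContMDiffOn.mdifferentiableAt_of_mem _ hk
      (hΛ.poisson.bivector_ck _ hW _ _ T.contMDiff_height.contMDiffOn
        (T.contMDiffOn_comp_retract A hf)) hW hsW),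
    T.derive_sliceField A hk Λ hfd, T.derive_sliceField A hk Λ hhd]

include hk hΛ hU hf hg in
-- No correction appears, because the derivative of `exp(τ)` is multiplied by `{τ, τ} = 0`.
theorem derive_bracket_slice [FiniteDimensional 𝕜 F] {s : A.Slice} (hs : s ∈ U) :
    derive 𝓘(𝕜, E) (T.sliceField A Λ) (bracket 𝓘(𝕜, E) (T.sliceBivector A Λ) f g) s =
      bracket J Λ τ (bracket J Λ (fun y => f (T.retract A y)) (fun y => g (T.retract A y)))
        (A.incl s) := by
  have hW := hU.preimage (T.continuous_retract A)
  have hsW : A.incl s ∈ T.retract A ⁻¹' U := by rwa [Set.mem_preimage, T.retract_incl]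
  rw [T.derive_sliceField A hk Λ (ContMDiffOn.mdifferentiableAt_of_mem _ hk
      (T.isCkBField_sliceBivector A hk hΛ U hU f g hf hg) hU hs),
    bracket_congr J Λ (Filter.EventuallyEq.refl _ _)
      (T.bracket_comp_retract_eventuallyEq A hk hΛ hU hf hg hs), bracket_swap,
    T.bracket_exp_mul_left A hk s (ContMDiffOn.mdifferentiableAt_of_mem _ hk
      (hΛ.poisson.bivector_ck _ hW _ _ (T.contMDiffOn_comp_retract A hf)
        (T.contMDiffOn_comp_retract A hg)) hW hsW),
    bracket_apply J Λ τ τ, bivectorPairing_self, mul_zero, add_zero, ← bracket_swap]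

include hk hΛ in
/-- The hypersurface `τ⁻¹(0)` is a Jacobi manifold. -/
theorem isJacobi_slice [FiniteDimensional 𝕜 F] :
    IsJacobi 𝓘(𝕜, E) k (T.sliceBivector A Λ) (T.sliceField A Λ) := by
  refine ⟨T.isCkBField_sliceBivector A hk hΛ, T.isCkVField_sliceField A hk hΛ, ?_, ?_⟩
  · intro U hU f g h hf hg hh s hs
    have hW := hU.preimage (T.continuous_retract A)
    have hsW : A.incl s ∈ T.retract A ⁻¹' U := by rwa [Set.mem_preimage, T.retract_incl]
    -- Ambient Jacobi identity on three pullbacks: the corrections `{f, g} E[h]` sum to `E ∧ π`.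
    have := hΛ.poisson.schouten _ hW _ _ _ (T.contMDiffOn_comp_retract A hf)
      (T.contMDiffOn_comp_retract A hg) (T.contMDiffOn_comp_retract A hh) _ hsW
    rw [schoutenSquare] at this ⊢
    rw [T.bracket_bracket_slice A hk hΛ hU hf hg hh hs,
      T.bracket_bracket_slice A hk hΛ hU hg hh hf hs,
      T.bracket_bracket_slice A hk hΛ hU hh hf hg hs, wedgeVB]
    linear_combination this
  · intro U hU f g hf hg s hs
    have hW := hU.preimage (T.continuous_retract A)
    have hsW : A.incl s ∈ T.retract A ⁻¹' U := by rwa [Set.mem_preimage, T.retract_incl]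
    -- Here the third function is `τ`. The two corrections `E[f] E[g]` cancel by antisymmetry.
    have := hΛ.poisson.schouten _ hW _ _ _ (T.contMDiffOn_comp_retract A hf)
      (T.contMDiffOn_comp_retract A hg) T.contMDiff_height.contMDiffOn _ hsW
    rw [schoutenSquare, bracket_swap J Λ τ (bracket J Λ _ _)] at this
    have h2 : bracket J Λ (bracket J Λ (fun y => g (T.retract A y)) τ)
        (fun y => f (T.retract A y)) (A.incl s) =
        -bracket J Λ (bracket J Λ τ (fun y => g (T.retract A y)))
          (fun y => f (T.retract A y)) (A.incl s) := by
      have h3 : bracket J Λ (fun y => g (T.retract A y)) τ =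
          fun y => -1 * bracket J Λ τ (fun y => g (T.retract A y)) y := by
        funext y
        rw [bracket_swap, neg_one_mul]
      rw [h3, bracket_apply, dAt_const_mul J (-1) (ContMDiffOn.mdifferentiableAt_of_mem _ hk
        (hΛ.poisson.bivector_ck _ hW _ _ T.contMDiff_height.contMDiffOn
          (T.contMDiffOn_comp_retract A hg)) hW hsW), bivectorPairing_smul_left, neg_one_mul]
      rfl
    rw [lieB, T.derive_bracket_slice A hk hΛ hU hf hg hs,
      T.bracket_derive_slice A hk hΛ hU hf hg hs, bracket_swap _ _ _ f,
      T.bracket_derive_slice A hk hΛ hU hg hf hs]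
    rw [h2] at this
    linear_combination -(1 / 2 : 𝕜) * this

end

end TransverseFlow

end TransverseFlow

/-! ### Bivectors on a space split by a hyperplane and a vector -/

section Hyperplane

variable {K : Type*} [Field K] {V : Type*} [AddCommGroup V] [Module K V]
  {W : Type*} [AddCommGroup W] [Module K W]
  {j : V →ₗ[K] W} {q : W →ₗ[K] V} {d : Module.Dual K W} {v : W}

/-- The map `(q, d)` to `V × K` is visibly onto, hence injective by dimension, and both sides have
the same image. -/
theorem eq_add_smul_of_finrank_eq_add_one [FiniteDimensional K V] [FiniteDimensional K W]
    (hW : Module.finrank K W = Module.finrank K V + 1)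
    (hq : q ∘ₗ j = LinearMap.id) (hd : d ∘ₗ j = 0) (hqv : q v = 0) (hdv : d v = 1) (w : W) :
    w = j (q w) + d w • v := by
  have hqj (x : V) : q (j x) = x := LinearMap.congr_fun hq x
  have hdj (x : V) : d (j x) = 0 := LinearMap.congr_fun hd x
  have hsurj : Function.Surjective (q.prod d) := fun p => ⟨j p.1 + p.2 • v, by
    ext <;> simp [hqj, hdj, hqv, hdv]⟩
  have hinj : Function.Injective (q.prod d) :=
    (LinearMap.injective_iff_surjective_of_finrank_eq_finrank
      (by rw [hW, Module.finrank_prod, Module.finrank_self])).2 hsurj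
  apply hinj
  ext <;> simp [hqj, hdj, hqv, hdv]

/-- Every covector is `(γ ∘ j) ∘ q + γ(v) d`. Expanding `π(α, β)` accordingly, the `d, d` term
vanishes and the mixed terms are contractions with `d`. -/
theorem eq_map_add_ιMulti_of_finrank_eq_add_one [FiniteDimensional K V] [FiniteDimensional K W]
    (hW : Module.finrank K W = Module.finrank K V + 1)
    (hq : q ∘ₗ j = LinearMap.id) (hd : d ∘ₗ j = 0) (hqv : q v = 0) (hdv : d v = 1)
    (π : ⋀[K]^2 W) :
    π = exteriorPower.map 2 j (exteriorPower.map 2 q π) +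
      exteriorPower.ιMulti K 2 ![v, j (q (bivectorContract π d))] := by
  refine bivector_ext fun α β => ?_
  have h (γ : Module.Dual K W) : γ = (γ ∘ₗ j) ∘ₗ q + γ v • d := by
    ext w
    conv_lhs => rw [eq_add_smul_of_finrank_eq_add_one hW hq hd hqv hdv w]
    simp [mul_comm]
  have hc (γ : Module.Dual K W) : γ (j (q (bivectorContract π d))) =
      bivectorPairing π d ((γ ∘ₗ j) ∘ₗ q) :=
    apply_bivectorContract π d ((γ ∘ₗ j) ∘ₗ q)
  rw [bivectorPairing_add, bivectorPairing_ιMulti, bivectorPairing_map, bivectorPairing_map, hc, hc]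
  conv_lhs => rw [h α, h β]
  rw [bivectorPairing_add_left, bivectorPairing_add_right, bivectorPairing_add_right,
    bivectorPairing_smul_left, bivectorPairing_smul_left, bivectorPairing_smul_right,
    bivectorPairing_smul_right, bivectorPairing_self, bivectorPairing_swap π d ((α ∘ₗ j) ∘ₗ q)]
  ring

end Hyperplane

/-! ### Nondegeneracy of the induced structure -/

namespace TransverseFlow

variable {𝕜 : Type} [RCLike 𝕜]
  {F : Type*} [NormedAddCommGroup F] [NormedSpace 𝕜 F] [FiniteDimensional 𝕜 F]
  {H : Type*} [TopologicalSpace H] {J : ModelWithCorners 𝕜 F H}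
  {N : Type v} [TopologicalSpace N] [ChartedSpace H N] {k : WithTop ℕ∞}
  {Z : VField J N} {τ : N → 𝕜} (T : TransverseFlow J k Z τ)
  {E : Type*} [NormedAddCommGroup E] [NormedSpace 𝕜 E] [FiniteDimensional 𝕜 E]
  (A : SliceAtlas E J k τ) (hk : k = ∞ ∨ k = ω)
  (hF : Module.finrank 𝕜 F = Module.finrank 𝕜 E + 1)

omit [FiniteDimensional 𝕜 F] [FiniteDimensional 𝕜 E] in
include hk in
-- The retraction is constant along flow lines; differentiate at time zero.
theorem mfderiv_retract_field (y : N) : mfderiv J 𝓘(𝕜, E) (T.retract A) y (Z y) = 0 := by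
  have h : ∀ y', T.flow 0 y = y' → mfderiv J 𝓘(𝕜, E) (T.retract A) y' (Z y') = 0 := by
    rintro _ rfl
    have h1 : HasMFDerivAt 𝓘(𝕜, 𝕜) 𝓘(𝕜, E) (fun t => T.retract A (T.flow t y)) 0 _ :=
      ((T.contMDiff_retract A).mdifferentiable (regularity_ne_zero hk) _).hasMFDerivAt.comp 0
        (T.hasMFDerivAt_flow 0 y)
    have h2 : HasMFDerivAt 𝓘(𝕜, 𝕜) 𝓘(𝕜, E) (fun t => T.retract A (T.flow t y)) 0 _ :=
      (hasMFDerivAt_const (T.retract A y) (0 : 𝕜)).congr_of_eventuallyEq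
        (Filter.Eventually.of_forall fun t => T.retract_flow A t y)
    have h3 := DFunLike.congr_fun (hasMFDerivAt_unique h1 h2) (1 : 𝕜)
    exact (congrArg (mfderiv J 𝓘(𝕜, E) (T.retract A) (T.flow 0 y))
      (one_smul 𝕜 (Z (T.flow 0 y)))).symm.trans h3
  exact h y (T.flow_zero y)

omit [FiniteDimensional 𝕜 F] [FiniteDimensional 𝕜 E] in
include hk in
theorem retractDeriv_field (s : A.Slice) : T.retractDeriv A s (Z (A.incl s)) = 0 := by
  have h : ∀ s' (hs : T.retract A (A.incl s) = s'),
      mfderivTo J 𝓘(𝕜, E) (T.retract A) (A.incl s) s' hs (Z (A.incl s)) = 0 := by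
    rintro _ rfl
    exact T.mfderiv_retract_field A hk (A.incl s)
  exact h s (T.retract_incl A s)

omit [FiniteDimensional 𝕜 F] [FiniteDimensional 𝕜 E] in
include hk in
theorem retractDeriv_comp_mfderiv_incl (s : A.Slice) :
    T.retractDeriv A s ∘ₗ (mfderiv 𝓘(𝕜, E) J A.incl s).toLinearMap = LinearMap.id :=
  mfderivTo_comp_mfderiv J 𝓘(𝕜, E) (T.retract_incl A)
    ((T.contMDiff_retract A).mdifferentiable (regularity_ne_zero hk) _)
    (A.contMDiff_incl.mdifferentiable (regularity_ne_zero hk) _)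

omit [FiniteDimensional 𝕜 F] [FiniteDimensional 𝕜 E] in
include hk T in
theorem dAt_height_comp_mfderiv_incl (s : A.Slice) :
    dAt J τ (A.incl s) ∘ₗ (mfderiv 𝓘(𝕜, E) J A.incl s).toLinearMap = 0 := by
  rw [← dAt_comp 𝓘(𝕜, E) (T.mdifferentiableAt_height hk _)
    (A.contMDiff_incl.mdifferentiable (regularity_ne_zero hk) _)]
  simp only [A.apply_incl]
  exact dAt_const _ _ _

include hk hF in
/-- The splitting of the tangent spaces at the points of `τ⁻¹(0)`. -/
theorem eq_mfderiv_incl_retractDeriv_add (s : A.Slice) (w : TangentSpace J (A.incl s)) :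
    w = mfderiv 𝓘(𝕜, E) J A.incl s (T.retractDeriv A s w) +
      dAt J τ (A.incl s) w • Z (A.incl s) := by
  have : FiniteDimensional 𝕜 (TangentSpace 𝓘(𝕜, E) s) :=
    inferInstanceAs (FiniteDimensional 𝕜 E)
  have : FiniteDimensional 𝕜 (TangentSpace J (A.incl s)) :=
    inferInstanceAs (FiniteDimensional 𝕜 F)
  exact eq_add_smul_of_finrank_eq_add_one
    (j := (mfderiv 𝓘(𝕜, E) J A.incl s).toLinearMap) hF
    (T.retractDeriv_comp_mfderiv_incl A hk s) (T.dAt_height_comp_mfderiv_incl A hk s)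
    (T.retractDeriv_field A hk s) (T.derive_height hk _) w

include hk hF in
-- Along `τ⁻¹(0)`, `Λ` has the form of a poissonification bivector at `t = 0`, to which the
-- computation of the top power applies.
theorem apply_incl_eq_map_sliceBivector_add (Λ : BField J N) (s : A.Slice) :
    Λ (A.incl s) = exteriorPower.map 2 (mfderiv 𝓘(𝕜, E) J A.incl s).toLinearMap
      (T.sliceBivector A Λ s) + exteriorPower.ιMulti 𝕜 2 ![Z (A.incl s),
        (mfderiv 𝓘(𝕜, E) J A.incl s).toLinearMap (T.sliceField A Λ s)] := by
  have hV : FiniteDimensional 𝕜 (TangentSpace 𝓘(𝕜, E) s) :=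
    inferInstanceAs (FiniteDimensional 𝕜 E)
  have hW : FiniteDimensional 𝕜 (TangentSpace J (A.incl s)) :=
    inferInstanceAs (FiniteDimensional 𝕜 F)
  have hF' : Module.finrank 𝕜 (TangentSpace J (A.incl s)) =
    Module.finrank 𝕜 (TangentSpace 𝓘(𝕜, E) s) + 1 := hF
  exact eq_map_add_ιMulti_of_finrank_eq_add_one hF'
    (T.retractDeriv_comp_mfderiv_incl A hk s) (T.dAt_height_comp_mfderiv_incl A hk s)
    (T.retractDeriv_field A hk s) (T.derive_height hk _) (Λ (A.incl s))

include hk hF in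
/-- If `Λ` is nondegenerate, then `τ⁻¹(0)` is a contact manifold. -/
theorem notMem_jacobiSing_slice {n : ℕ} (hE : Module.finrank 𝕜 E = 2 * n + 1) {Λ : BField J N}
    (s : A.Slice) (hs : A.incl s ∉ poissonSing J (n + 1) Λ) :
    s ∉ jacobiSing 𝓘(𝕜, E) n (T.sliceBivector A Λ) (T.sliceField A Λ) := by
  have hV : FiniteDimensional 𝕜 (TangentSpace 𝓘(𝕜, E) s) :=
    inferInstanceAs (FiniteDimensional 𝕜 E)
  intro h
  apply hs
  have hE' : Module.finrank 𝕜 (TangentSpace 𝓘(𝕜, E) s) = 2 * n + 1 := hE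
  have h4 := (symplectization_pow_eq_zero_iff hE'
    (T.retractDeriv_comp_mfderiv_incl A hk s) (T.dAt_height_comp_mfderiv_incl A hk s)
    (T.derive_height hk (A.incl s)) (T.sliceBivector A Λ s) (T.sliceField A Λ s)).2 h
  rw [← T.apply_incl_eq_map_sliceBivector_add A hk hF Λ s] at h4
  exact h4

end TransverseFlow

/-! ### From homogeneous symplectic resolutions to contact resolutions -/

namespace HomogeneousSymplecticResolution

variable {𝕜 : Type} [RCLike 𝕜]
  {E : Type*} [NormedAddCommGroup E] [NormedSpace 𝕜 E]
  {M : Type*} [TopologicalSpace M] [ChartedSpace E M] {k : WithTop ℕ∞} {n : ℕ}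
  {π : BField 𝓘(𝕜, E) M} {X : VField 𝓘(𝕜, E) M}
  (R : HomogeneousSymplecticResolution.{v} (𝓘(𝕜, E).prod 𝓘(𝕜, 𝕜)) k (n + 1)
    (poissonificationBivector 𝓘(𝕜, E) π X) (poissonificationField 𝓘(𝕜, E)))
  (hk : k = ∞ ∨ k = ω)

/-- The composition of the resolution with the projection to `M`. -/
def proj (y : R.carrier) : M := (R.φ y).1

/-- The composition of the resolution with the projection to `𝕜`. -/
def height (y : R.carrier) : 𝕜 := (R.φ y).2

theorem contMDiff_proj : ContMDiff (𝓘(𝕜, E).prod 𝓘(𝕜, 𝕜)) 𝓘(𝕜, E) k R.proj :=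
  contMDiff_fst.comp R.φ_ck

theorem contMDiff_height : ContMDiff (𝓘(𝕜, E).prod 𝓘(𝕜, 𝕜)) 𝓘(𝕜, 𝕜) k R.height :=
  contMDiff_snd.comp R.φ_ck

/-- The projection `T_(x,t) (M × 𝕜) → T_x M`. -/
noncomputable def horizontalProj (p : M × 𝕜) :
    TangentSpace (𝓘(𝕜, E).prod 𝓘(𝕜, 𝕜)) p →ₗ[𝕜] TangentSpace 𝓘(𝕜, E) p.1 :=
  LinearMap.fst 𝕜 (TangentSpace 𝓘(𝕜, E) p.1) (TangentSpace 𝓘(𝕜, 𝕜) p.2)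

include hk in
theorem mfderiv_proj (y : R.carrier) :
    (mfderiv (𝓘(𝕜, E).prod 𝓘(𝕜, 𝕜)) 𝓘(𝕜, E) R.proj y).toLinearMap =
      horizontalProj (R.φ y) ∘ₗ
        (mfderiv (𝓘(𝕜, E).prod 𝓘(𝕜, 𝕜)) (𝓘(𝕜, E).prod 𝓘(𝕜, 𝕜)) R.φ y).toLinearMap := by
  have h : HasMFDerivAt (𝓘(𝕜, E).prod 𝓘(𝕜, 𝕜)) 𝓘(𝕜, E) R.proj y _ :=
    (hasMFDerivAt_fst (I := 𝓘(𝕜, E)) (I' := 𝓘(𝕜, 𝕜)) (R.φ y)).comp y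
      (R.φ_ck.mdifferentiable (regularity_ne_zero hk) y).hasMFDerivAt
  rw [h.mfderiv]
  rfl

include hk in
theorem mfderiv_proj_field (y : R.carrier) :
    mfderiv (𝓘(𝕜, E).prod 𝓘(𝕜, 𝕜)) 𝓘(𝕜, E) R.proj y (R.field y) = 0 := by
  refine (LinearMap.congr_fun (R.mfderiv_proj hk y) (R.field y)).trans ?_
  exact congrArg (horizontalProj (R.φ y)) (R.φ_field y)

include hk in
theorem dAt_height (y : R.carrier) :
    dAt (𝓘(𝕜, E).prod 𝓘(𝕜, 𝕜)) R.height y =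
      dAt (𝓘(𝕜, E).prod 𝓘(𝕜, 𝕜)) (fun q : M × 𝕜 => q.2) (R.φ y) ∘ₗ
        (mfderiv (𝓘(𝕜, E).prod 𝓘(𝕜, 𝕜)) (𝓘(𝕜, E).prod 𝓘(𝕜, 𝕜)) R.φ y).toLinearMap :=
  dAt_comp (I' := 𝓘(𝕜, E).prod 𝓘(𝕜, 𝕜)) (𝓘(𝕜, E).prod 𝓘(𝕜, 𝕜))
    (hasMFDerivAt_snd (I := 𝓘(𝕜, E)) (I' := 𝓘(𝕜, 𝕜)) (R.φ y)).mdifferentiableAt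
    (R.φ_ck.mdifferentiable (regularity_ne_zero hk) y)

include hk in
theorem derive_height (y : R.carrier) :
    derive (𝓘(𝕜, E).prod 𝓘(𝕜, 𝕜)) R.field R.height y = 1 := by
  rw [derive, R.dAt_height hk]
  refine Eq.trans ?_ (dAt_snd 𝓘(𝕜, E) (R.φ y)).2
  exact congrArg (dAt (𝓘(𝕜, E).prod 𝓘(𝕜, 𝕜)) (fun q : M × 𝕜 => q.2) (R.φ y)) (R.φ_field y)

/-- The flow of a homogeneous symplectic resolution. -/
noncomputable def transverseFlow :
    TransverseFlow (𝓘(𝕜, E).prod 𝓘(𝕜, 𝕜)) k R.field R.height where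
  flow := R.homogeneousPoisson.complete.choose
  contMDiff_flow := R.homogeneousPoisson.complete.choose_spec.1
  flow_zero := R.homogeneousPoisson.complete.choose_spec.2.1
  flow_add := R.homogeneousPoisson.complete.choose_spec.2.2.1
  hasMFDerivAt_flow := R.homogeneousPoisson.complete.choose_spec.2.2.2
  contMDiff_height := R.contMDiff_height
  height_flow t x := by
    -- The field projects to `∂/∂t`, so the height has derivative `1` along the flow.
    have h (s : 𝕜) : HasDerivAt
        (fun s => R.height (R.homogeneousPoisson.complete.choose s x)) 1 s := by
      rw [← R.derive_height hk (R.homogeneousPoisson.complete.choose s x)]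
      exact hasDerivAt_comp_of_velocity _ (R.homogeneousPoisson.complete.choose_spec.2.2.2 s x)
        (R.contMDiff_height.mdifferentiable (regularity_ne_zero hk) _)
    have h3 := eq_add_of_hasDerivAt_one h t
    simp only [R.homogeneousPoisson.complete.choose_spec.2.1] at h3
    exact h3

/-- The field projects to `∂/∂t`, which has no component along `M`, so the curve in `M` has zero
velocity. -/
theorem proj_flow [IsManifold 𝓘(𝕜, E) k M] (t : 𝕜) (y : R.carrier) :
    R.proj ((R.transverseFlow hk).flow t y) = R.proj y := by
  have h (s : 𝕜) : HasMFDerivAt 𝓘(𝕜, 𝕜) 𝓘(𝕜, E)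
      (fun s => R.proj ((R.transverseFlow hk).flow s y)) s 0 :=
    hasMFDerivAt_comp_zero_of_velocity _ ((R.transverseFlow hk).hasMFDerivAt_flow s y)
      (R.contMDiff_proj.mdifferentiable (regularity_ne_zero hk) _) (R.mfderiv_proj_field hk _)
  have h2 := eq_of_hasMFDerivAt_zero hk h t
  simpa only [TransverseFlow.flow_zero] using h2

include hk in
/-- The bivector and the differential of the height at the zero level of the height. -/
theorem bivectorPairing_comp_mfderiv_proj {y : R.carrier} (hy : R.height y = 0)
    (α β : Module.Dual 𝕜 (TangentSpace 𝓘(𝕜, E) (R.proj y))) :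
    bivectorPairing (R.bivector y)
        (α ∘ₗ (mfderiv (𝓘(𝕜, E).prod 𝓘(𝕜, 𝕜)) 𝓘(𝕜, E) R.proj y).toLinearMap)
        (β ∘ₗ (mfderiv (𝓘(𝕜, E).prod 𝓘(𝕜, 𝕜)) 𝓘(𝕜, E) R.proj y).toLinearMap) =
      bivectorPairing (π (R.proj y)) α β ∧
    bivectorPairing (R.bivector y) (dAt (𝓘(𝕜, E).prod 𝓘(𝕜, 𝕜)) R.height y)
        (β ∘ₗ (mfderiv (𝓘(𝕜, E).prod 𝓘(𝕜, 𝕜)) 𝓘(𝕜, E) R.proj y).toLinearMap) =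
      β (X (R.proj y)) := by
  -- At height zero the exponential factor is `1`, so the bivector is pushed by `φ` to `π + Z ∧ X`.
  have key (γ δ : Module.Dual 𝕜 (TangentSpace (𝓘(𝕜, E).prod 𝓘(𝕜, 𝕜)) (R.φ y))) :
      bivectorPairing (R.bivector y)
        (γ ∘ₗ (mfderiv (𝓘(𝕜, E).prod 𝓘(𝕜, 𝕜)) (𝓘(𝕜, E).prod 𝓘(𝕜, 𝕜)) R.φ y).toLinearMap)
        (δ ∘ₗ (mfderiv (𝓘(𝕜, E).prod 𝓘(𝕜, 𝕜)) (𝓘(𝕜, E).prod 𝓘(𝕜, 𝕜)) R.φ y).toLinearMap) =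
      bivectorPairing (π (R.φ y).1) (γ ∘ₗ horizontal 𝓘(𝕜, E) (R.φ y))
          (δ ∘ₗ horizontal 𝓘(𝕜, E) (R.φ y)) +
        (γ (poissonificationField 𝓘(𝕜, E) (R.φ y)) *
          (δ ∘ₗ horizontal 𝓘(𝕜, E) (R.φ y)) (X (R.φ y).1) -
        (γ ∘ₗ horizontal 𝓘(𝕜, E) (R.φ y)) (X (R.φ y).1) *
          δ (poissonificationField 𝓘(𝕜, E) (R.φ y))) := by
    have hy' : (R.φ y).2 = 0 := hy
    rw [← bivectorPairing_map, R.φ_bivector, bivectorPairing_poissonificationBivector, hy',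
      NormedSpace.exp_zero, inv_one, one_mul]
  rw [R.mfderiv_proj hk, R.dAt_height hk]
  have hv (γ : Module.Dual 𝕜 (TangentSpace 𝓘(𝕜, E) (R.φ y).1)) :
      (γ ∘ₗ horizontalProj (R.φ y)) (poissonificationField 𝓘(𝕜, E) (R.φ y)) = 0 := map_zero γ
  have hh (γ : Module.Dual 𝕜 (TangentSpace 𝓘(𝕜, E) (R.φ y).1)) :
      (γ ∘ₗ horizontalProj (R.φ y)) ∘ₗ horizontal 𝓘(𝕜, E) (R.φ y) = γ := rfl
  have h1 (γ δ : Module.Dual 𝕜 (TangentSpace 𝓘(𝕜, E) (R.φ y).1)) :=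
    key (γ ∘ₗ horizontalProj (R.φ y)) (δ ∘ₗ horizontalProj (R.φ y))
  have h2 (δ : Module.Dual 𝕜 (TangentSpace 𝓘(𝕜, E) (R.φ y).1)) :=
    key (dAt (𝓘(𝕜, E).prod 𝓘(𝕜, 𝕜)) (fun q : M × 𝕜 => q.2) (R.φ y))
      (δ ∘ₗ horizontalProj (R.φ y))
  simp only [hv, hh, zero_mul, mul_zero, sub_zero, add_zero] at h1
  simp only [hv, hh, (dAt_snd 𝓘(𝕜, E) (R.φ y)).1, (dAt_snd 𝓘(𝕜, E) (R.φ y)).2, one_mul,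
    mul_zero, sub_zero, bivectorPairing_zero_left, zero_add] at h2
  exact ⟨h1 α β, h2 β⟩

variable [FiniteDimensional 𝕜 E]

/-- The atlas of the zero level of the height. -/
noncomputable def sliceAtlas : SliceAtlas E (𝓘(𝕜, E).prod 𝓘(𝕜, 𝕜)) k R.height :=
  SliceAtlas.ofSubmersion hk (by rw [Module.finrank_prod, Module.finrank_self])
    R.contMDiff_height ((R.transverseFlow hk).dAt_height_ne_zero hk)

variable [IsManifold 𝓘(𝕜, E) k M]

theorem proj_incl_retract (y : R.carrier) :
    R.proj ((R.sliceAtlas hk).incl ((R.transverseFlow hk).retract (R.sliceAtlas hk) y)) =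
      R.proj y := by
  rw [TransverseFlow.incl_retract, R.proj_flow]

omit [IsManifold 𝓘(𝕜, E) k M] in
-- A tangent vector and its retraction differ by a multiple of the homogeneity field, which the
-- derivative of `proj` kills.
theorem mfderiv_proj_incl_comp_retractDeriv (s : (R.sliceAtlas hk).Slice) :
    (mfderiv 𝓘(𝕜, E) 𝓘(𝕜, E) (fun s => R.proj ((R.sliceAtlas hk).incl s)) s).toLinearMap ∘ₗ
        (R.transverseFlow hk).retractDeriv (R.sliceAtlas hk) s =
      (mfderiv (𝓘(𝕜, E).prod 𝓘(𝕜, 𝕜)) 𝓘(𝕜, E) R.proj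
        ((R.sliceAtlas hk).incl s)).toLinearMap := by
  have h1 : mfderiv 𝓘(𝕜, E) 𝓘(𝕜, E) (fun s => R.proj ((R.sliceAtlas hk).incl s)) s =
      (mfderiv (𝓘(𝕜, E).prod 𝓘(𝕜, 𝕜)) 𝓘(𝕜, E) R.proj ((R.sliceAtlas hk).incl s)).comp
        (mfderiv 𝓘(𝕜, E) (𝓘(𝕜, E).prod 𝓘(𝕜, 𝕜)) (R.sliceAtlas hk).incl s) :=
    mfderiv_comp s (R.contMDiff_proj.mdifferentiable (regularity_ne_zero hk) _)
      ((R.sliceAtlas hk).contMDiff_incl.mdifferentiable (regularity_ne_zero hk) _)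
  rw [h1]
  refine LinearMap.ext fun w => ?_
  have h2 := congrArg
    (mfderiv (𝓘(𝕜, E).prod 𝓘(𝕜, 𝕜)) 𝓘(𝕜, E) R.proj ((R.sliceAtlas hk).incl s))
    ((R.transverseFlow hk).eq_mfderiv_incl_retractDeriv_add (R.sliceAtlas hk) hk
      (by rw [Module.finrank_prod, Module.finrank_self]) s w)
  rw [map_add, map_smul, R.mfderiv_proj_field hk, smul_zero, add_zero] at h2
  exact h2.symm

/-- The zero level of the height of a homogeneous symplectic resolution of the poissonification
is a contact resolution. -/
noncomputable def slice (hE : Module.finrank 𝕜 E = 2 * n + 1) :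
    ContactResolution.{v} 𝓘(𝕜, E) k n π X where
  carrier := (R.sliceAtlas hk).Slice
  bivector := (R.transverseFlow hk).sliceBivector (R.sliceAtlas hk) R.bivector
  reeb := (R.transverseFlow hk).sliceField (R.sliceAtlas hk) R.bivector
  jacobi := (R.transverseFlow hk).isJacobi_slice (R.sliceAtlas hk) hk R.homogeneousPoisson
  contact s := (R.transverseFlow hk).notMem_jacobiSing_slice (R.sliceAtlas hk) hk
    (by rw [Module.finrank_prod, Module.finrank_self]) hE s (R.symplectic _)
  φ s := R.proj ((R.sliceAtlas hk).incl s)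
  φ_ck := R.contMDiff_proj.comp (R.sliceAtlas hk).contMDiff_incl
  φ_surjective x := by
    -- Any preimage may be retracted to height zero, since the flow preserves the `M`-component.
    obtain ⟨y, hy⟩ := R.φ_surjective (x, 0)
    exact ⟨(R.transverseFlow hk).retract (R.sliceAtlas hk) y,
      (R.proj_incl_retract hk y).trans (congrArg Prod.fst hy)⟩
  φ_bivector s := by
    refine bivector_ext fun α β => ?_
    rw [bivectorPairing_map, TransverseFlow.sliceBivector, bivectorPairing_map,
      LinearMap.comp_assoc, LinearMap.comp_assoc, R.mfderiv_proj_incl_comp_retractDeriv hk]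
    exact (R.bivectorPairing_comp_mfderiv_proj hk ((R.sliceAtlas hk).apply_incl s) α β).1
  φ_reeb s := by
    rw [← sub_eq_zero, ← Module.forall_dual_apply_eq_zero_iff 𝕜]
    intro β
    rw [map_sub, sub_eq_zero]
    refine ((R.transverseFlow hk).apply_sliceField (R.sliceAtlas hk) R.bivector s
      (β ∘ₗ (mfderiv 𝓘(𝕜, E) 𝓘(𝕜, E)
        (fun s => R.proj ((R.sliceAtlas hk).incl s)) s).toLinearMap)).trans ?_
    rw [LinearMap.comp_assoc, R.mfderiv_proj_incl_comp_retractDeriv hk]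
    -- The first `β` is a dummy: the second conjunct involves one covector only.
    exact (R.bivectorPairing_comp_mfderiv_proj hk ((R.sliceAtlas hk).apply_incl s) β β).2

variable (hE : Module.finrank 𝕜 E = 2 * n + 1)

omit [IsManifold 𝓘(𝕜, E) k M] in
theorem isClosedEmbedding_incl :
    Topology.IsClosedEmbedding (R.sliceAtlas hk).incl := by
  refine ⟨⟨(R.sliceAtlas hk).isInducing_incl, (R.sliceAtlas hk).incl_injective⟩, ?_⟩
  have h : Set.range (R.sliceAtlas hk).incl = R.height ⁻¹' {0} := Subtype.range_coe
  rw [h]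
  exact isClosed_singleton.preimage R.contMDiff_height.continuous

/-- The restriction of `φ` to the closed set `τ⁻¹(0)` is proper and factors through the injective
continuous map `x ↦ (x, 0)`, which can be cancelled. -/
theorem isProperMap_slice (h : IsProperMap R.φ) : IsProperMap (R.slice hk hE).φ := by
  have h1 : IsProperMap (R.φ ∘ (R.sliceAtlas hk).incl) :=
    h.comp (R.isClosedEmbedding_incl hk).isProperMap
  have h2 : R.φ ∘ (R.sliceAtlas hk).incl = (fun x : M => (x, (0 : 𝕜))) ∘ (R.slice hk hE).φ :=
    funext fun s => Prod.ext rfl ((R.sliceAtlas hk).apply_incl s)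
  rw [h2] at h1
  exact isProperMap_of_comp_of_inj (R.slice hk hE).φ_ck.continuous (by fun_prop) h1
    (Prod.mk_left_injective 0)

/-- The retraction carries the component of `incl s` into the component of `s` without changing the
image in `M`. If the latter component went into the singular locus, so would the former. -/
theorem semiConnected_slice
    (h : SemiConnected R.φ (poissonSing (𝓘(𝕜, E).prod 𝓘(𝕜, 𝕜)) (n + 1)
      (poissonificationBivector 𝓘(𝕜, E) π X))) :
    SemiConnected (R.slice hk hE).φ (jacobiSing 𝓘(𝕜, E) n π X) := by
  intro (s : (R.sliceAtlas hk).Slice) hs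
  refine h ((R.sliceAtlas hk).incl s) ?_
  rintro _ ⟨y, hy, rfl⟩
  rw [mem_poissonSing_poissonification 𝓘(𝕜, E) hE]
  have h1 := ((R.transverseFlow hk).continuous_retract
    (R.sliceAtlas hk)).image_connectedComponent_subset ((R.sliceAtlas hk).incl s)
    ⟨y, hy, rfl⟩
  rw [TransverseFlow.retract_incl] at h1
  have h2 := hs ⟨_, h1, rfl⟩
  exact Set.mem_of_eq_of_mem (R.proj_incl_retract hk y).symm h2

/-- Separability does not pass to closed subspaces in general, but it does pass to continuous
images, here under the retraction. -/
theorem separableSpace_slice (h : TopologicalSpace.SeparableSpace R.carrier) :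
    TopologicalSpace.SeparableSpace (R.slice hk hE).carrier := by
  have h1 : Function.Surjective ((R.transverseFlow hk).retract (R.sliceAtlas hk)) :=
    fun s => ⟨_, (R.transverseFlow hk).retract_incl (R.sliceAtlas hk) s⟩
  exact h1.denseRange.separableSpace ((R.transverseFlow hk).continuous_retract (R.sliceAtlas hk))

/-- Second countability is hereditary, so the inclusion suffices. -/
theorem secondCountableTopology_slice (h : SecondCountableTopology R.carrier) :
    SecondCountableTopology (R.slice hk hE).carrier :=
  (R.sliceAtlas hk).isInducing_incl.secondCountableTopology

end HomogeneousSymplecticResolution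

end JacobiGeometry

/-! ### The four equivalences -/

theorem mainTheorem2 {𝕜 : Type} [RCLike 𝕜] (k : WithTop ℕ∞) (hk : k = ∞ ∨ k = ω)
    (n : ℕ)
    {E : Type uE} [NormedAddCommGroup E] [NormedSpace 𝕜 E] [FiniteDimensional 𝕜 E]
    (hE : Module.finrank 𝕜 E = 2 * n + 1)
    {M : Type u} [TopologicalSpace M] [T2Space M] [ChartedSpace E M] [IsManifold 𝓘(𝕜, E) k M]
    (π : JacobiGeometry.BField 𝓘(𝕜, E) M) (X : JacobiGeometry.VField 𝓘(𝕜, E) M)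
    (hJ : JacobiGeometry.IsJacobi 𝓘(𝕜, E) k π X) :
    -- proper resolutions
    ((∃ R : JacobiGeometry.ContactResolution.{v} 𝓘(𝕜, E) k n π X, IsProperMap R.φ) ↔
      ∃ R : JacobiGeometry.HomogeneousSymplecticResolution.{v}
        (𝓘(𝕜, E).prod 𝓘(𝕜, 𝕜)) k (n + 1)
        (JacobiGeometry.poissonificationBivector 𝓘(𝕜, E) π X)
        (JacobiGeometry.poissonificationField 𝓘(𝕜, E)), IsProperMap R.φ) ∧
    -- semi-connected resolutions
    ((∃ R : JacobiGeometry.ContactResolution.{v} 𝓘(𝕜, E) k n π X,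
        JacobiGeometry.SemiConnected R.φ (JacobiGeometry.jacobiSing 𝓘(𝕜, E) n π X)) ↔
      ∃ R : JacobiGeometry.HomogeneousSymplecticResolution.{v}
        (𝓘(𝕜, E).prod 𝓘(𝕜, 𝕜)) k (n + 1)
        (JacobiGeometry.poissonificationBivector 𝓘(𝕜, E) π X)
        (JacobiGeometry.poissonificationField 𝓘(𝕜, E)),
        JacobiGeometry.SemiConnected R.φ
          (JacobiGeometry.poissonSing (𝓘(𝕜, E).prod 𝓘(𝕜, 𝕜)) (n + 1)
            (JacobiGeometry.poissonificationBivector 𝓘(𝕜, E) π X))) ∧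
    -- separable resolutions
    ((∃ R : JacobiGeometry.ContactResolution.{v} 𝓘(𝕜, E) k n π X,
        TopologicalSpace.SeparableSpace R.carrier) ↔
      ∃ R : JacobiGeometry.HomogeneousSymplecticResolution.{v}
        (𝓘(𝕜, E).prod 𝓘(𝕜, 𝕜)) k (n + 1)
        (JacobiGeometry.poissonificationBivector 𝓘(𝕜, E) π X)
        (JacobiGeometry.poissonificationField 𝓘(𝕜, E)),
        TopologicalSpace.SeparableSpace R.carrier) ∧
    -- second countable resolutions
    ((∃ R : JacobiGeometry.ContactResolution.{v} 𝓘(𝕜, E) k n π X,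
        SecondCountableTopology R.carrier) ↔
      ∃ R : JacobiGeometry.HomogeneousSymplecticResolution.{v}
        (𝓘(𝕜, E).prod 𝓘(𝕜, 𝕜)) k (n + 1)
        (JacobiGeometry.poissonificationBivector 𝓘(𝕜, E) π X)
        (JacobiGeometry.poissonificationField 𝓘(𝕜, E)),
        SecondCountableTopology R.carrier) := by
  refine ⟨⟨?_, ?_⟩, ⟨?_, ?_⟩, ⟨?_, ?_⟩, ⟨?_, ?_⟩⟩
  · rintro ⟨R, hR⟩
    exact ⟨R.symplectization hk hE, hR.prodMap isProperMap_id⟩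
  · rintro ⟨R, hR⟩
    exact ⟨R.slice hk hE, R.isProperMap_slice hk hE hR⟩
  · rintro ⟨R, hR⟩
    exact ⟨R.symplectization hk hE, R.semiConnected_symplectization hk hE hR⟩
  · rintro ⟨R, hR⟩
    exact ⟨R.slice hk hE, R.semiConnected_slice hk hE hR⟩
  · rintro ⟨R, hR⟩
    exact ⟨R.symplectization hk hE,
      inferInstanceAs (TopologicalSpace.SeparableSpace (R.carrier × 𝕜))⟩
  · rintro ⟨R, hR⟩
    exact ⟨R.slice hk hE, R.separableSpace_slice hk hE hR⟩
  · rintro ⟨R, hR⟩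
    exact ⟨R.symplectization hk hE,
      inferInstanceAs (SecondCountableTopology (R.carrier × 𝕜))⟩
  · rintro ⟨R, hR⟩
    exact ⟨R.slice hk hE, R.secondCountableTopology_slice hk hE hR⟩
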